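/- **Setting.** Let $\mathcal P$ be a finite set of participants and $\mathcal R\subseteq\mathcal P$ the set of reliable ones. Between any two different participants $p,q$ there is a perfect FIFO channel $pq$. An action is a send $pq!m$ (performed by $p$), a receive $pq?m$ (performed by $q$) or an internal action of one participant; $\mathsf{crash}_p$ is a reserved internal action. A FIFO system consists of one FIFO automaton (finitely many states and transitions, an initial state, no final states) for each participant; initially all channels are empty. $\lightning$ is a special message, and *data actions* are sends and receives of messages other than $\lightning$. *Crash-stop local types* are $T ::= q?\{m_i(B_i).T_i\}_{i\in I}\mid q!\{m_i(B_i).T_i\}_{i\in I}\mid \mu t.T\mid t\mid \mathsf{end}\mid\mathsf{stop}$. The type of $p$ is closed, its recursion variables are pairwise distinct, and it has no subterm $\mu t_1\cdots\mu t_n.t$ ($n\ge 1$, $t$ a variable). Choices are non-empty, have a peer $q\ne p$ and pairwise distinct labels; the crash-handling label $\mathsf{crash}$ may occur only in external choices $q?\{\dots\}$, and not as the only label. Write $\mathrm{strip}(T)$ for $T$ without its leading recursions. *Translation.* The automaton of $p$ with type $T_0$ has as states the types occurring in $T_0$ that are neither variables nor recursions, the state $\mathsf{stop}$, and auxiliary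 states $q_{\mathrm{sink}}$ and $q_{\mathrm{send},r}$ ($r\neq p$). Its initial state is $\mathrm{strip}(T_0)$. The target of a branch with continuation $T_k$ is $\mathrm{strip}(T_k)$ if $T_k$ is not a variable, and $\mathrm{strip}(T')$ if $T_k=t$ and $\mu t.T'$ occurs in $T_0$. The transitions are: (a) every branch of a choice with a label other than $\mathsf{crash}$ gives the corresponding send or receive of $m_k(B_k)$ to its target; (b) a branch labelled $\mathsf{crash}$ of $q?\{\dots\}$ gives $qp?\lightning$ to its target; (c) if $p\notin\mathcal R$, every choice has the transition $\mathsf{crash}_p$ to $q_{\mathrm{sink}}$, followed by sends of $\lightning$ to all other participants $r_1,\dots,r_n$, in a fixed order that is part of the data and may be any, through $q_{\mathrm{send},r_1},\dots,q_{\mathrm{send},r_{n-1}}$, ending in $\mathsf{stop}$; (d) $\mathsf{end}$ and $\mathsf{stop}$ have self-loops $qp?\lightning$ for all $q\neq p$. *Crash-handling.* A system is crash-handling (for $\mathcal R$) if for every $p$ the states can be partitioned into $Q_1,Q_2,Q_3$ and the transitions into $\delta_1,\delta_2$ such that $\delta_1$ consists of data actions from $Q_1$ to $Q_1\cup Q_2$,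 $\delta_2$ contains no data action, and $\delta_2$ is a minimal set (under inclusion) with: for each $(s,rp?m,s')\in\delta_1$ with $r\notin\mathcal R$ there is $(s,rp?\lightning,s'')\in\delta_2$ with $s''\in Q_1\cup Q_2$; if $p\notin\mathcal R$, then from each $s\in Q_1$ there is a path in $\delta_2$ labelled $\mathsf{crash}_p$ and then $pr_1!\lightning,\dots,pr_n!\lightning$, for some enumeration without repetition of the other participants, that ends in $Q_2$ and whose intermediate states are in $Q_3$; and $(s,rp?\lightning,s)\in\delta_2$ for all $s\in Q_2$ and $r\neq p$. *RSC.* In a sequence of actions, a matching pair consists of the $k$-th send and a later $k$-th receive on the same channel, with the same message. Interactions are matching pairs, unmatched sends and internal actions; a valid communication is a set of interactions such that each position is in exactly one of them. Two actions commute if they have different active participants and are not a matching pair; the conflict graph has the interactions as vertices, with an edge from $v$ to $w$ if some action of $v$ precedes, and does not commute with, an action of $w$. A system is RSC if each of its executions (with each of its valid communications) has the same conflict graph, up to isomorphism preserving the actions, as some sequence in which all matching pairs are at consecutive positions. *$k$-WMC.* A configuration is $k$-bounded if no channel contains more than $k$ messages; consider only runs through $k$-bounded configurations. A system is $k$-WMC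 if for each configuration reached from the initial one by such a run: whenever a channel $pq$ has first message $m$, some such run continues and then performs $pq?m$; and whenever $p$ is in a sending state (one with outgoing sends and no outgoing receives, internal actions being disregarded), each of its outgoing sends can be performed at the end of some such run. **Theorem 6.** Consider the FIFO system generated by the translation from a collection of crash-stop local types, one for each participant. 1. If the external choices that have a crash-handling branch are exactly those whose peer is unreliable, then the system is crash-handling. 2. It is decidable whether the system is RSC: there is an algorithm that decides this, given the participants, the reliable participants, the local types and the orders of the broadcasts (participants, labels, payload types and variables being numbered). 3. It is decidable whether the system is $k$-WMC: there is an algorithm that decides this, given $k\in\mathbb N$ and the same data. -/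

import Mathlib

namespace CrashStop

/-! ### Actions and FIFO systems -/

/-- Names of internal actions; `crash` is the reserved one. -/
inductive InternalName where
  | crash
  | other (i : ℕ)

/-- Actions over the set of participants `P` and the message alphabet `A`. The channel from `p` to
`q` is used by `send p q a` (performed by `p`) and by `recv p q a` (performed by `q`);
`internal p c` is an internal action of `p`. -/
inductive Act (P A : Type) where
  | send (p q : P) (a : A)
  | recv (p q : P) (a : A)
  | internal (p : P) (c : InternalName)

namespace Act

variable {P A : Type}

/-- The active participant of an action. -/
def actor : Act P A → P
  | send p _ _ => p
  | recv _ q _ => q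
  | internal p _ => p

/-- Channels connect two different participants. -/
def OnChannel : Act P A → Prop
  | send p q _ => p ≠ q
  | recv p q _ => p ≠ q
  | internal _ _ => True

def IsSend : Act P A → Prop
  | send _ _ _ => True
  | _ => False

def IsRecv : Act P A → Prop
  | recv _ _ _ => True
  | _ => False

def IsInternal : Act P A → Prop
  | internal _ _ => True
  | _ => False

/-- Is the action a send on the channel from `p` to `q`? -/
def sendsOn [DecidableEq P] (p q : P) : Act P A → Bool
  | send p' q' _ => decide (p' = p) && decide (q' = q)
  | _ => false

/-- Is the action a receive on the channel from `p` to `q`? -/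
def recvsOn [DecidableEq P] (p q : P) : Act P A → Bool
  | recv p' q' _ => decide (p' = p) && decide (q' = q)
  | _ => false

end Act

/-- A FIFO automaton of participant `p`. -/
structure FIFOAutomaton (P A : Type) (p : P) where
  State : Type
  finite_state : Finite State
  init : State
  trans : Set (State × Act P A × State)
  finite_trans : trans.Finite
  actor_eq : ∀ s a s', (s, a, s') ∈ trans → a.actor = p
  onChannel : ∀ s a s', (s, a, s') ∈ trans → a.OnChannel

/-- A sending state has outgoing sends and no outgoing receives. Internal actions are disregarded:
they involve no channel. -/
def FIFOAutomaton.IsSending {P A : Type} {p : P} (M : FIFOAutomaton P A p) (s : M.State) : Prop :=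
  (∃ a s', (s, a, s') ∈ M.trans ∧ a.IsSend) ∧ ∀ a s', (s, a, s') ∈ M.trans → ¬ a.IsRecv

/-- A FIFO system: one FIFO automaton for each participant. -/
abbrev FIFOSystem (P A : Type) := (p : P) → FIFOAutomaton P A p

namespace FIFOSystem

variable {P A : Type}

/-- A configuration: a global state and the contents of all channels, oldest message first. -/
structure Config (S : FIFOSystem P A) where
  state : (p : P) → (S p).State
  chan : P → P → List A

def initConfig (S : FIFOSystem P A) : Config S where
  state := fun p => (S p).init
  chan := fun _ _ => []

/-- The effect of an action on perfect FIFO channels. -/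
def ChanStep (w : P → P → List A) : Act P A → (P → P → List A) → Prop
  | .send p q a, w' =>
      w' p q = w p q ++ [a] ∧ ∀ r s, (r, s) ≠ (p, q) → w' r s = w r s
  | .recv p q a, w' =>
      w p q = a :: w' p q ∧ ∀ r s, (r, s) ≠ (p, q) → w' r s = w r s
  | .internal _ _, w' => w' = w

/-- The successor relation on configurations. -/
def Step (S : FIFOSystem P A) (c : Config S) (a : Act P A) (c' : Config S) : Prop :=
  (c.state a.actor, a, c'.state a.actor) ∈ (S a.actor).trans ∧
    (∀ r, r ≠ a.actor → c'.state r = c.state r) ∧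
    ChanStep c.chan a c'.chan

/-- `c` goes to `c'` by performing the sequence of actions `e`. -/
def Run (S : FIFOSystem P A) : Config S → List (Act P A) → Config S → Prop
  | c, [], c' => c = c'
  | c, a :: e, c' => ∃ d, Step S c a d ∧ Run S d e c'

/-- The executions of the system. -/
def Exec (S : FIFOSystem P A) : Set (List (Act P A)) :=
  {e | ∃ c, Run S (initConfig S) e c}

end FIFOSystem

/-! ### RSC systems -/

section RSC

variable {P A : Type} [DecidableEq P]

/-- `{j, j'}` is a (perfect) matching pair of `e`: for some channel and some `k`, position `j`
carries the `k`-th send and position `j'` the `k`-th receive on that channel, with the same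
message, and `j < j'`. -/
def IsMatchingPair (e : List (Act P A)) (j j' : Fin e.length) : Prop :=
  j < j' ∧ ∃ p q a, e.get j = .send p q a ∧ e.get j' = .recv p q a ∧
    (e.take j).countP (Act.sendsOn p q) = (e.take j').countP (Act.recvsOn p q)

/-- Interactions: matching pairs, unmatched sends and internal actions. -/
def IsInteraction (e : List (Act P A)) (v : Set (Fin e.length)) : Prop :=
  (∃ j j', IsMatchingPair e j j' ∧ v = {j, j'}) ∨
  (∃ j, v = {j} ∧ (e.get j).IsSend ∧ ∀ j', ¬ IsMatchingPair e j j') ∨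
  (∃ j, v = {j} ∧ (e.get j).IsInternal)

/-- A valid communication of `e`: a set of interactions such that every position of `e` lies in
exactly one of them. -/
def IsValidComm (e : List (Act P A)) (V : Set (Set (Fin e.length))) : Prop :=
  (∀ v ∈ V, IsInteraction e v) ∧ ∀ j, ∃! v, v ∈ V ∧ j ∈ v

/-- Two positions commute if their actions have different active participants and they do not
form a matching pair. -/
def Commute (e : List (Act P A)) (j j' : Fin e.length) : Prop :=
  (e.get j).actor ≠ (e.get j').actor ∧ ¬ IsMatchingPair e j j' ∧ ¬ IsMatchingPair e j' j

/-- The edge relation of the conflict graph. -/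
def Conflict (e : List (Act P A)) (v v' : Set (Fin e.length)) : Prop :=
  ∃ j ∈ v, ∃ j' ∈ v', j < j' ∧ ¬ Commute e j j'

/-- Causal equivalence: the conflict graphs, whose vertices are the interactions labelled with the
actions that they consist of, are isomorphic. -/
def CausallyEquivalent (e : List (Act P A)) (V : Set (Set (Fin e.length)))
    (e' : List (Act P A)) (V' : Set (Set (Fin e'.length))) : Prop :=
  ∃ f : V ≃ V', (∀ v, e'.get '' (f v).1 = e.get '' v.1) ∧
    ∀ v w, Conflict e' (f v).1 (f w).1 ↔ Conflict e v.1 w.1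

/-- RSC executions: every matching pair is of the form `{j, j + 1}`. -/
def IsRSCExec (e : List (Act P A)) (V : Set (Set (Fin e.length))) : Prop :=
  ∀ j j', IsMatchingPair e j j' → {j, j'} ∈ V → (j' : ℕ) = j + 1

/-- RSC systems: every execution is causally equivalent to an RSC execution. -/
def FIFOSystem.IsRSC (S : FIFOSystem P A) : Prop :=
  ∀ e ∈ S.Exec, ∀ V, IsValidComm e V →
    ∃ e' V', IsValidComm e' V' ∧ IsRSCExec e' V' ∧ CausallyEquivalent e V e' V'

end RSC

/-! ### Weak `k`-multiparty compatibility -/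

namespace FIFOSystem

variable {P A : Type}

def Config.Bounded {S : FIFOSystem P A} (k : ℕ) (c : Config S) : Prop :=
  ∀ p q, p ≠ q → (c.chan p q).length ≤ k

/-- A step between `k`-bounded configurations. -/
def StepK (S : FIFOSystem P A) (k : ℕ) (c : Config S) (a : Act P A) (c' : Config S) : Prop :=
  c.Bounded k ∧ c'.Bounded k ∧ Step S c a c'

/-- Reachability through `k`-bounded configurations. -/
def ReachK (S : FIFOSystem P A) (k : ℕ) : Config S → Config S → Prop :=
  Relation.ReflTransGen fun c c' => ∃ a, StepK S k c a c'

/-- Eventual reception. -/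
def EventualReception (S : FIFOSystem P A) (k : ℕ) : Prop :=
  ∀ c, ReachK S k (initConfig S) c → ∀ p q m u, p ≠ q → c.chan p q = m :: u →
    ∃ d d', ReachK S k c d ∧ StepK S k d (.recv p q m) d'

/-- `k`-exhaustivity. -/
def Exhaustive (S : FIFOSystem P A) (k : ℕ) : Prop :=
  ∀ c, ReachK S k (initConfig S) c → ∀ p q, p ≠ q → (S p).IsSending (c.state p) →
    ∀ m s', (c.state p, .send p q m, s') ∈ (S p).trans →
      ∃ d d', ReachK S k c d ∧ StepK S k d (.send p q m) d'

/-- Weak `k`-multiparty compatibility. -/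
def IsWMC (S : FIFOSystem P A) (k : ℕ) : Prop :=
  EventualReception S k ∧ Exhaustive S k

end FIFOSystem

/-! ### Crash-handling systems -/

/-- The alphabet `M` extended with the crash message. -/
inductive CMsg (M : Type) where
  | data (m : M)
  | crash

namespace Act

variable {P M : Type}

/-- Sends and receives of ordinary messages. -/
def IsData : Act P (CMsg M) → Prop
  | send _ _ (.data _) => True
  | recv _ _ (.data _) => True
  | _ => False

end Act

section CrashHandling

variable {P M : Type} {p : P}

/-- Crash handling: every state that receives a message from an unreliable participant also
receives the crash message of that participant. -/
def CrashHandled (rel : Finset P) {Q : Type} (p : P) (Q₁ Q₂ : Set Q)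
    (δ₁ δ₂ : Set (Q × Act P (CMsg M) × Q)) : Prop :=
  ∀ s r m s', (s, .recv r p (.data m), s') ∈ δ₁ → r ∉ rel →
    ∃ s'' ∈ Q₁ ∪ Q₂, (s, .recv r p .crash, s'') ∈ δ₂

/-- Starting in `s`, the crash message is sent to the listed participants one after the other,
through states of `Q₃`, ending in a state of `Q₂`. -/
def BroadcastPath {Q : Type} (p : P) (Q₂ Q₃ : Set Q) (δ₂ : Set (Q × Act P (CMsg M) × Q)) :
    List P → Q → Prop
  | [], s => s ∈ Q₂
  | r :: rs, s => s ∈ Q₃ ∧ ∃ s', (s, .send p r .crash, s') ∈ δ₂ ∧ BroadcastPath p Q₂ Q₃ δ₂ rs s'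

/-- Crash broadcast: an unreliable participant can crash in every state of `Q₁`; it then sends the
crash message to all other participants, each exactly once. -/
def CrashBroadcast (rel : Finset P) {Q : Type} (p : P) (Q₁ Q₂ Q₃ : Set Q)
    (δ₂ : Set (Q × Act P (CMsg M) × Q)) : Prop :=
  p ∉ rel → ∀ s ∈ Q₁, ∃ rs : List P, rs.Nodup ∧ (∀ r, r ∈ rs ↔ r ≠ p) ∧
    ∃ s', (s, .internal p .crash, s') ∈ δ₂ ∧ BroadcastPath p Q₂ Q₃ δ₂ rs s'

/-- Crash redundancy: crash messages are consumed in the states of `Q₂`. -/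
def CrashRedundant {Q : Type} (p : P) (Q₂ : Set Q) (δ₂ : Set (Q × Act P (CMsg M) × Q)) : Prop :=
  ∀ s ∈ Q₂, ∀ r, r ≠ p → (s, .recv r p .crash, s) ∈ δ₂

/-- The automaton of `p` has crash-handling behaviour, for the set `rel` of reliable
participants. -/
def FIFOAutomaton.IsCrashHandling (rel : Finset P) (N : FIFOAutomaton P (CMsg M) p) : Prop :=
  ∃ (Q₁ Q₂ Q₃ : Set N.State) (δ₁ δ₂ : Set (N.State × Act P (CMsg M) × N.State)),
    Q₁ ∪ Q₂ ∪ Q₃ = Set.univ ∧ Disjoint Q₁ Q₂ ∧ Disjoint Q₁ Q₃ ∧ Disjoint Q₂ Q₃ ∧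
    δ₁ ∪ δ₂ = N.trans ∧ Disjoint δ₁ δ₂ ∧
    (∀ s a s', (s, a, s') ∈ δ₁ → s ∈ Q₁ ∧ a.IsData ∧ s' ∈ Q₁ ∪ Q₂) ∧
    (∀ s a s', (s, a, s') ∈ δ₂ → ¬ a.IsData) ∧
    Minimal (fun δ => CrashHandled rel p Q₁ Q₂ δ₁ δ ∧ CrashBroadcast rel p Q₁ Q₂ Q₃ δ ∧
      CrashRedundant p Q₂ δ) δ₂

/-- Crash-handling systems. -/
def FIFOSystem.IsCrashHandling (rel : Finset P) (S : FIFOSystem P (CMsg M)) : Prop :=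
  ∀ p, (S p).IsCrashHandling rel

end CrashHandling

/-! ### Local types -/

/-- Ordinary messages: a label and the base type of the payload, both from countable sets. -/
abbrev Payload := ℕ × ℕ

/-- Labels of branches: an ordinary label with its payload type, or the crash-handling label. -/
inductive Label where
  | msg (l B : ℕ)
  | crash

/-- The label without the payload type (`none` is the crash-handling label). -/
def Label.name : Label → Option ℕ
  | .msg l _ => some l
  | .crash => none

/-- Local types: external choice, internal choice, recursion, type variable, successful
termination, crash. -/
inductive LocalType (P : Type) where
  | branch (q : P) (bs : List (Label × LocalType P))
  | select (q : P) (bs : List (Label × LocalType P))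
  | mu (t : ℕ) (T : LocalType P)
  | var (t : ℕ)
  | finished
  | crashed

namespace LocalType

variable {P : Type}

mutual
/-- The types occurring in a type. -/
def subterms : LocalType P → List (LocalType P)
  | branch q bs => branch q bs :: subtermsL bs
  | select q bs => select q bs :: subtermsL bs
  | mu t T => mu t T :: subterms T
  | var t => [var t]
  | finished => [finished]
  | crashed => [crashed]
def subtermsL : List (Label × LocalType P) → List (LocalType P)
  | [] => []
  | (_, T) :: bs => subterms T ++ subtermsL bs
end

mutual
/-- The variables bound by the recursions of a type, with multiplicity. -/
def binders : LocalType P → List ℕ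
  | branch _ bs => bindersL bs
  | select _ bs => bindersL bs
  | mu t T => t :: binders T
  | var _ => []
  | finished => []
  | crashed => []
def bindersL : List (Label × LocalType P) → List ℕ
  | [] => []
  | (_, T) :: bs => binders T ++ bindersL bs
end

mutual
/-- All free variables lie in the given list. -/
def ClosedIn : List ℕ → LocalType P → Prop
  | ts, branch _ bs => ClosedInL ts bs
  | ts, select _ bs => ClosedInL ts bs
  | ts, mu t T => ClosedIn (t :: ts) T
  | ts, var t => t ∈ ts
  | _, finished => True
  | _, crashed => True
def ClosedInL : List ℕ → List (Label × LocalType P) → Prop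
  | _, [] => True
  | ts, (_, T) :: bs => ClosedIn ts T ∧ ClosedInL ts bs
end

/-- Removal of the leading recursions. -/
def strip : LocalType P → LocalType P
  | mu _ T => strip T
  | T => T

def IsVar : LocalType P → Prop
  | var _ => True
  | _ => False

def IsMu : LocalType P → Prop
  | mu _ _ => True
  | _ => False

/-- External and internal choices. -/
def IsChoice : LocalType P → Prop
  | branch _ _ => True
  | select _ _ => True
  | _ => False

/-- Successful termination and crash. -/
def IsSink : LocalType P → Prop
  | finished => True
  | crashed => True
  | _ => False

/-- Well-formed local types of participant `p`: closed, recursion variables unique, recursion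
guarded; choices have another participant as their peer, have pairwise distinct labels, and have at
least one branch that is not the crash-handling branch (so they are non-empty, and the crash label
is never alone); no crash-handling label occurs in an internal choice. -/
structure WellFormed (p : P) (T₀ : LocalType P) : Prop where
  closed : ClosedIn [] T₀
  unique : T₀.binders.Nodup
  guarded : ∀ t T, mu t T ∈ T₀.subterms → ¬ T.strip.IsVar
  branch_ok : ∀ q bs, branch q bs ∈ T₀.subterms →
    q ≠ p ∧ (bs.map fun b => b.1.name).Nodup ∧ ∃ b ∈ bs, b.1 ≠ .crash
  select_ok : ∀ q bs, select q bs ∈ T₀.subterms →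
    q ≠ p ∧ (bs.map fun b => b.1.name).Nodup ∧ bs ≠ [] ∧ ∀ b ∈ bs, b.1 ≠ .crash

/-! ### From local types to FIFO automata -/

/-- Control states: types, and the auxiliary states of the crash broadcast. -/
inductive TState (P : Type) where
  | ty (T : LocalType P)
  | sink
  | sent (r : P)

/-- The control states of the automaton of `T₀`. -/
def IsState (p : P) (T₀ : LocalType P) : TState P → Prop
  | .ty T => (T ∈ T₀.subterms ∧ ¬ T.IsVar ∧ ¬ T.IsMu) ∨ T = crashed
  | .sink => True
  | .sent r => r ≠ p

/-- The control state `T'` reached by continuing with `T`. -/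
inductive Target (T₀ : LocalType P) : LocalType P → LocalType P → Prop
  | direct (T) : ¬ T.IsVar → Target T₀ T T.strip
  | loop (t T') : mu t T' ∈ T₀.subterms → Target T₀ (var t) T'.strip

/-- The state of the broadcast from which the message number `i` is sent. -/
def castSource (order : List P) : ℕ → TState P
  | 0 => .sink
  | i + 1 => (order[i]?).elim .sink .sent

/-- The state of the broadcast that is reached by sending the message number `i`. -/
def castTarget (order : List P) (i : ℕ) : TState P :=
  if i + 1 = order.length then .ty crashed else castSource order (i + 1)

/-- The transitions of the automaton of `T₀`, for the participant `p`, the set `rel` of reliable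
participants, and an enumeration `order` of the participants other than `p`. -/
inductive Trans (p : P) (rel : Finset P) (order : List P) (T₀ : LocalType P) :
    TState P → Act P (CMsg Payload) → TState P → Prop
  | recv (q bs l B T T') : branch q bs ∈ T₀.subterms → (.msg l B, T) ∈ bs → Target T₀ T T' →
      Trans p rel order T₀ (.ty (branch q bs)) (.recv q p (.data (l, B))) (.ty T')
  | send (q bs l B T T') : select q bs ∈ T₀.subterms → (.msg l B, T) ∈ bs → Target T₀ T T' →
      Trans p rel order T₀ (.ty (select q bs)) (.send p q (.data (l, B))) (.ty T')
  | handle (q bs T T') : branch q bs ∈ T₀.subterms → (.crash, T) ∈ bs → Target T₀ T T' →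
      Trans p rel order T₀ (.ty (branch q bs)) (.recv q p .crash) (.ty T')
  | crash (T) : p ∉ rel → T ∈ T₀.subterms → T.IsChoice →
      Trans p rel order T₀ (.ty T) (.internal p .crash) .sink
  | cast (T i r) : p ∉ rel → T ∈ T₀.subterms → T.IsChoice → order[i]? = some r →
      Trans p rel order T₀ (castSource order i) (.send p r .crash) (castTarget order i)
  | drain (T q) : T.IsSink → q ≠ p →
      Trans p rel order T₀ (.ty T) (.recv q p .crash) (.ty T)

/-! Facts that are needed to form the automaton. -/

theorem self_mem_subterms (T : LocalType P) : T ∈ T.subterms := by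
  cases T <;> simp [subterms]

theorem strip_not_mu (T : LocalType P) : ¬ T.strip.IsMu := by
  fun_induction strip T with
  | case1 t T ih => exact ih
  | case2 T h =>
    cases T <;> simp_all [IsMu]

theorem strip_mem_subterms (T : LocalType P) : T.strip ∈ T.subterms := by
  fun_induction strip T with
  | case1 t T ih => simp [subterms, ih]
  | case2 T h => exact self_mem_subterms T

theorem WellFormed.isState_init {p : P} {T₀ : LocalType P} (h : WellFormed p T₀) :
    IsState p T₀ (.ty T₀.strip) := by
  refine Or.inl ⟨strip_mem_subterms _, ?_, strip_not_mu _⟩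
  have hc := h.closed
  have hg := h.guarded
  cases T₀ with
  | mu t T => simpa [strip] using hg t T (self_mem_subterms _)
  | var t => simp [ClosedIn] at hc
  | _ => simp [strip, IsVar]

theorem finite_isState [Finite P] (p : P) (T₀ : LocalType P) : Finite {s // IsState p T₀ s} := by
  have h : ((TState.ty '' {T | T ∈ T₀.subterms} ∪ {.ty crashed}) ∪
      ({.sink} ∪ Set.range TState.sent)).Finite :=
    (((List.finite_toSet _).image _).union (Set.finite_singleton _)).union
      ((Set.finite_singleton _).union (Set.finite_range _))
  refine (h.subset ?_).to_subtype
  rintro (T | _ | r) hs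
  · rcases hs with hs | rfl
    · exact Or.inl (Or.inl ⟨T, hs.1, rfl⟩)
    · exact Or.inl (Or.inr rfl)
  · exact Or.inr (Or.inl rfl)
  · exact Or.inr (Or.inr ⟨r, rfl⟩)

/-- The message that announces a branch. -/
def labelMsg : Label → CMsg Payload
  | .msg l B => .data (l, B)
  | .crash => .crash

/-- The communications offered by a choice. -/
def offers (p : P) : LocalType P → List (Act P (CMsg Payload))
  | branch q bs => bs.map fun b => .recv q p (labelMsg b.1)
  | select q bs => bs.map fun b => .send p q (labelMsg b.1)
  | _ => []

theorem finite_actions [Finite P] (p : P) (rel : Finset P) (order : List P) (T₀ : LocalType P) :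
    {a | ∃ s s', Trans p rel order T₀ s a s'}.Finite := by
  have h : (({a | a ∈ T₀.subterms.flatMap (offers p)} ∪ {.internal p .crash}) ∪
      (Set.range (fun r => Act.send p r CMsg.crash) ∪
        Set.range (fun r => Act.recv r p CMsg.crash))).Finite :=
    ((List.finite_toSet _).union (Set.finite_singleton _)).union
      ((Set.finite_range _).union (Set.finite_range _))
  refine h.subset ?_
  rintro a ⟨s, s', ht⟩
  cases ht with
  | recv q bs l B T T' h₁ h₂ _ =>
    exact Or.inl (Or.inl (List.mem_flatMap.2 ⟨_, h₁, List.mem_map.2 ⟨_, h₂, rfl⟩⟩))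
  | send q bs l B T T' h₁ h₂ _ =>
    exact Or.inl (Or.inl (List.mem_flatMap.2 ⟨_, h₁, List.mem_map.2 ⟨_, h₂, rfl⟩⟩))
  | handle q bs T T' h₁ h₂ _ => exact Or.inr (Or.inr ⟨q, rfl⟩)
  | crash T _ _ _ => exact Or.inl (Or.inr rfl)
  | cast T i r _ _ _ _ => exact Or.inr (Or.inl ⟨r, rfl⟩)
  | drain T q _ _ => exact Or.inr (Or.inr ⟨q, rfl⟩)

/-- The FIFO automaton of a well-formed local type. -/
def toAutomaton [Finite P] (p : P) (rel : Finset P) (order : List P)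
    (hord : ∀ r, r ∈ order ↔ r ≠ p) (T₀ : LocalType P) (h : WellFormed p T₀) :
    FIFOAutomaton P (CMsg Payload) p where
  State := {s // IsState p T₀ s}
  finite_state := finite_isState p T₀
  init := ⟨.ty T₀.strip, h.isState_init⟩
  trans := {x | Trans p rel order T₀ x.1.1 x.2.1 x.2.2.1}
  finite_trans := by
    have := finite_isState p T₀
    refine (Set.finite_univ.prod
      ((finite_actions p rel order T₀).prod Set.finite_univ)).subset ?_
    rintro ⟨s, a, s'⟩ ht
    exact ⟨trivial, ⟨_, _, ht⟩, trivial⟩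
  actor_eq := by
    rintro ⟨s, _⟩ a ⟨s', _⟩ ht
    cases ht <;> rfl
  onChannel := by
    rintro ⟨s, _⟩ a ⟨s', _⟩ ht
    replace ht : Trans p rel order T₀ s a s' := ht
    cases ht with
    | recv q bs l B T T' h₁ _ _ => exact (h.branch_ok q bs h₁).1
    | send q bs l B T T' h₁ _ _ => exact (h.select_ok q bs h₁).1.symm
    | handle q bs T T' h₁ _ _ => exact (h.branch_ok q bs h₁).1
    | crash T _ _ _ => trivial
    | cast T i r _ _ _ h₄ => exact ((hord r).1 (List.mem_of_getElem? h₄)).symm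
    | drain T q _ h₂ => exact h₂

end LocalType

/-! ### Crash-stop session types and their FIFO systems -/

/-- A collection of crash-stop local types: the number `n` of participants, the set of reliable
participants, one well-formed local type for each participant, and for each participant the order
in which it notifies the others of its crash. -/
structure Protocol where
  n : ℕ
  reliable : Finset (Fin n)
  type : Fin n → LocalType (Fin n)
  wf : ∀ p, (type p).WellFormed p
  order : Fin n → List (Fin n)
  order_nodup : ∀ p, (order p).Nodup
  mem_order : ∀ p r, r ∈ order p ↔ r ≠ p

namespace Protocol

/-- The FIFO system generated from the local types. -/
def system (S : Protocol) : FIFOSystem (Fin S.n) (CMsg Payload) := fun p =>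
  LocalType.toAutomaton p S.reliable (S.order p) (S.mem_order p) (S.type p) (S.wf p)

/-- Exactly the external choices whose peer is unreliable have a crash-handling branch. -/
def CrashAware (S : Protocol) : Prop :=
  ∀ p q bs, .branch q bs ∈ (S.type p).subterms → ((∃ b ∈ bs, b.1 = .crash) ↔ q ∉ S.reliable)

end Protocol

/-! ### Inputs of algorithms: collections of local types as words over `ℕ` -/

def Label.encode : Label → List ℕ
  | .msg l B => [0, l, B]
  | .crash => [1]

mutual
/-- Prefix notation of a local type. -/
def LocalType.encode {n : ℕ} : LocalType (Fin n) → List ℕ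
  | .branch q bs => 0 :: q.val :: bs.length :: LocalType.encodeL bs
  | .select q bs => 1 :: q.val :: bs.length :: LocalType.encodeL bs
  | .mu t T => 2 :: t :: LocalType.encode T
  | .var t => [3, t]
  | .finished => [4]
  | .crashed => [5]
def LocalType.encodeL {n : ℕ} : List (Label × LocalType (Fin n)) → List ℕ
  | [] => []
  | (l, T) :: bs => l.encode ++ (LocalType.encode T ++ LocalType.encodeL bs)
end

/-- The number of participants; then for each participant whether it is reliable, its notification
order, and its local type. -/
def Protocol.encode (S : Protocol) : List ℕ :=
  S.n :: (List.finRange S.n).flatMap fun p =>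
    (if p ∈ S.reliable then 1 else 0) ::
      ((S.order p).length :: (S.order p).map Fin.val ++ (S.type p).encode)

end CrashStop

-- Decidability rests on finite transition systems. A rewriting system changes a memory with a fixed
-- number of cells by conditional assignments taken from a finite list of rules, so only finitely
-- many memories are reachable. A property of the form "whenever this condition holds, one of those
-- conditions is reachable" can then be checked as soon as reachability has stabilised
-- (`exists_computable_rewriting`). The stabilisation time is not estimated. It is found by
-- unbounded search, which ends because the reachable set is finite; the rest of the algorithm is
-- primitive recursive, which `fun_prop` verifies.
--
-- For `k`-WMC the memory holds the local states and the full contents of the channels, which are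
-- words of length at most `k` over the finitely many messages of the system. Eventual reception and
-- exhaustivity are then liveness properties of the required form (`Coding.isWMC_iff`).
--
-- For RSC the channels are unbounded, and a finite characterisation comes first
-- (`FIFOSystem.isRSC_iff`). In a synchronous run each message exchange is one step through an empty
-- channel; other messages are sent and never received. A violation consists of a synchronous run
-- that ends with the channel `pq` empty, a send of `m` from `p` to `q`, and a further synchronous
-- run that contains a causal chain from `p` to `q` and after which `q` can receive `m`. A violation
-- makes the system non-RSC: with the receive added, the chain closes a cycle through the vertex of
-- this matching pair, whereas conflict graphs of RSC executions have only trivial cycles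
-- (`IsRSCExec.acyclic`). Without violations, every receive of an execution can be moved next to its
-- send past everything on which it does not depend (`exists_srun_recv`). The resulting synchronous
-- run has the same projections to the participants. Projections determine which send matches which
-- receive, so the conflict graph is unchanged (`exists_causallyEquivalent`). Since synchronous
-- steps only ask whether a channel is empty, violations are found by a finite memory: local states,
-- one bit for each channel, the message under observation, and the participant that the chain has
-- reached (`hasViolation_iff`, `Coding.isRSC_iff`).
--
-- Both reductions work from a table of transitions. A parser for prefix notation computes it from
-- the encoded local types, and `Protocol.coding` shows that it describes the generated system.
--
-- For crash handling, `Q₁` consists of the choices, `Q₂` of the terminated types, `Q₃` of the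
-- auxiliary states, and `δ₂` of all transitions that are not data actions. It is minimal because
-- each of these transitions is forced by one of the three requirements
-- (`LocalType.isCrashHandling`).

attribute [fun_prop] Primrec
attribute [fun_prop] Primrec.id Primrec.const Primrec.comp Primrec.fst Primrec.snd Primrec.pair

namespace CrashStop

open Relation

-- Closure of primitive recursion under list operations

section PrimrecClosure

variable {α β γ σ : Type} [Primcodable α] [Primcodable β] [Primcodable γ] [Primcodable σ]

@[fun_prop]
theorem primrec_append {f g : α → List β} (hf : Primrec f) (hg : Primrec g) :
    Primrec fun x => f x ++ g x :=
  Primrec.list_append.comp hf hg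

@[fun_prop]
theorem primrec_cons {f : α → β} {g : α → List β} (hf : Primrec f) (hg : Primrec g) :
    Primrec fun x => f x :: g x :=
  Primrec.list_cons.comp hf hg

@[fun_prop]
theorem primrec_map {f : α → List β} {g : α → β → γ} (hf : Primrec f)
    (hg : Primrec fun p : α × β => g p.1 p.2) : Primrec fun x => (f x).map (g x) :=
  Primrec.list_map hf hg

@[fun_prop]
theorem primrec_flatMap {f : α → List β} {g : α → β → List γ} (hf : Primrec f)
    (hg : Primrec fun p : α × β => g p.1 p.2) : Primrec fun x => (f x).flatMap (g x) :=
  Primrec.list_flatMap hf hg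

@[fun_prop]
theorem primrec_foldl {f : α → List β} {g : α → σ} {h : α → σ → β → σ} (hf : Primrec f)
    (hg : Primrec g) (hh : Primrec fun p : α × (σ × β) => h p.1 p.2.1 p.2.2) :
    Primrec fun x => (f x).foldl (h x) (g x) :=
  Primrec.list_foldl (h := fun x p => h x p.1 p.2) hf hg hh

@[fun_prop]
theorem primrec_decide_eq {f g : α → β} [∀ x, Decidable (f x = g x)] (hf : Primrec f)
    (hg : Primrec g) : Primrec fun x => decide (f x = g x) :=
  PrimrecPred.decide (Primrec.eq.comp hf hg)

@[fun_prop]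
theorem primrec_decide_lt {f g : α → ℕ} (hf : Primrec f) (hg : Primrec g) :
    Primrec fun x => decide (f x < g x) :=
  PrimrecPred.decide (Primrec.nat_lt.comp hf hg)

@[fun_prop]
theorem primrec_and {f g : α → Bool} (hf : Primrec f) (hg : Primrec g) :
    Primrec fun x => f x && g x :=
  Primrec.and.comp hf hg

@[fun_prop]
theorem primrec_or {f g : α → Bool} (hf : Primrec f) (hg : Primrec g) :
    Primrec fun x => f x || g x :=
  Primrec.or.comp hf hg

@[fun_prop]
theorem primrec_not {f : α → Bool} (hf : Primrec f) : Primrec fun x => !f x :=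
  Primrec.not.comp hf

@[fun_prop]
theorem primrec_cond {c : α → Bool} {f g : α → β} (hc : Primrec c) (hf : Primrec f)
    (hg : Primrec g) : Primrec fun x => bif c x then f x else g x :=
  Primrec.cond hc hf hg

@[fun_prop]
theorem primrec_any {f : α → List β} {g : α → β → Bool} (hf : Primrec f)
    (hg : Primrec fun p : α × β => g p.1 p.2) : Primrec fun x => (f x).any (g x) := by
  refine (primrec_foldl (h := fun x b y => b || g x y) hf (Primrec.const false)
    (by fun_prop)).of_eq fun x => ?_
  have (l : List β) (b : Bool) : l.foldl (fun b y => b || g x y) b = (b || l.any (g x)) := by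
    induction l generalizing b with
    | nil => simp
    | cons y l ih => rw [List.foldl_cons, ih]; simp [Bool.or_assoc]
  simp [this]

@[fun_prop]
theorem primrec_all {f : α → List β} {g : α → β → Bool} (hf : Primrec f)
    (hg : Primrec fun p : α × β => g p.1 p.2) : Primrec fun x => (f x).all (g x) := by
  refine (primrec_not (primrec_any (g := fun x y => !g x y) hf (by fun_prop))).of_eq fun x => ?_
  rw [← List.not_all_eq_any_not, Bool.not_not]

@[fun_prop]
theorem primrec_filter {f : α → List β} {g : α → β → Bool} (hf : Primrec f)
    (hg : Primrec fun p : α × β => g p.1 p.2) : Primrec fun x => (f x).filter (g x) := by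
  refine (primrec_flatMap (g := fun x y => bif g x y then [y] else []) hf
    (by fun_prop)).of_eq fun x => ?_
  induction f x with
  | nil => rfl
  | cons y l ih => cases h : g x y <;> simp [h, ih]

@[fun_prop]
theorem primrec_iterate {f : α → ℕ} {g : α → β} {h : α → β → β} (hf : Primrec f)
    (hg : Primrec g) (hh : Primrec fun p : α × β => h p.1 p.2) :
    Primrec fun x => (h x)^[f x] (g x) :=
  Primrec.nat_iterate hf hg hh

@[fun_prop]
theorem primrec_getD {f : α → List β} {g : α → ℕ} {d : β} (hf : Primrec f) (hg : Primrec g) :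
    Primrec fun x => (f x).getD (g x) d :=
  (Primrec.list_getD d).comp hf hg

@[fun_prop]
theorem primrec_drop {f : α → List β} {g : α → ℕ} (hf : Primrec f) (hg : Primrec g) :
    Primrec fun x => (f x).drop (g x) :=
  Primrec.list_drop.comp hg hf

@[fun_prop]
theorem primrec_take {f : α → List β} {g : α → ℕ} (hf : Primrec f) (hg : Primrec g) :
    Primrec fun x => (f x).take (g x) :=
  Primrec.list_take.comp hg hf

@[fun_prop]
theorem primrec_length {f : α → List β} (hf : Primrec f) : Primrec fun x => (f x).length :=
  Primrec.list_length.comp hf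

@[fun_prop]
theorem primrec_range {f : α → ℕ} (hf : Primrec f) : Primrec fun x => List.range (f x) :=
  Primrec.list_range.comp hf

@[fun_prop]
theorem primrec_add {f g : α → ℕ} (hf : Primrec f) (hg : Primrec g) :
    Primrec fun x => f x + g x :=
  Primrec.nat_add.comp hf hg

@[fun_prop]
theorem primrec_sub {f g : α → ℕ} (hf : Primrec f) (hg : Primrec g) :
    Primrec fun x => f x - g x :=
  Primrec.nat_sub.comp hf hg

@[fun_prop]
theorem primrec_elem {f : α → β} {g : α → List β} [∀ x, Decidable (f x ∈ g x)]
    (hf : Primrec f) (hg : Primrec g) : Primrec fun x => decide (f x ∈ g x) := by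
  classical
  refine (primrec_any (g := fun x y => decide (y = f x)) hg (by fun_prop)).of_eq fun x => ?_
  rw [Bool.eq_iff_iff]
  simp

end PrimrecClosure

/-! ### Finite reachability -/

section Reachability

variable {σ : Type}

/-- All members of a list together with their successors. -/
def extend (succ : σ → List σ) (R : List σ) : List σ :=
  R ++ R.flatMap succ

/-- The elements that are reached from `s` by at most `n` steps. -/
def stage (succ : σ → List σ) (n : ℕ) (s : σ) : List σ :=
  (extend succ)^[n] [s]

theorem mem_stage_succ {succ : σ → List σ} {n : ℕ} {s t : σ} :
    t ∈ stage succ (n + 1) s ↔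
      t ∈ stage succ n s ∨ ∃ u ∈ stage succ n s, t ∈ succ u := by
  simp [stage, Function.iterate_succ_apply', extend]

theorem stage_mono {succ : σ → List σ} {m n : ℕ} (h : m ≤ n) {s t : σ}
    (ht : t ∈ stage succ m s) : t ∈ stage succ n s := by
  induction h with
  | refl => exact ht
  | step _ ih => exact mem_stage_succ.2 (Or.inl ih)

theorem self_mem_stage (succ : σ → List σ) (n : ℕ) (s : σ) : s ∈ stage succ n s :=
  stage_mono (Nat.zero_le n) (by simp [stage])

theorem reflTransGen_of_mem_stage {succ : σ → List σ} {n : ℕ} {s t : σ}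
    (h : t ∈ stage succ n s) : ReflTransGen (fun s s' => s' ∈ succ s) s t := by
  induction n generalizing t with
  | zero =>
    obtain rfl : t = s := by simpa [stage] using h
    exact .refl
  | succ n ih =>
    rcases mem_stage_succ.1 h with h | ⟨u, hu, h⟩
    · exact ih h
    · exact (ih hu).tail h

theorem exists_mem_stage {succ : σ → List σ} {s t : σ}
    (h : ReflTransGen (fun s s' => s' ∈ succ s) s t) : ∃ n, t ∈ stage succ n s := by
  induction h with
  | refl => exact ⟨0, self_mem_stage _ _ _⟩
  | tail _ h ih =>
    obtain ⟨n, hn⟩ := ih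
    exact ⟨n + 1, mem_stage_succ.2 (Or.inr ⟨_, hn, h⟩)⟩

/-- Every reachable element appears at some stage; there are finitely many of them, so the latest of
these stages contains all. -/
theorem exists_stage_complete {succ : σ → List σ} {s : σ}
    (hfin : {t | ReflTransGen (fun s s' => s' ∈ succ s) s t}.Finite) :
    ∃ n, ∀ t, ReflTransGen (fun s s' => s' ∈ succ s) s t → t ∈ stage succ n s := by
  classical
  choose! N hN using fun t (h : ReflTransGen (fun s s' => s' ∈ succ s) s t) => exists_mem_stage h
  obtain ⟨n, hn⟩ := (hfin.image N).bddAbove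
  exact ⟨n, fun t ht => stage_mono (hn ⟨t, ht, rfl⟩) (hN t ht)⟩

/-- Within `n` steps everything reachable is reached, from `s` and from everything reachable
from `s`. -/
def isStable [DecidableEq σ] (succ : σ → List σ) (s : σ) (n : ℕ) : Bool :=
  (stage succ n s).all fun c => (stage succ n c).all fun d => (succ d).all fun d' =>
    decide (d' ∈ stage succ n c)

/-- For each `c` in the stage of `s`, stability makes the stage of `c` closed under successors, so a
path from `c` never leaves it. As `s` lies in its own stage, reachability from `s` is covered too.
-/
theorem mem_stage_iff_of_isStable [DecidableEq σ] {succ : σ → List σ} {s c d : σ} {n : ℕ}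
    (h : isStable succ s n = true) (hc : c ∈ stage succ n s) :
    d ∈ stage succ n c ↔ ReflTransGen (fun s s' => s' ∈ succ s) c d := by
  refine ⟨reflTransGen_of_mem_stage, fun hd => ?_⟩
  simp only [isStable, List.all_eq_true, decide_eq_true_eq] at h
  induction hd with
  | refl => exact self_mem_stage _ _ _
  | tail _ hd ih => exact h c hc _ ih _ hd

/-- One number has to serve all starting points reachable from `s`. Each of them has a finite
reachable set, contained in that of `s`, and there are finitely many of them, so a maximum exists.
-/
theorem exists_isStable [DecidableEq σ] {succ : σ → List σ} {s : σ}
    (hfin : {t | ReflTransGen (fun s s' => s' ∈ succ s) s t}.Finite) :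
    ∃ n, isStable succ s n = true := by
  have hfin' (t : σ) (ht : ReflTransGen (fun s s' => s' ∈ succ s) s t) :
      {u | ReflTransGen (fun s s' => s' ∈ succ s) t u}.Finite :=
    hfin.subset fun u hu => ht.trans hu
  choose! N hN using fun t ht => exists_stage_complete (hfin' t ht)
  obtain ⟨n, hn⟩ := (hfin.image N).bddAbove
  refine ⟨n, ?_⟩
  simp only [isStable, List.all_eq_true, decide_eq_true_eq]
  intro c hc d hd d' hd'
  have hc := reflTransGen_of_mem_stage hc
  exact stage_mono (hn ⟨c, hc, rfl⟩) (hN c hc d' ((reflTransGen_of_mem_stage hd).tail hd'))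

variable {α β : Type} [Primcodable α] [Primcodable β] [Primcodable σ]

@[fun_prop]
theorem primrec_stage {succ : α → σ → List σ} {f : α → ℕ} {s : α → σ}
    (hsucc : Primrec fun p : α × σ => succ p.1 p.2) (hf : Primrec f) (hs : Primrec s) :
    Primrec fun a => stage (succ a) (f a) (s a) := by
  unfold stage extend
  fun_prop

/-- Liveness properties of uniformly given finite transition systems are decidable. -/
theorem exists_computable_liveness [DecidableEq σ] {succ : α → σ → List σ} {s : α → σ}
    {obl : α → List β} {pre post : β → σ → Bool}
    (hsucc : Primrec fun p : α × σ => succ p.1 p.2) (hs : Primrec s) (hobl : Primrec obl)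
    (hpre : Primrec fun p : β × σ => pre p.1 p.2) (hpost : Primrec fun p : β × σ => post p.1 p.2)
    (hfin : ∀ a, {t | ReflTransGen (fun s s' => s' ∈ succ a s) (s a) t}.Finite) :
    ∃ f : α → Bool, Computable f ∧ ∀ a, f a = true ↔
      ∀ c, ReflTransGen (fun s s' => s' ∈ succ a s) (s a) c → ∀ o ∈ obl a, pre o c = true →
        ∃ d, ReflTransGen (fun s s' => s' ∈ succ a s) c d ∧ post o d = true := by
  have hst : Primrec fun p : α × ℕ => isStable (succ p.1) (s p.1) p.2 := by
    unfold isStable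
    fun_prop
  have hfind (a : α) : ∃ n, isStable (succ a) (s a) n = true := exists_isStable (hfin a)
  -- Unbounded search for the stabilisation time: the only step that is not shown to be primitive
  -- recursive.
  have hN : Computable fun a => Nat.find (hfind a) :=
    Computable.find (P := fun a n => isStable (succ a) (s a) n = true) (by
      refine Computable.computablePred (Primrec.to_comp (hst.of_eq fun p => ?_))
      simp) hfind
  have hchk : Primrec fun p : α × ℕ => (stage (succ p.1) p.2 (s p.1)).all fun c =>
      (obl p.1).all fun o => !pre o c || (stage (succ p.1) p.2 c).any fun d => post o d := by
    fun_prop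
  refine ⟨_, hchk.to_comp.comp (Computable.id.pair hN), fun a => ?_⟩
  have hst := Nat.find_spec (hfind a)
  simp only [id, List.all_eq_true, Bool.or_eq_true, Bool.not_eq_true', List.any_eq_true]
  constructor
  · intro h c hc o ho hp
    have hc' := (mem_stage_iff_of_isStable hst (self_mem_stage _ _ _)).2 hc
    obtain h | ⟨d, hd, h⟩ := h c hc' o ho
    · simp [h] at hp
    · exact ⟨d, reflTransGen_of_mem_stage hd, h⟩
  · intro h c hc o ho
    by_cases hp : pre o c = true
    · obtain ⟨d, hd, h⟩ := h c (reflTransGen_of_mem_stage hc) o ho hp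
      exact Or.inr ⟨d, (mem_stage_iff_of_isStable hst hc).2 hd, h⟩
    · exact Or.inl (by simpa using hp)

end Reachability

/-! ### Rewriting of memories -/

/-- Memory keys. -/
abbrev Key := List ℕ

/-- Values of memory cells. -/
abbrev Val := List (List ℕ)

/-- A memory: the list of its cells. -/
abbrev Mem := List (Key × Val)

/-- Rewriting rules: cells with their required and their new contents. -/
abbrev Rule := List (Key × Val × Val)

/-- An absent key is ignored, so no assignment changes the length of a memory. -/
def Mem.set (m : Mem) (k : Key) (v : Val) : Mem :=
  m.map fun c => bif decide (c.1 = k) then (k, v) else c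

def Mem.has (m : Mem) (g : Mem) : Bool :=
  g.all fun c => decide (c ∈ m)

def Rule.guard (r : Rule) : Mem :=
  r.map fun c => (c.1, c.2.1)

def Rule.apply (r : Rule) (m : Mem) : Mem :=
  r.foldl (fun m c => Mem.set m c.1 c.2.2) m

/-- All guards of a rule are tested on the old memory, before its assignments are made. -/
def rewrites (rs : List Rule) (m : Mem) : List Mem :=
  (rs.filter fun r => Mem.has m (Rule.guard r)).map fun r => Rule.apply r m

theorem mem_rewrites {rs : List Rule} {m m' : Mem} :
    m' ∈ rewrites rs m ↔ ∃ r ∈ rs, m.has r.guard = true ∧ r.apply m = m' := by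
  simp [rewrites, and_assoc]

/-- An obligation: if the first condition holds, then one of the other conditions has to be
reachable. -/
abbrev Obligation := Mem × List Mem

/-- Rules preserve the length of the memory and write only contents that are listed in them, so the
reachable memories are words of a fixed length over a finite set of cells. -/
theorem finite_rewrites (rs : List Rule) (m : Mem) :
    {m' | ReflTransGen (fun s s' => s' ∈ rewrites rs s) m m'}.Finite := by
  let A : Set (Key × Val) := {c | c ∈ m} ∪ {c | c ∈ rs.flatten.map fun c => (c.1, c.2.2)}
  have hA : A.Finite := (List.finite_toSet _).union (List.finite_toSet _)
  have hset (k : Key) (v : Val) (hkv : (k, v) ∈ A) (x : Mem)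
      (hx : x.length = m.length ∧ ∀ c ∈ x, c ∈ A) :
      (x.set k v).length = m.length ∧ ∀ c ∈ x.set k v, c ∈ A := by
    refine ⟨by simp [Mem.set, hx.1], fun c hc => ?_⟩
    obtain ⟨d, hd, rfl⟩ := List.mem_map.1 hc
    by_cases h : d.1 = k
    · simpa [h] using hkv
    · simpa [h] using hx.2 d hd
  have hfold (r : Rule) (hr : ∀ c ∈ r, (c.1, c.2.2) ∈ A) (x : Mem)
      (hx : x.length = m.length ∧ ∀ c ∈ x, c ∈ A) :
      (r.apply x).length = m.length ∧ ∀ c ∈ r.apply x, c ∈ A := by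
    induction r generalizing x with
    | nil => exact hx
    | cons c r ih =>
      exact ih (fun c hc => hr c (.tail _ hc)) _ (hset _ _ (hr c (.head _)) _ hx)
  have : ({x : Mem | x.length = m.length ∧ ∀ c ∈ x, c ∈ A}).Finite := by
    have := hA.to_subtype
    refine ((List.finite_length_eq A m.length).image (List.map Subtype.val)).subset ?_
    rintro x ⟨h₁, h₂⟩
    refine ⟨x.attach.map fun c => ⟨c.1, h₂ _ c.2⟩, by simp [h₁], ?_⟩
    simpa [List.map_map, Function.comp_def] using List.attach_map_subtype_val x
  refine this.subset fun m' h => ?_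
  induction h with
  | refl => exact ⟨rfl, fun c hc => Or.inl hc⟩
  | tail _ h ih =>
    obtain ⟨r, hr, -, rfl⟩ := mem_rewrites.1 h
    refine hfold r (fun c hc => Or.inr ?_) _ ih
    exact List.mem_map.2 ⟨c, List.mem_flatten.2 ⟨r, hr, hc⟩, rfl⟩

/-- Liveness of rewriting systems is decidable. -/
theorem exists_computable_rewriting {α : Type} [Primcodable α] {init : α → Mem}
    {rules : α → List Rule} {obl : α → List Obligation} (hinit : Primrec init)
    (hrules : Primrec rules) (hobl : Primrec obl) :
    ∃ f : α → Bool, Computable f ∧ ∀ a, f a = true ↔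
      ∀ c, ReflTransGen (fun s s' => s' ∈ rewrites (rules a) s) (init a) c →
        ∀ o ∈ obl a, c.has o.1 = true →
          ∃ d, ReflTransGen (fun s s' => s' ∈ rewrites (rules a) s) c d ∧
            ∃ g ∈ o.2, d.has g = true := by
  have hsucc : Primrec fun p : α × Mem => rewrites (rules p.1) p.2 := by
    unfold rewrites Mem.has Rule.guard Rule.apply Mem.set
    fun_prop
  have hpre : Primrec fun p : Obligation × Mem => Mem.has p.2 p.1.1 := by
    unfold Mem.has
    fun_prop
  have hpost : Primrec fun p : Obligation × Mem => p.1.2.any fun g => Mem.has p.2 g := by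
    unfold Mem.has
    fun_prop
  obtain ⟨f, hf, h⟩ := exists_computable_liveness (succ := fun a => rewrites (rules a))
    (pre := fun o c => c.has o.1) (post := fun o d => o.2.any fun g => d.has g) hsucc hinit hobl
    hpre hpost fun a => finite_rewrites _ _
  refine ⟨f, hf, fun a => (h a).trans ?_⟩
  simp only [List.any_eq_true]

end CrashStop

namespace CrashStop

open Relation

/-! ### Positions in lists -/

section Positions

variable {α : Type}

theorem countP_take_mono (P : α → Bool) (l : List α) {i j : ℕ} (h : i ≤ j) :
    (l.take i).countP P ≤ (l.take j).countP P :=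
  ((List.take_prefix_take_left h).sublist).countP_le

theorem countP_take_succ (P : α → Bool) (l : List α) (i : Fin l.length) (h : P (l.get i) = true) :
    (l.take (i + 1)).countP P = (l.take i).countP P + 1 := by
  rw [List.take_add_one, List.getElem?_eq_getElem i.2, List.countP_append]
  simpa using h

theorem countP_take_succ_of_not (P : α → Bool) (l : List α) (i : Fin l.length)
    (h : P (l.get i) = false) : (l.take (i + 1)).countP P = (l.take i).countP P := by
  rw [List.take_add_one, List.getElem?_eq_getElem i.2, List.countP_append]
  simpa using h

theorem countP_take_lt (P : α → Bool) (l : List α) {i : Fin l.length} {j : ℕ}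
    (h : P (l.get i) = true) (hij : (i : ℕ) < j) :
    (l.take i).countP P < (l.take j).countP P := by
  have := countP_take_mono P l (show (i : ℕ) + 1 ≤ j from hij)
  have := countP_take_succ P l i h
  omega

theorem countP_take_inj (P : α → Bool) (l : List α) {i j : Fin l.length}
    (hi : P (l.get i) = true) (hj : P (l.get j) = true)
    (h : (l.take i).countP P = (l.take j).countP P) : i = j := by
  rcases lt_trichotomy i j with hij | hij | hij
  · have := countP_take_lt P l hi hij
    omega
  · exact hij
  · have := countP_take_lt P l hj hij
    omega

theorem exists_countP_take (P : α → Bool) (l : List α) {n : ℕ} (h : n < l.countP P) :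
    ∃ i : Fin l.length, P (l.get i) = true ∧ (l.take i).countP P = n := by
  induction l generalizing n with
  | nil => simp at h
  | cons x l ih =>
    by_cases hx : P x = true
    · rcases n with _ | n
      · exact ⟨⟨0, by simp⟩, by simpa using hx, by simp⟩
      · obtain ⟨i, h₁, h₂⟩ := ih (n := n) (by simpa [List.countP_cons, hx] using h)
        exact ⟨i.succ, by simpa using h₁, by simp [hx, h₂]⟩
    · obtain ⟨i, h₁, h₂⟩ := ih (n := n) (by simpa [List.countP_cons, hx] using h)
      exact ⟨i.succ, by simpa using h₁, by simp [hx, h₂]⟩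

theorem filter_take_countP (P : α → Bool) (l : List α) (i : ℕ) :
    (l.take i).filter P = (l.filter P).take ((l.take i).countP P) := by
  conv_rhs => rw [← List.take_append_drop i l, List.filter_append]
  rw [List.countP_eq_length_filter]
  simp

theorem getElem?_filter_countP (P : α → Bool) (l : List α) (i : Fin l.length)
    (h : P (l.get i) = true) : (l.filter P)[(l.take i).countP P]? = some (l.get i) := by
  have hl : l = l.take i ++ l.get i :: l.drop (i + 1) := by simp
  conv_lhs =>
    enter [1]
    rw [hl, List.filter_append, List.filter_cons_of_pos h]
  rw [List.countP_eq_length_filter]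
  simp

end Positions

/-! ### Words with the same projections -/

section Projections

variable {P A : Type} [DecidableEq P]

/-- The actions of a participant. -/
def proj (p : P) (e : List (Act P A)) : List (Act P A) :=
  e.filter fun a => decide (a.actor = p)

@[simp]
theorem proj_append (p : P) (e e' : List (Act P A)) : proj p (e ++ e') = proj p e ++ proj p e' :=
  List.filter_append ..

theorem proj_eq_nil {p : P} {e : List (Act P A)} (h : ∀ a ∈ e, a.actor ≠ p) : proj p e = [] := by
  simpa [proj] using h

theorem proj_append_comm {p : P} {e e' : List (Act P A)}
    (h : ∀ a ∈ e, ∀ b ∈ e', a.actor ≠ b.actor) : proj p (e ++ e') = proj p (e' ++ e) := by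
  by_cases hp : ∃ a ∈ e, a.actor = p
  · obtain ⟨a, ha, rfl⟩ := hp
    rw [proj_append, proj_append, proj_eq_nil fun b hb => (h a ha b hb).symm]
    simp
  · push Not at hp
    rw [proj_append, proj_append, proj_eq_nil hp]
    simp

/-- A channel has only one sender, so the index of a send on it can be read off a single projection.
The same holds for receives, and therefore projections determine the matching. -/
theorem countP_sendsOn_proj (p q : P) (e : List (Act P A)) :
    e.countP (Act.sendsOn p q) = (proj p e).countP (Act.sendsOn p q) := by
  rw [proj, List.countP_filter]
  congr 1
  funext a
  rw [Bool.eq_iff_iff]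
  cases a <;> simp +contextual [Act.sendsOn, Act.actor]

theorem countP_recvsOn_proj (p q : P) (e : List (Act P A)) :
    e.countP (Act.recvsOn p q) = (proj q e).countP (Act.recvsOn p q) := by
  rw [proj, List.countP_filter]
  congr 1
  funext a
  rw [Bool.eq_iff_iff]
  cases a <;> simp +contextual [Act.recvsOn, Act.actor]

/-- In no prefix more messages are received than sent, on any channel. -/
def IsFIFOWord (e : List (Act P A)) : Prop :=
  ∀ n p q, (e.take n).countP (Act.recvsOn p q) ≤ (e.take n).countP (Act.sendsOn p q)

/-- Matching pairs without the requirement on the order of the positions. -/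
def IsMatch (e : List (Act P A)) (j j' : Fin e.length) : Prop :=
  ∃ p q a, e.get j = .send p q a ∧ e.get j' = .recv p q a ∧
    (e.take j).countP (Act.sendsOn p q) = (e.take j').countP (Act.recvsOn p q)

/-- If the receive did not come after the send, the prefix ending with the receive would contain
more receives than sends on the channel. -/
theorem IsFIFOWord.isMatchingPair_iff {e : List (Act P A)} (he : IsFIFOWord e)
    {j j' : Fin e.length} : IsMatchingPair e j j' ↔ IsMatch e j j' := by
  refine ⟨fun h => h.2, fun h => ⟨?_, h⟩⟩
  obtain ⟨p, q, a, h₁, h₂, h₃⟩ := h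
  by_contra hlt
  have h₄ := countP_take_succ (Act.recvsOn p q) e j' (by rw [h₂]; simp [Act.recvsOn])
  have h₅ := countP_take_succ_of_not (Act.sendsOn p q) e j' (by rw [h₂]; simp [Act.sendsOn])
  have h₆ := countP_take_mono (Act.sendsOn p q) e (show (j' : ℕ) ≤ j by simpa using hlt)
  have h₇ := he (j' + 1) p q
  omega

/-- Corresponding positions of two words: the same participant has performed the same actions
before. -/
def Corresponds (e e' : List (Act P A)) (j : Fin e.length) (j' : Fin e'.length) : Prop :=
  e.get j = e'.get j' ∧
    proj (e.get j).actor (e.take j) = proj (e.get j).actor (e'.take j')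

/-- The position sought carries the action with the same index in the common projection to its
participant. -/
theorem exists_corresponds {e e' : List (Act P A)} (h : ∀ p, proj p e = proj p e')
    (j : Fin e.length) : ∃ j', Corresponds e e' j j' := by
  set p := (e.get j).actor with hp
  have hlt : (e.take j).countP (fun a => decide (a.actor = p)) <
      e'.countP (fun a => decide (a.actor = p)) := by
    have h₁ := countP_take_lt (fun a => decide (a.actor = p)) e (i := j) (by simp [hp]) j.2
    rw [List.take_length] at h₁
    have h₂ := congrArg List.length (h p)
    simp only [proj, ← List.countP_eq_length_filter] at h₂
    omega
  obtain ⟨j', h₁, h₂⟩ := exists_countP_take _ _ hlt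
  refine ⟨j', ?_, ?_⟩
  · have h₃ := getElem?_filter_countP (fun a => decide (a.actor = p)) e j (by simp [hp])
    have h₄ := getElem?_filter_countP (fun a => decide (a.actor = p)) e' j' h₁
    have h₅ : e.filter _ = e'.filter _ := h p
    rw [h₂, ← h₅, h₃] at h₄
    exact Option.some.inj h₄
  · have h₅ : e.filter _ = e'.filter _ := h p
    simp only [proj]
    rw [filter_take_countP, filter_take_countP, ← hp, h₂, h₅]

theorem Corresponds.symm {e e' : List (Act P A)} {j : Fin e.length} {j' : Fin e'.length}
    (h : Corresponds e e' j j') : Corresponds e' e j' j :=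
  ⟨h.1.symm, by rw [← h.1]; exact h.2.symm⟩

theorem length_proj_take_lt {e : List (Act P A)} {j j' : Fin e.length} (h : j < j') :
    (proj (e.get j).actor (e.take j)).length < (proj (e.get j).actor (e.take j')).length := by
  simp only [proj, ← List.countP_eq_length_filter]
  exact countP_take_lt _ _ (by simp) h

/-- The positions of one participant are ordered by the lengths of the projected prefixes, and
corresponding positions share these prefixes. -/
theorem Corresponds.lt_of_lt {e e' : List (Act P A)} {i j : Fin e.length} {i' j' : Fin e'.length}
    (hi : Corresponds e e' i i') (hj : Corresponds e e' j j')
    (ha : (e.get i).actor = (e.get j).actor) (h : i < j) : i' < j' := by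
  have h₁ := length_proj_take_lt h
  have h₂ := hi.2
  have h₃ := hj.2
  rw [← ha] at h₃
  rw [h₂, h₃] at h₁
  simp only [proj, ← List.countP_eq_length_filter] at h₁
  by_contra hlt
  have := countP_take_mono (fun a => decide (a.actor = (e.get i).actor)) e'
    (show (j' : ℕ) ≤ i' by simpa using hlt)
  omega

theorem Corresponds.unique {e e' : List (Act P A)} {i j : Fin e.length} {j' : Fin e'.length}
    (hi : Corresponds e e' i j') (hj : Corresponds e e' j j') : i = j := by
  have ha : (e.get i).actor = (e.get j).actor := by rw [hi.1, hj.1]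
  rcases lt_trichotomy i j with h | h | h
  · exact absurd (hi.lt_of_lt hj ha h) (lt_irrefl _)
  · exact h
  · exact absurd (hj.lt_of_lt hi ha.symm h) (lt_irrefl _)

/-- The correspondence of the positions of two words with the same projections. -/
noncomputable def positionEquiv {e e' : List (Act P A)} (h : ∀ p, proj p e = proj p e') :
    Fin e.length ≃ Fin e'.length :=
  Equiv.ofBijective (fun j => (exists_corresponds h j).choose) <| by
    have hs (j) : Corresponds e e' j _ := (exists_corresponds h j).choose_spec
    constructor
    · intro i j hij
      have := hs j
      rw [← show (exists_corresponds h i).choose = (exists_corresponds h j).choose from hij] at this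
      exact (hs i).unique this
    · intro j'
      obtain ⟨j, hj⟩ := exists_corresponds (fun p => (h p).symm) j'
      exact ⟨j, (hs j).symm.unique hj⟩

theorem corresponds_positionEquiv {e e' : List (Act P A)} (h : ∀ p, proj p e = proj p e')
    (j : Fin e.length) : Corresponds e e' j (positionEquiv h j) :=
  (exists_corresponds h j).choose_spec

/-- The two counts depend only on the projected prefixes of the sender and of the receiver. -/
theorem Corresponds.isMatch {e e' : List (Act P A)} {i j : Fin e.length} {i' j' : Fin e'.length}
    (hi : Corresponds e e' i i') (hj : Corresponds e e' j j') (h : IsMatch e i j) :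
    IsMatch e' i' j' := by
  obtain ⟨p, q, a, h₁, h₂, h₃⟩ := h
  refine ⟨p, q, a, hi.1 ▸ h₁, hj.1 ▸ h₂, ?_⟩
  have h₄ := hi.2
  have h₅ := hj.2
  rw [h₁] at h₄
  rw [h₂] at h₅
  simp only [Act.actor] at h₄ h₅
  rw [countP_sendsOn_proj, countP_recvsOn_proj, ← h₄, ← h₅, ← countP_sendsOn_proj,
    ← countP_recvsOn_proj, h₃]

variable {e e' : List (Act P A)}

theorem isMatchingPair_positionEquiv (he : IsFIFOWord e) (he' : IsFIFOWord e')
    (h : ∀ p, proj p e = proj p e') {i j : Fin e.length} :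
    IsMatchingPair e' (positionEquiv h i) (positionEquiv h j) ↔ IsMatchingPair e i j := by
  have hc := corresponds_positionEquiv h
  rw [he.isMatchingPair_iff, he'.isMatchingPair_iff]
  exact ⟨(hc i).symm.isMatch (hc j).symm, (hc i).isMatch (hc j)⟩

/-- Positions of one participant are ordered as in its projection. Positions of different
participants conflict only if they match, and then both words, being FIFO, have the send first. -/
theorem conflict_positions (he : IsFIFOWord e) (he' : IsFIFOWord e')
    (h : ∀ p, proj p e = proj p e') {i j : Fin e.length} :
    (positionEquiv h i < positionEquiv h j ∧
      ¬ Commute e' (positionEquiv h i) (positionEquiv h j)) ↔ (i < j ∧ ¬ Commute e i j) := by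
  have hc := corresponds_positionEquiv h
  unfold Commute
  rw [isMatchingPair_positionEquiv he he' h, isMatchingPair_positionEquiv he he' h,
    ← (hc i).1, ← (hc j).1]
  by_cases ha : (e.get i).actor = (e.get j).actor
  · simp only [ha, ne_eq, not_true_eq_false, false_and, not_false_eq_true, and_true]
    refine ⟨fun hlt => (hc i).symm.lt_of_lt (hc j).symm ?_ hlt, (hc i).lt_of_lt (hc j) ha⟩
    rw [← (hc i).1, ← (hc j).1, ha]
  · have h₁ : IsMatchingPair e i j → i < j := fun h => h.1
    have h₂ : IsMatchingPair e j i → j < i := fun h => h.1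
    have h₃ : IsMatchingPair e i j → positionEquiv h i < positionEquiv h j := fun hm =>
      ((isMatchingPair_positionEquiv he he' h).2 hm).1
    have h₄ : IsMatchingPair e j i → positionEquiv h j < positionEquiv h i := fun hm =>
      ((isMatchingPair_positionEquiv he he' h).2 hm).1
    constructor
    · rintro ⟨hlt, hn⟩
      have : IsMatchingPair e i j := by
        by_contra hm
        exact hn ⟨ha, hm, fun hm' => absurd (h₄ hm') hlt.asymm⟩
      exact ⟨h₁ this, hn⟩
    · rintro ⟨hlt, hn⟩
      have : IsMatchingPair e i j := by
        by_contra hm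
        exact hn ⟨ha, hm, fun hm' => absurd (h₂ hm') hlt.asymm⟩
      exact ⟨h₃ this, hn⟩

theorem isInteraction_image (he : IsFIFOWord e) (he' : IsFIFOWord e')
    (h : ∀ p, proj p e = proj p e') {v : Set (Fin e.length)} (hv : IsInteraction e v) :
    IsInteraction e' (positionEquiv h '' v) := by
  have hc := corresponds_positionEquiv h
  rcases hv with ⟨j, j', hm, rfl⟩ | ⟨j, rfl, hs, hm⟩ | ⟨j, rfl, hi⟩
  · exact Or.inl ⟨_, _, (isMatchingPair_positionEquiv he he' h).2 hm, Set.image_pair ..⟩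
  · refine Or.inr (Or.inl ⟨_, Set.image_singleton, (hc j).1 ▸ hs, fun j' hj' => ?_⟩)
    obtain ⟨i, rfl⟩ := (positionEquiv h).surjective j'
    exact hm i ((isMatchingPair_positionEquiv he he' h).1 hj')
  · exact Or.inr (Or.inr ⟨_, Set.image_singleton, (hc j).1 ▸ hi⟩)

/-- FIFO words with the same projections are causally equivalent. -/
theorem exists_causallyEquivalent (he : IsFIFOWord e) (he' : IsFIFOWord e')
    (h : ∀ p, proj p e = proj p e') {V : Set (Set (Fin e.length))} (hV : IsValidComm e V) :
    ∃ V', IsValidComm e' V' ∧ CausallyEquivalent e V e' V' := by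
  have hc := corresponds_positionEquiv h
  set φ := positionEquiv h with hφ
  have hinj : Function.Injective fun v : Set (Fin e.length) => φ '' v :=
    Set.image_injective.2 φ.injective
  refine ⟨(fun v => φ '' v) '' V, ⟨?_, fun j' => ?_⟩, Equiv.Set.image _ V hinj, ?_, ?_⟩
  · rintro _ ⟨v, hv, rfl⟩
    exact isInteraction_image he he' h (hV.1 v hv)
  · obtain ⟨j, rfl⟩ := φ.surjective j'
    obtain ⟨v, ⟨hv, hj⟩, hu⟩ := hV.2 j
    refine ⟨φ '' v, ⟨⟨v, hv, rfl⟩, j, hj, rfl⟩, ?_⟩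
    rintro _ ⟨⟨w, hw, rfl⟩, hjw⟩
    rw [hu w ⟨hw, by simpa using hjw⟩]
  · rintro ⟨v, hv⟩
    simp only [Equiv.Set.image_apply, Set.image_image]
    exact Set.image_congr fun j _ => (hc j).1.symm
  · rintro ⟨v, hv⟩ ⟨w, hw⟩
    simp only [Conflict, Equiv.Set.image_apply, Set.exists_mem_image]
    refine exists_congr fun i => and_congr_right fun _ => exists_congr fun j =>
      and_congr_right fun _ => conflict_positions he he' h

end Projections

end CrashStop

namespace CrashStop

open Relation

namespace FIFOSystem

variable {P A : Type} {S : FIFOSystem P A}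

theorem run_append {c c' : Config S} {e e' : List (Act P A)} :
    Run S c (e ++ e') c' ↔ ∃ d, Run S c e d ∧ Run S d e' c' := by
  induction e generalizing c with
  | nil => simp [Run]
  | cons a e ih => simp only [List.cons_append, Run, ih]; grind

theorem run_singleton {c c' : Config S} {a : Act P A} : Run S c [a] c' ↔ Step S c a c' := by
  simp [Run]

theorem ne_of_step_send {c c' : Config S} {p q : P} {a : A} (h : Step S c (.send p q a) c') :
    p ≠ q :=
  (S p).onChannel _ _ _ h.1

theorem ne_of_step_recv {c c' : Config S} {p q : P} {a : A} (h : Step S c (.recv p q a) c') :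
    p ≠ q :=
  (S q).onChannel _ _ _ h.1

/-! ### Executions are FIFO words -/

section Words

variable [DecidableEq P]

theorem countP_eq_of_run {c c' : Config S} {e : List (Act P A)} (h : Run S c e c') (p q : P) :
    (c.chan p q).length + e.countP (Act.sendsOn p q) =
      e.countP (Act.recvsOn p q) + (c'.chan p q).length := by
  induction e generalizing c with
  | nil => obtain rfl := h; simp
  | cons a e ih =>
    obtain ⟨d, ⟨-, -, hd⟩, h⟩ := h
    have := ih h
    rw [List.countP_cons, List.countP_cons]
    cases a with
    | internal p' i =>
      have hd : d.chan = c.chan := hd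
      rw [hd] at this
      simpa [Act.sendsOn, Act.recvsOn] using this
    | send p' q' a =>
      by_cases hpq : p' = p ∧ q' = q
      · obtain ⟨rfl, rfl⟩ := hpq
        have := congrArg List.length hd.1
        simp [Act.sendsOn, Act.recvsOn] at this ⊢
        omega
      · rw [hd.2 p q fun h => hpq ⟨(Prod.ext_iff.1 h).1.symm, (Prod.ext_iff.1 h).2.symm⟩] at this
        simpa [Act.sendsOn, Act.recvsOn, hpq] using this
    | recv p' q' a =>
      by_cases hpq : p' = p ∧ q' = q
      · obtain ⟨rfl, rfl⟩ := hpq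
        have := congrArg List.length hd.1
        simp [Act.sendsOn, Act.recvsOn] at this ⊢
        omega
      · rw [hd.2 p q fun h => hpq ⟨(Prod.ext_iff.1 h).1.symm, (Prod.ext_iff.1 h).2.symm⟩] at this
        simpa [Act.sendsOn, Act.recvsOn, hpq] using this

theorem countP_eq_of_run_init {c : Config S} {e : List (Act P A)} (h : Run S (initConfig S) e c)
    (p q : P) : e.countP (Act.sendsOn p q) =
      e.countP (Act.recvsOn p q) + (c.chan p q).length := by
  simpa [initConfig] using countP_eq_of_run h p q

theorem isFIFOWord_of_run {c : Config S} {e : List (Act P A)} (h : Run S (initConfig S) e c) :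
    IsFIFOWord e := by
  intro n p q
  rw [← List.take_append_drop n e, run_append] at h
  obtain ⟨d, h, -⟩ := h
  have := countP_eq_of_run_init h p q
  omega

/-- The payloads sent on a channel. -/
def sent (p q : P) (e : List (Act P A)) : List A :=
  e.filterMap fun
    | .send p' q' a => if p' = p ∧ q' = q then some a else none
    | _ => none

/-- The payloads received from a channel. -/
def received (p q : P) (e : List (Act P A)) : List A :=
  e.filterMap fun
    | .recv p' q' a => if p' = p ∧ q' = q then some a else none
    | _ => none

/-- The FIFO discipline as an equation of words; it identifies the `k`-th message received with the
`k`-th message sent. -/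
theorem sent_eq_of_run {c c' : Config S} {e : List (Act P A)} (h : Run S c e c') (p q : P) :
    c.chan p q ++ sent p q e = received p q e ++ c'.chan p q := by
  induction e generalizing c with
  | nil => obtain rfl := h; simp [sent, received]
  | cons a e ih =>
    obtain ⟨d, ⟨-, -, hd⟩, h⟩ := h
    have := ih h
    cases a with
    | internal p' i =>
      have hd : d.chan = c.chan := hd
      rw [hd] at this
      simpa [sent, received] using this
    | send p' q' a =>
      by_cases hpq : p' = p ∧ q' = q
      · obtain ⟨rfl, rfl⟩ := hpq
        rw [hd.1] at this
        simpa [sent, received] using this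
      · rw [hd.2 p q fun h => hpq ⟨(Prod.ext_iff.1 h).1.symm, (Prod.ext_iff.1 h).2.symm⟩] at this
        simpa [sent, received, hpq] using this
    | recv p' q' a =>
      by_cases hpq : p' = p ∧ q' = q
      · obtain ⟨rfl, rfl⟩ := hpq
        rw [hd.1]
        simpa [sent, received] using this
      · rw [hd.2 p q fun h => hpq ⟨(Prod.ext_iff.1 h).1.symm, (Prod.ext_iff.1 h).2.symm⟩] at this
        simpa [sent, received, hpq] using this

theorem sent_getElem? (p q : P) (e : List (Act P A)) {n : ℕ} {a : A}
    (h : (sent p q e)[n]? = some a) :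
    ∃ i : Fin e.length, e.get i = .send p q a ∧ (e.take i).countP (Act.sendsOn p q) = n := by
  induction e generalizing n with
  | nil => simp [sent] at h
  | cons b e ih =>
    by_cases hb : ∃ b', b = .send p q b'
    · obtain ⟨b', rfl⟩ := hb
      rcases n with _ | n
      · refine ⟨⟨0, by simp⟩, ?_, by simp⟩
        simpa [sent] using h
      · obtain ⟨i, h₁, h₂⟩ := ih (n := n) (by simpa [sent] using h)
        exact ⟨i.succ, by simpa using h₁, by simp [h₂, Act.sendsOn]⟩
    · have hb' : Act.sendsOn p q b = false := by
        cases b <;> simp_all [Act.sendsOn]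
      have : sent p q (b :: e) = sent p q e := by
        cases b <;> simp_all [sent]
      obtain ⟨i, h₁, h₂⟩ := ih (this ▸ h)
      exact ⟨i.succ, by simpa using h₁, by simp [h₂, hb']⟩

theorem length_received (p q : P) (e : List (Act P A)) :
    (received p q e).length = e.countP (Act.recvsOn p q) := by
  induction e with
  | nil => rfl
  | cons b e ih =>
    rw [List.countP_cons, ← ih]
    cases b with
    | recv p' q' a => by_cases h : p' = p ∧ q' = q <;> simp [received, Act.recvsOn, h]
    | _ => simp [received, Act.recvsOn]

/-- In an execution every receive belongs to a matching pair. -/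
theorem exists_isMatchingPair_of_recv {c : Config S} {e : List (Act P A)}
    (h : Run S (initConfig S) e c) {j' : Fin e.length} {p q : P} {a : A}
    (hj' : e.get j' = .recv p q a) : ∃ j, IsMatchingPair e j j' := by
  have hsplit : e = e.take j' ++ e.get j' :: e.drop (j' + 1) := by simp
  have hr := h
  rw [hsplit, hj', run_append] at hr
  obtain ⟨d, hd, d', ⟨-, -, hs⟩, -⟩ := hr
  have h₁ := sent_eq_of_run hd p q
  rw [hs.1] at h₁
  -- The head of the channel is the sent message whose index is the number of earlier receives.
  have h₂ : (sent p q (e.take j'))[(e.take j').countP (Act.recvsOn p q)]? = some a := by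
    have : sent p q (e.take j') = received p q (e.take j') ++ a :: d'.chan p q := by
      simpa [initConfig] using h₁
    rw [this, ← length_received]
    simp
  have h₃ : (sent p q e)[(e.take j').countP (Act.recvsOn p q)]? = some a := by
    have : sent p q e = sent p q (e.take j') ++ sent p q (e.drop j') := by
      conv_lhs => rw [← List.take_append_drop j' e]
      exact List.filterMap_append
    rw [this, List.getElem?_append_left (List.getElem?_eq_some_iff.1 h₂).1, h₂]
  obtain ⟨j, hj, hc⟩ := sent_getElem? p q e h₃
  exact ⟨j, (isFIFOWord_of_run h).isMatchingPair_iff.2 ⟨p, q, a, hj, hj', hc⟩⟩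

end Words

/-! ### Synchronous runs -/

/-- One interaction: a message exchange through an empty channel, a send, or an internal action. -/
inductive SStep (S : FIFOSystem P A) : Config S → List (Act P A) → Config S → Prop
  | pair (c d : Config S) (p q : P) (a : A) : p ≠ q → c.chan p q = [] →
      (c.state p, .send p q a, d.state p) ∈ (S p).trans →
      (c.state q, .recv p q a, d.state q) ∈ (S q).trans →
      (∀ r, r ≠ p → r ≠ q → d.state r = c.state r) → d.chan = c.chan →
      SStep S c [.send p q a, .recv p q a] d
  | send (c d : Config S) (p q : P) (a : A) : Step S c (.send p q a) d →
      SStep S c [.send p q a] d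
  | internal (c d : Config S) (p : P) (i : InternalName) : Step S c (.internal p i) d →
      SStep S c [.internal p i] d

/-- Sequences of interactions. -/
def SRun (S : FIFOSystem P A) : Config S → List (List (Act P A)) → Config S → Prop
  | c, [], d => c = d
  | c, v :: L, d => ∃ m, SStep S c v m ∧ SRun S m L d

theorem srun_append {c c' : Config S} {L L' : List (List (Act P A))} :
    SRun S c (L ++ L') c' ↔ ∃ d, SRun S c L d ∧ SRun S d L' c' := by
  induction L generalizing c with
  | nil => simp [SRun]
  | cons a L ih => simp only [List.cons_append, SRun, ih]; grind

theorem srun_singleton {c c' : Config S} {v : List (Act P A)} :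
    SRun S c [v] c' ↔ SStep S c v c' := by
  simp [SRun]

/-- The participants of an interaction. -/
def actors (v : List (Act P A)) : Set P :=
  {r | ∃ a ∈ v, a.actor = r}

@[simp]
theorem actors_pair (p q : P) (a : A) :
    actors [Act.send p q a, Act.recv p q a] = {p, q} := by
  ext r; simp [actors, Act.actor, eq_comm]

@[simp]
theorem actors_send (p q : P) (a : A) : actors [Act.send p q a] = {p} := by
  ext r; simp [actors, Act.actor, eq_comm]

@[simp]
theorem actors_internal (p : P) (i : InternalName) :
    actors [(Act.internal p i : Act P A)] = {p} := by
  ext r; simp [actors, Act.actor, eq_comm]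

/-- Two configurations agree on the state and the outgoing channels of a participant. -/
def Agree (c d : Config S) (r : P) : Prop :=
  c.state r = d.state r ∧ ∀ t, c.chan r t = d.chan r t

theorem Agree.symm {c d : Config S} {r : P} (h : Agree c d r) : Agree d c r :=
  ⟨h.1.symm, fun t => (h.2 t).symm⟩

theorem Agree.trans {c d e : Config S} {r : P} (h : Agree c d r) (h' : Agree d e r) :
    Agree c e r :=
  ⟨h.1.trans h'.1, fun t => (h.2 t).trans (h'.2 t)⟩

theorem SStep.agree {c d : Config S} {v : List (Act P A)} (h : SStep S c v d) {r : P}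
    (hr : r ∉ actors v) : Agree d c r := by
  cases h with
  | pair _ p q a _ _ _ _ h₁ h₂ =>
    simp only [actors_pair, Set.mem_insert_iff, Set.mem_singleton_iff, not_or] at hr
    exact ⟨h₁ r hr.1 hr.2, fun t => by rw [h₂]⟩
  | send _ p q a h =>
    simp only [actors_send, Set.mem_singleton_iff] at hr
    exact ⟨h.2.1 r hr, fun t => h.2.2.2 r t (by simp [hr])⟩
  | internal _ p i h =>
    simp only [actors_internal, Set.mem_singleton_iff] at hr
    exact ⟨h.2.1 r hr, fun t => by rw [show d.chan = c.chan from h.2.2]⟩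

/-- An interaction depends only on its participants. -/
theorem SStep.congr {c d c' d' : Config S} {v : List (Act P A)} (h : SStep S c v d)
    (h₁ : ∀ r ∈ actors v, Agree c' c r) (h₂ : ∀ r ∈ actors v, Agree d' d r)
    (h₃ : ∀ r ∉ actors v, Agree d' c' r) : SStep S c' v d' := by
  cases h with
  | pair _ p q a hpq hc hs hr ho hch =>
    have hp := h₁ p (by simp)
    have hq := h₁ q (by simp)
    have hp' := h₂ p (by simp)
    have hq' := h₂ q (by simp)
    refine .pair _ _ _ _ _ hpq (by rw [hp.2, hc]) (by rw [hp.1, hp'.1]; exact hs)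
      (by rw [hq.1, hq'.1]; exact hr) (fun r hrp hrq => (h₃ r (by simp [hrp, hrq])).1) ?_
    funext r t
    by_cases hr : r ∈ actors [Act.send p q a, Act.recv p q a]
    · rw [(h₂ r hr).2, (h₁ r hr).2, hch]
    · rw [(h₃ r hr).2]
  | send _ p q a h =>
    have hp := h₁ p (by simp)
    have hp' := h₂ p (by simp)
    refine .send _ _ _ _ _ ⟨?_, fun r (hr : r ≠ p) => (h₃ r (by simpa using hr)).1, ?_, fun r t hrt => ?_⟩
    · simp only [Act.actor]
      rw [hp.1, hp'.1]
      exact h.1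
    · rw [hp.2, hp'.2]
      exact h.2.2.1
    · by_cases hr : r = p
      · subst hr
        rw [hp.2, hp'.2]
        exact h.2.2.2 r t hrt
      · exact (h₃ r (by simpa using hr)).2 t
  | internal _ p i h =>
    have hp := h₁ p (by simp)
    have hp' := h₂ p (by simp)
    refine .internal _ _ _ _ ⟨?_, fun r (hr : r ≠ p) => (h₃ r (by simpa using hr)).1, ?_⟩
    · simp only [Act.actor]
      rw [hp.1, hp'.1]
      exact h.1
    · funext r t
      by_cases hr : r = p
      · subst hr
        rw [hp.2, hp'.2, show d.chan = c.chan from h.2.2]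
      · exact (h₃ r (by simpa using hr)).2 t

/-- If every channel is attributed to its sender, interactions without a common participant read and
change disjoint parts of the configuration. -/
theorem SStep.swap {c d f : Config S} {v w : List (Act P A)} (hv : SStep S c v d)
    (hw : SStep S d w f) (hd : Disjoint (actors v) (actors w)) :
    ∃ d', SStep S c w d' ∧ SStep S d' v f := by
  classical
  -- The participants of `w` have already moved, all others are still as in `c`.
  let d' : Config S :=
    { state := fun r => if r ∈ actors w then f.state r else c.state r
      chan := fun r t => if r ∈ actors w then f.chan r t else c.chan r t }
  have h₁ (r) (hr : r ∈ actors w) : Agree d' f r := by simp [Agree, d', hr]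
  have h₂ (r) (hr : r ∉ actors w) : Agree d' c r := by simp [Agree, d', hr]
  refine ⟨d', hw.congr (fun r hr => (hv.agree (hd.notMem_of_mem_right hr)).symm) h₁ h₂,
    hv.congr (fun r hr => h₂ r (hd.notMem_of_mem_left hr))
      (fun r hr => hw.agree (hd.notMem_of_mem_left hr)) fun r hr => ?_⟩
  by_cases hr' : r ∈ actors w
  · exact (h₁ r hr').symm
  · exact ((hw.agree hr').trans (hv.agree hr)).trans (h₂ r hr').symm

theorem SStep.swap_run {c d f : Config S} {v : List (Act P A)} {L : List (List (Act P A))}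
    (hv : SStep S c v d) (hL : SRun S d L f) (hd : ∀ w ∈ L, Disjoint (actors v) (actors w)) :
    ∃ d', SRun S c L d' ∧ SStep S d' v f := by
  induction L generalizing c d with
  | nil => obtain rfl := hL; exact ⟨c, rfl, hv⟩
  | cons w L ih =>
    obtain ⟨m, hw, hL⟩ := hL
    obtain ⟨m', hw', hv'⟩ := hv.swap hw (hd w (.head _))
    obtain ⟨d', hL', hv''⟩ := ih hv' hL fun w hw => hd w (.tail _ hw)
    exact ⟨d', ⟨m', hw', hL'⟩, hv''⟩

/-- An exchange goes through an empty channel and leaves it empty, so no interaction removes a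
waiting message. Once non-empty, a channel is blocked for the rest of a synchronous run. -/
theorem SStep.chan_prefix {c d : Config S} {v : List (Act P A)} (h : SStep S c v d) (p q : P) :
    c.chan p q <+: d.chan p q := by
  cases h with
  | pair _ _ _ _ _ _ _ _ _ h => rw [h]
  | send _ p' q' a h =>
    by_cases hpq : (p, q) = (p', q')
    · obtain ⟨rfl, rfl⟩ := Prod.ext_iff.1 hpq
      rw [h.2.2.1]
      exact List.prefix_append _ _
    · rw [h.2.2.2 p q hpq]
  | internal _ _ _ h => rw [show d.chan = c.chan from h.2.2]

theorem SRun.chan_prefix {c d : Config S} {L : List (List (Act P A))} (h : SRun S c L d)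
    (p q : P) : c.chan p q <+: d.chan p q := by
  induction L generalizing c with
  | nil => obtain rfl := h; exact List.prefix_refl _
  | cons v L ih =>
    obtain ⟨m, hv, h⟩ := h
    exact (hv.chan_prefix p q).trans (ih h)

theorem SRun.agree {c d : Config S} {L : List (List (Act P A))} (h : SRun S c L d) {r : P}
    (hr : ∀ v ∈ L, r ∉ actors v) : Agree d c r := by
  induction L generalizing c with
  | nil => obtain rfl := h; exact ⟨rfl, fun _ => rfl⟩
  | cons v L ih =>
    obtain ⟨m, hv, h⟩ := h
    exact (ih h fun v hv => hr v (.tail _ hv)).trans (hv.agree (hr v (.head _)))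

/-- A receive from a non-empty channel commutes with the interactions of the other
participants. -/
theorem SStep.swap_recv {c d f : Config S} {v : List (Act P A)} {p q : P} {m : A}
    (hv : SStep S c v d) (hr : Step S d (.recv p q m) f) (hq : q ∉ actors v)
    (hc : c.chan p q ≠ []) : ∃ d', Step S c (.recv p q m) d' ∧ SStep S d' v f := by
  classical
  -- Channels grow only at their end, so the message received after `v` is already the first one
  -- before `v`.
  obtain ⟨x, u, hxu⟩ := List.exists_cons_of_ne_nil hc
  obtain ⟨y, hy⟩ := hv.chan_prefix p q
  rw [hr.2.2.1, hxu] at hy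
  obtain ⟨rfl, hy⟩ : x = m ∧ u ++ y = f.chan p q := by simpa using hy
  let d' : Config S :=
    { state := fun r => if r = q then f.state r else c.state r
      chan := fun r t => if r = p ∧ t = q then u else c.chan r t }
  have hd' : Step S c (.recv p q x) d' := by
    refine ⟨?_, fun r (hr : r ≠ q) => by simp [d', hr], by simpa [d'] using hxu,
      fun r t hrt => ?_⟩
    · have := hr.1
      rw [show d.state (Act.recv p q x).actor = c.state q from (hv.agree hq).1] at this
      simpa [Act.actor, d'] using this
    · simp only [d']
      rw [if_neg fun h => hrt (Prod.ext_iff.2 h)]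
  refine ⟨d', hd', ?_⟩
  have hstate (r) (h : r ≠ q) : f.state r = d.state r := hr.2.1 r h
  have hchan (r t) (h : (r, t) ≠ (p, q)) : f.chan r t = d.chan r t := hr.2.2.2 r t h
  have hchan' (r t) (h : (r, t) ≠ (p, q)) : d'.chan r t = c.chan r t := hd'.2.2.2 r t h
  cases hv with
  | pair _ p' q' a hpq hce hs hre ho hch =>
    simp only [actors_pair, Set.mem_insert_iff, Set.mem_singleton_iff, not_or] at hq
    have hne : (p', q') ≠ (p, q) := fun h => hq.2 (Prod.ext_iff.1 h).2.symm
    refine .pair _ _ _ _ _ hpq ?_ ?_ ?_ (fun r h₁ h₂ => ?_) ?_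
    · rw [hchan' _ _ hne, hce]
    · rw [hstate _ (Ne.symm hq.1)]
      simpa [d', Ne.symm hq.1] using hs
    · rw [hstate _ (Ne.symm hq.2)]
      simpa [d', Ne.symm hq.2] using hre
    · by_cases h : r = q
      · simp [d', h]
      · rw [hstate r h, ho r h₁ h₂]
        simp [d', h]
    · funext r t
      by_cases h : (r, t) = (p, q)
      · obtain ⟨rfl, rfl⟩ := Prod.ext_iff.1 h
        have := hr.2.2.1
        rw [hch, hxu] at this
        simpa [d'] using this.symm
      · rw [hchan r t h, hch, hchan' r t h]
  | send _ p' q' a h =>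
    simp only [actors_send, Set.mem_singleton_iff] at hq
    refine .send _ _ _ _ _ ⟨?_, fun r (hrp : r ≠ p') => ?_, ?_, fun r t hrt => ?_⟩
    · have := h.1
      simp only [Act.actor] at this ⊢
      rw [hstate _ (Ne.symm hq)]
      simpa [d', Ne.symm hq] using this
    · by_cases h' : r = q
      · simp [d', h']
      · rw [hstate r h', h.2.1 r hrp]
        simp [d', h']
    · by_cases h' : (p', q') = (p, q)
      · obtain ⟨rfl, rfl⟩ := Prod.ext_iff.1 h'
        have h₁ := h.2.2.1
        rw [hr.2.2.1, hxu] at h₁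
        simpa [d'] using h₁
      · rw [hchan _ _ h', hchan' _ _ h']
        exact h.2.2.1
    · by_cases h' : (r, t) = (p, q)
      · obtain ⟨rfl, rfl⟩ := Prod.ext_iff.1 h'
        have h₁ := h.2.2.2 r t hrt
        rw [hr.2.2.1, hxu] at h₁
        simpa [d'] using h₁
      · rw [hchan _ _ h', hchan' _ _ h']
        exact h.2.2.2 r t hrt
  | internal _ p' i h =>
    simp only [actors_internal, Set.mem_singleton_iff] at hq
    have hch : d.chan = c.chan := h.2.2
    refine .internal _ _ _ _ ⟨?_, fun r (hrp : r ≠ p') => ?_, ?_⟩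
    · have := h.1
      simp only [Act.actor] at this ⊢
      rw [hstate _ (Ne.symm hq)]
      simpa [d', Ne.symm hq] using this
    · by_cases h' : r = q
      · simp [d', h']
      · rw [hstate r h', h.2.1 r hrp]
        simp [d', h']
    · change f.chan = d'.chan
      funext r t
      by_cases h' : (r, t) = (p, q)
      · obtain ⟨rfl, rfl⟩ := Prod.ext_iff.1 h'
        have := hr.2.2.1
        rw [hch, hxu] at this
        simpa [d'] using this.symm
      · rw [hchan r t h', hch, hchan' r t h']

theorem SStep.run {c d : Config S} {v : List (Act P A)} (h : SStep S c v d) : Run S c v d := by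
  classical
  cases h with
  | pair _ p q a hpq hc hs hr ho hch =>
    -- Between the two actions only the sender has moved, and its message is in transit.
    let m : Config S :=
      { state := fun r => if r = p then d.state r else c.state r
        chan := fun r t => if r = p ∧ t = q then [a] else c.chan r t }
    refine ⟨m, ⟨?_, fun r (hr : r ≠ p) => by simp [m, hr], by simp [m, hc], fun r t hrt => ?_⟩, d,
      ⟨?_, fun r (hr : r ≠ q) => ?_, by simp [m, hch, hc], fun r t hrt => ?_⟩, rfl⟩
    · have h₁ : m.state p = d.state p := by simp [m]
      simp only [Act.actor]
      rw [h₁]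
      exact hs
    · simp only [m]
      rw [if_neg fun h => hrt (Prod.ext_iff.2 h)]
    · have h₁ : m.state q = c.state q := by simp [m, hpq.symm]
      simp only [Act.actor]
      rw [h₁]
      exact hr
    · by_cases h : r = p
      · simp [m, h]
      · simp [m, h, ho r h hr]
    · simp only [m, hch]
      rw [if_neg fun h => hrt (Prod.ext_iff.2 h)]
  | send _ p q a h => exact ⟨d, h, rfl⟩
  | internal _ p i h => exact ⟨d, h, rfl⟩

theorem SRun.run {c d : Config S} {L : List (List (Act P A))} (h : SRun S c L d) :
    Run S c L.flatten d := by
  induction L generalizing c with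
  | nil => exact h
  | cons v L ih =>
    obtain ⟨m, hv, h⟩ := h
    exact run_append.2 ⟨m, hv.run, ih h⟩

end FIFOSystem

end CrashStop

namespace CrashStop

open Relation

-- Systems without violations are RSC

namespace FIFOSystem

variable {P A : Type} {S : FIFOSystem P A}

/-- A causal chain from the participant `x` to the participant `y`, through a sequence of
interactions. -/
def Chain : List (List (Act P A)) → P → P → Prop
  | [], x, y => x = y
  | v :: L, x, y => ∃ z, (z = x ∨ x ∈ actors v ∧ z ∈ actors v) ∧ Chain L z y

/-- After a synchronous run a message can be sent that can be received only by the last action of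
a causal chain. -/
def HasViolation (S : FIFOSystem P A) : Prop :=
  ∃ (d c c' : Config S) (p q : P) (m : A) (L R : List (List (Act P A))),
    SRun S (initConfig S) L d ∧ d.chan p q = [] ∧ Step S d (.send p q m) c ∧ SRun S c R c' ∧
      Chain R p q ∧ ∃ s, (c'.state q, .recv p q m, s) ∈ (S q).trans

section

variable [DecidableEq P]

/-- If there is no violation, a receive can be moved next to the corresponding send. `R` is the
part of the run on which the receive depends, with participants in `Y`. -/
theorem exists_srun_recv (hS : ¬ HasViolation S) {p q : P} {m : A} (L : List (List (Act P A)))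
    {R : List (List (Act P A))} {c d d' : Config S} {Y : Set P}
    (hL : SRun S (initConfig S) L c) (hR : SRun S c R d) (hr : Step S d (.recv p q m) d')
    (hc : c.chan p q ≠ []) (hq : q ∈ Y) (hY : ∀ w ∈ R, actors w ⊆ Y)
    (hchain : ∀ y ∈ Y, Chain R y q) :
    ∃ J, SRun S (initConfig S) J d' ∧
      ∀ r, proj r J.flatten = proj r (L.flatten ++ (R.flatten ++ [.recv p q m])) := by
  induction L using List.reverseRecOn generalizing R c d d' Y with
  | nil =>
    -- Initially all channels are empty, so the message must have been sent within `L`.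
    obtain rfl := hL
    exact absurd rfl hc
  | append_singleton L v ih =>
    rw [srun_append] at hL
    obtain ⟨b, hL, hv⟩ := hL
    rw [srun_singleton] at hv
    have hcomm (hdis : Disjoint (actors v) Y) (w : List (Act P A))
        (hw : ∀ a ∈ w, a.actor ∈ Y) (r : P) : proj r (v ++ w) = proj r (w ++ v) := by
      refine proj_append_comm fun a ha b hb hab => ?_
      exact Set.disjoint_left.1 hdis ⟨a, ha, rfl⟩ (hab ▸ hw b hb)
    have hRY (a) (ha : a ∈ R.flatten) : a.actor ∈ Y := by
      obtain ⟨w, hw, ha⟩ := List.mem_flatten.1 ha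
      exact hY w hw ⟨a, ha, rfl⟩
    -- If `v` makes the channel non-empty, then it is the send of the message that is received.
    -- Otherwise the message is older than `v` and the search continues to the left.
    by_cases hb : b.chan p q = []
    · have hsend : ∃ a, v = [.send p q a] ∧ Step S b (.send p q a) c := by
        cases hv with
        | pair _ _ _ _ _ _ _ _ _ h => exact absurd (h ▸ hb) hc
        | internal _ _ _ h =>
          rw [show c.chan = b.chan from h.2.2] at hc
          exact absurd hb hc
        | send _ p' q' a h =>
          by_cases hpq : (p, q) = (p', q')
          · obtain ⟨rfl, rfl⟩ := Prod.ext_iff.1 hpq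
            exact ⟨a, rfl, h⟩
          · rw [h.2.2.2 p q hpq] at hc
            exact absurd hb hc
      obtain ⟨a, rfl, hs⟩ := hsend
      have ham : a = m := by
        obtain ⟨y, hy⟩ := hR.chan_prefix p q
        rw [hs.2.2.1, hb, hr.2.2.1] at hy
        exact (List.cons.inj hy).1
      subst ham
      -- A sender in `Y` has a causal chain to `q` through `R`, which is a violation. Any other
      -- sender does not take part in `R`, so the send moves past `R` and forms one exchange with
      -- the receive.
      by_cases hp : p ∈ Y
      · exact absurd ⟨b, c, d, p, q, a, L, R, hL, hb, hs, hR, hchain p hp, d'.state q, hr.1⟩ hS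
      · have hdis : Disjoint (actors [Act.send p q a]) Y := by simpa using hp
        obtain ⟨b', hR', hv'⟩ := hv.swap_run hR fun w hw => hdis.mono_right (hY w hw)
        have hpq := ne_of_step_recv hr
        have hag : Agree b' b p := hR'.agree fun w hw h => hp (hY w hw h)
        have hstep : Step S b' (.send p q a) d := by
          cases hv' with
          | send _ _ _ _ h => exact h
        refine ⟨L ++ (R ++ [[.send p q a, .recv p q a]]), ?_, fun r => ?_⟩
        · refine srun_append.2 ⟨b, hL, srun_append.2 ⟨b', hR', srun_singleton.2 ?_⟩⟩
          refine .pair _ _ _ _ _ hpq (by rw [hag.2, hb]) ?_ ?_ (fun r h₁ h₂ => ?_) ?_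
          · rw [hr.2.1 p hpq]
            exact hstep.1
          · rw [← hstep.2.1 q hpq.symm]
            exact hr.1
          · rw [hr.2.1 r h₂, hstep.2.1 r h₁]
          · funext r t
            by_cases h : (r, t) = (p, q)
            · obtain ⟨rfl, rfl⟩ := Prod.ext_iff.1 h
              have h₁ := hr.2.2.1
              have h₂ := hstep.2.2.1
              simp only [hag.2, hb] at h₁ h₂ ⊢
              rw [h₁] at h₂
              simpa using h₂
            · rw [hr.2.2.2 r t h, hstep.2.2.2 r t h]
        · have := hcomm hdis R.flatten hRY r
          simp only [List.flatten_append, List.flatten_cons, List.flatten_nil, proj_append,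
            List.append_nil, List.append_assoc] at this ⊢
          rw [← List.append_assoc (proj r [_]), this, List.append_assoc]
          congr 2
          exact proj_append r [_] [_]
    -- An independent `v` is moved behind the receive. A dependent `v` is added to `R`; through a
    -- participant shared with `Y`, all participants of `v` then have a chain to `q`.
    · by_cases hdis : Disjoint (actors v) Y
      · obtain ⟨b', hR', hv'⟩ := hv.swap_run hR fun w hw => hdis.mono_right (hY w hw)
        have hb' : b'.chan p q ≠ [] := fun h => hb (List.prefix_nil.1 (h ▸ hR'.chan_prefix p q))
        obtain ⟨b'', hr', hv''⟩ := hv'.swap_recv hr (hdis.notMem_of_mem_right hq) hb'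
        obtain ⟨J, hJ, hproj⟩ := ih hL hR' hr' hb hq hY hchain
        refine ⟨J ++ [v], srun_append.2 ⟨_, hJ, srun_singleton.2 hv''⟩, fun r => ?_⟩
        have := hcomm hdis (R.flatten ++ [.recv p q m]) (fun a ha => by
          rcases List.mem_append.1 ha with ha | ha
          · exact hRY a ha
          · obtain rfl := List.mem_singleton.1 ha
            exact hq) r
        simp only [List.flatten_append, List.flatten_cons, List.flatten_nil, proj_append,
          List.append_nil, List.append_assoc] at this hproj ⊢
        rw [this, hproj]
        simp only [List.append_assoc]
      · obtain ⟨x, hxv, hxY⟩ := Set.not_disjoint_iff.1 hdis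
        obtain ⟨J, hJ, hproj⟩ := ih (R := v :: R) (Y := Y ∪ actors v) hL ⟨c, hv, hR⟩ hr hb
          (Or.inl hq) (by
            rintro w hw
            rcases List.mem_cons.1 hw with rfl | hw
            · exact Set.subset_union_right
            · exact (hY w hw).trans Set.subset_union_left) (by
            rintro y (hy | hy)
            · exact ⟨y, Or.inl rfl, hchain y hy⟩
            · exact ⟨x, Or.inr ⟨hy, hxv⟩, hchain x hxY⟩)
        refine ⟨J, hJ, fun r => ?_⟩
        rw [hproj]
        simp

/-- If there is no violation, every execution has the same projections as a synchronous run. -/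
theorem exists_srun (hS : ¬ HasViolation S) {e : List (Act P A)} {c : Config S}
    (h : Run S (initConfig S) e c) :
    ∃ J, SRun S (initConfig S) J c ∧ ∀ r, proj r J.flatten = proj r e := by
  induction e using List.reverseRecOn generalizing c with
  | nil => exact ⟨[], h, fun r => rfl⟩
  | append_singleton e a ih =>
    rw [run_append] at h
    obtain ⟨d, h, ha⟩ := h
    rw [run_singleton] at ha
    obtain ⟨J, hJ, hproj⟩ := ih h
    cases a with
    | send p q m =>
      refine ⟨J ++ [[.send p q m]], srun_append.2 ⟨d, hJ, srun_singleton.2 (.send _ _ _ _ _ ha)⟩,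
        fun r => ?_⟩
      simp [hproj]
    | internal p i =>
      refine ⟨J ++ [[.internal p i]], srun_append.2 ⟨d, hJ, srun_singleton.2 (.internal _ _ _ _ ha)⟩,
        fun r => ?_⟩
      simp [hproj]
    | recv p q m =>
      obtain ⟨J', hJ', hproj'⟩ := exists_srun_recv (R := []) (Y := {q}) hS J hJ rfl ha
        (by rw [ha.2.2.1]; simp) rfl (by simp) (by rintro y rfl; rfl)
      refine ⟨J', hJ', fun r => ?_⟩
      rw [hproj', proj_append, hproj]
      simp

/-- In a synchronous run every receive comes immediately after the corresponding send. -/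
theorem exists_send_before_recv {L : List (List (Act P A))} {c : Config S}
    (h : SRun S (initConfig S) L c) {e e' : List (Act P A)} {p q : P} {m : A}
    (he : L.flatten = e ++ .recv p q m :: e') :
    ∃ u, e = u ++ [.send p q m] ∧ u.countP (Act.sendsOn p q) = u.countP (Act.recvsOn p q) := by
  induction L using List.reverseRecOn generalizing c e' with
  | nil => simp at he
  | append_singleton L v ih =>
    rw [srun_append] at h
    obtain ⟨d, hL, hv⟩ := h
    rw [srun_singleton] at hv
    rw [List.flatten_append, List.append_eq_append_iff] at he
    rcases he with ⟨a, rfl, ha⟩ | ⟨a, ha, hav⟩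
    · simp only [List.flatten_cons, List.flatten_nil, List.append_nil] at ha
      cases hv with
      | send _ p' q' m' h =>
        rcases a with _ | ⟨x, a⟩ <;> simp at ha
      | internal _ p' i h =>
        rcases a with _ | ⟨x, a⟩ <;> simp at ha
      | pair _ p' q' m' _ hce _ _ _ _ =>
        rcases a with _ | ⟨x, _ | ⟨y, a⟩⟩
        · simp at ha
        · obtain ⟨rfl, ⟨rfl, rfl, rfl⟩, -⟩ : Act.send p' q' m' = x ∧
              (p' = p ∧ q' = q ∧ m' = m) ∧ e' = [] := by simpa using ha
          refine ⟨L.flatten, rfl, ?_⟩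
          have := countP_eq_of_run_init hL.run p' q'
          rw [hce] at this
          simpa using this
        · simp at ha
    · rcases a with _ | ⟨x, a⟩
      · simp only [List.append_nil] at ha
        subst ha
        simp only [List.flatten_cons, List.flatten_nil, List.append_nil, List.nil_append] at hav
        cases hv with
        | send _ p' q' m' h => simp at hav
        | internal _ p' i h => simp at hav
        | pair _ p' q' m' _ hce _ _ _ _ => simp at hav
      · simp only [List.cons_append, List.cons.injEq] at hav
        rw [hav.1.symm] at ha
        exact ih hL ha

/-- The send directly before a receive has the same index on the channel as the matching send, and
the index determines its position. -/
theorem isRSCExec_of_srun {L : List (List (Act P A))} {c : Config S}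
    (h : SRun S (initConfig S) L c) (V : Set (Set (Fin L.flatten.length))) :
    IsRSCExec L.flatten V := by
  rintro j j' ⟨hlt, p, q, a, hj, hj', hc⟩ -
  have hsplit : L.flatten = L.flatten.take j' ++ .recv p q a :: L.flatten.drop (j' + 1) := by
    rw [← hj']
    simp
  obtain ⟨u, hu, hcu⟩ := exists_send_before_recv h hsplit
  have hlen : (j' : ℕ) = u.length + 1 := by
    have := congrArg List.length hu
    rw [List.length_take, min_eq_left j'.2.le] at this
    simpa using this
  have hul : u = L.flatten.take u.length := by
    have := congrArg (List.take u.length) hu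
    rw [List.take_take, min_eq_left (by omega)] at this
    simpa using this.symm
  have hget : L.flatten.get ⟨u.length, by omega⟩ = .send p q a := by
    have h₁ : (L.flatten.take j')[u.length]? = some (.send p q a) := by rw [hu]; simp
    rw [List.getElem?_take_of_lt (by omega)] at h₁
    exact (List.getElem?_eq_some_iff.1 h₁).2
  have hcount : (L.flatten.take j').countP (Act.recvsOn p q) = u.countP (Act.recvsOn p q) := by
    rw [hu]
    simp [Act.recvsOn]
  have := countP_take_inj (Act.sendsOn p q) L.flatten (i := j) (j := ⟨u.length, by omega⟩)
    (by rw [hj]; simp [Act.sendsOn]) (by rw [hget]; simp [Act.sendsOn])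
    (by rw [hc, hcount, ← hcu]; simp only [← hul])
  rw [this]
  exact hlen

/-- The synchronous run given by `exists_srun` has the same projections as the execution, hence an
isomorphic conflict graph, and its matching pairs are consecutive. -/
theorem isRSC_of_not_hasViolation (hS : ¬ HasViolation S) : S.IsRSC := by
  rintro e ⟨c, he⟩ V hV
  obtain ⟨J, hJ, hproj⟩ := exists_srun hS he
  obtain ⟨V', hV', hce⟩ := exists_causallyEquivalent (isFIFOWord_of_run he)
    (isFIFOWord_of_run hJ.run) (fun p => (hproj p).symm) hV
  exact ⟨_, V', hV', isRSCExec_of_srun hJ V', hce⟩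

end

end FIFOSystem

end CrashStop

namespace CrashStop

open Relation

-- Violations are cycles of the conflict graph

section Acyclicity

variable {P A : Type} [DecidableEq P]

/-- As matching pairs are consecutive, each vertex is an interval of one or two positions. Its first
position will serve as a rank. -/
theorem IsInteraction.exists_first {e : List (Act P A)} {V : Set (Set (Fin e.length))}
    (hV : IsValidComm e V) (hrsc : IsRSCExec e V) {v : Set (Fin e.length)} (hv : v ∈ V) :
    ∃ i ∈ v, ∀ j ∈ v, (j : ℕ) = i ∨ (j : ℕ) = i + 1 := by
  rcases hV.1 v hv with ⟨j, j', hm, rfl⟩ | ⟨j, rfl, -⟩ | ⟨j, rfl, -⟩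
  · refine ⟨j, by simp, fun i hi => ?_⟩
    have := hrsc j j' hm hv
    rcases hi with rfl | rfl
    · exact Or.inl rfl
    · exact Or.inr this
  · exact ⟨j, rfl, fun i hi => Or.inl (by rw [show i = j from hi])⟩
  · exact ⟨j, rfl, fun i hi => Or.inl (by rw [show i = j from hi])⟩

/-- The conflict graph of an RSC execution has only trivial cycles. -/
theorem IsRSCExec.acyclic {e : List (Act P A)} {V : Set (Set (Fin e.length))}
    (hV : IsValidComm e V) (hrsc : IsRSCExec e V) {v w : V}
    (h : ReflTransGen (fun v w : V => Conflict e v.1 w.1) v w) (h' : Conflict e w.1 v.1) :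
    v = w := by
  choose first hfirst hle using fun v : V => IsInteraction.exists_first hV hrsc v.2
  -- Different vertices have different first positions and at most one further position each, so an
  -- edge between them must increase the first position.
  have key (v w : V) (hvw : Conflict e v.1 w.1) : v = w ∨ first v < first w := by
    by_contra! hne
    obtain ⟨j, hj, j', hj', hlt, -⟩ := hvw
    have h₁ := hle v j hj
    have h₂ := hle w j' hj'
    have h₃ : first v ≠ first w := fun h => hne.1 <| Subtype.ext <|
      (hV.2 (first v)).unique ⟨v.2, hfirst v⟩ ⟨w.2, h ▸ hfirst w⟩
    have h₄ : j ≠ j' := hlt.ne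
    have h₅ : (first v : ℕ) ≠ first w := fun h => h₃ (Fin.ext h)
    have h₆ : (first w : ℕ) ≤ first v := hne.2
    have h₇ : (j : ℕ) < j' := hlt
    omega
  have path {w : V} (h : ReflTransGen (fun v w : V => Conflict e v.1 w.1) v w) :
      v = w ∨ first v < first w := by
    induction h with
    | refl => exact Or.inl rfl
    | tail _ h ih =>
      rcases key _ _ h with rfl | h
      · exact ih
      · rcases ih with rfl | ih
        · exact Or.inr h
        · exact Or.inr (ih.trans h)
  rcases path h with h | h
  · exact h
  · rcases key w v h' with h' | h'
    · exact h'.symm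
    · exact absurd h h'.asymm

/-- Two positions are linked if the first one precedes the second one at the same participant, or
if they form a matching pair. -/
def Link (e : List (Act P A)) (i j : Fin e.length) : Prop :=
  (i < j ∧ (e.get i).actor = (e.get j).actor) ∨ IsMatchingPair e i j ∨ IsMatchingPair e j i

end Acyclicity

namespace FIFOSystem

variable {P A : Type} [DecidableEq P] {S : FIFOSystem P A}

/-- The interactions of an execution form a valid communication. -/
theorem isValidComm_of_run {e : List (Act P A)} {c : Config S} (h : Run S (initConfig S) e c) :
    IsValidComm e {v | IsInteraction e v} := by
  have hF := isFIFOWord_of_run h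
  have hright {j i i' : Fin e.length} (h₁ : IsMatchingPair e i j) (h₂ : IsMatchingPair e i' j) :
      i = i' := by
    obtain ⟨-, p, q, a, hi, hj, hc⟩ := h₁
    obtain ⟨-, p', q', a', hi', hj', hc'⟩ := h₂
    obtain ⟨rfl, rfl, rfl⟩ : p = p' ∧ q = q' ∧ a = a' := by simpa using hj.symm.trans hj'
    exact countP_take_inj _ _ (by rw [hi]; simp [Act.sendsOn]) (by rw [hi']; simp [Act.sendsOn])
      (hc.trans hc'.symm)
  have hleft {j i i' : Fin e.length} (h₁ : IsMatchingPair e j i) (h₂ : IsMatchingPair e j i') :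
      i = i' := by
    obtain ⟨-, p, q, a, hj, hi, hc⟩ := h₁
    obtain ⟨-, p', q', a', hj', hi', hc'⟩ := h₂
    obtain ⟨rfl, rfl, rfl⟩ : p = p' ∧ q = q' ∧ a = a' := by simpa using hj.symm.trans hj'
    exact countP_take_inj _ _ (by rw [hi]; simp [Act.recvsOn]) (by rw [hi']; simp [Act.recvsOn])
      (hc.symm.trans hc')
  have hsend {i j : Fin e.length} (h : IsMatchingPair e i j) : (e.get i).IsSend := by
    obtain ⟨-, p, q, a, hi, -, -⟩ := h
    rw [hi]; trivial
  have hrecv {i j : Fin e.length} (h : IsMatchingPair e i j) : (e.get j).IsRecv := by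
    obtain ⟨-, p, q, a, -, hj, -⟩ := h
    rw [hj]; trivial
  refine ⟨fun v hv => hv, fun j => ?_⟩
  cases hj : e.get j with
  | internal p i =>
    refine ⟨{j}, ⟨Or.inr (Or.inr ⟨j, rfl, by rw [hj]; trivial⟩), rfl⟩, ?_⟩
    rintro v ⟨⟨k, k', hm, rfl⟩ | ⟨k, rfl, -⟩ | ⟨k, rfl, -⟩, hjv⟩
    · rcases hjv with rfl | rfl
      · have := hsend hm; rw [hj] at this; exact this.elim
      · have := hrecv hm; rw [hj] at this; exact this.elim
    · rw [show j = k from hjv]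
    · rw [show j = k from hjv]
  | send p q a =>
    by_cases hm : ∃ j', IsMatchingPair e j j'
    · obtain ⟨j', hm⟩ := hm
      refine ⟨{j, j'}, ⟨Or.inl ⟨j, j', hm, rfl⟩, by simp⟩, ?_⟩
      rintro v ⟨⟨k, k', hm', rfl⟩ | ⟨k, rfl, -, hn⟩ | ⟨k, rfl, hi⟩, hjv⟩
      · rcases hjv with rfl | rfl
        · rw [hleft hm hm']
        · have := hrecv hm'; rw [hj] at this; exact this.elim
      · obtain rfl : j = k := hjv
        exact absurd hm (hn j')
      · obtain rfl : j = k := hjv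
        rw [hj] at hi; exact hi.elim
    · push Not at hm
      refine ⟨{j}, ⟨Or.inr (Or.inl ⟨j, rfl, by rw [hj]; trivial, hm⟩), rfl⟩, ?_⟩
      rintro v ⟨⟨k, k', hm', rfl⟩ | ⟨k, rfl, -⟩ | ⟨k, rfl, -⟩, hjv⟩
      · rcases hjv with rfl | rfl
        · exact absurd hm' (hm k')
        · have := hrecv hm'; rw [hj] at this; exact this.elim
      · rw [show j = k from hjv]
      · rw [show j = k from hjv]
  | recv p q a =>
    obtain ⟨i, hm⟩ := exists_isMatchingPair_of_recv h hj
    refine ⟨{i, j}, ⟨Or.inl ⟨i, j, hm, rfl⟩, by simp⟩, ?_⟩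
    rintro v ⟨⟨k, k', hm', rfl⟩ | ⟨k, rfl, hs, -⟩ | ⟨k, rfl, hi⟩, hjv⟩
    · rcases hjv with rfl | rfl
      · have := hsend hm'; rw [hj] at this; exact this.elim
      · rw [hright hm hm']
    · obtain rfl : j = k := hjv
      rw [hj] at hs; exact hs.elim
    · obtain rfl : j = k := hjv
      rw [hj] at hi; exact hi.elim

/-- A causal chain through a part of a word yields a chain of linked positions. -/
theorem exists_link_chain {e : List (Act P A)} {s : Fin e.length} {L : List (List (Act P A))}
    {u w : List (Act P A)} {c d : Config S} {x y : P} (he : e = u ++ (L.flatten ++ w))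
    (hu : Run S (initConfig S) u c) (hL : SRun S c L d) (hxy : Chain L x y)
    (hx : ∃ i : Fin e.length, (i : ℕ) < u.length ∧ (e.get i).actor = x ∧
      ReflTransGen (Link e) s i) :
    ∃ i : Fin e.length, (i : ℕ) < u.length + L.flatten.length ∧ (e.get i).actor = y ∧
      ReflTransGen (Link e) s i := by
  induction L generalizing u c x with
  | nil =>
    obtain rfl : x = y := hxy
    simpa using hx
  | cons v L ih =>
    obtain ⟨m, hv, hL⟩ := hL
    obtain ⟨z, hz, hzy⟩ := hxy
    have he' : e = (u ++ v) ++ (L.flatten ++ w) := by simpa using he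
    have hget (n : ℕ) (hn : n < v.length) : ∃ k : Fin e.length, (k : ℕ) = u.length + n ∧
        e.get k = v[n] := by
      refine ⟨⟨u.length + n, by rw [he']; simp; omega⟩, rfl, ?_⟩
      simp [he', hn]
    obtain ⟨i, hi, hix, hsi⟩ := hx
    have hmove (n : ℕ) (hn : n < v.length) (hnx : v[n].actor = x) :
        ∃ k : Fin e.length, (k : ℕ) = u.length + n ∧ ReflTransGen (Link e) s k := by
      obtain ⟨k, hk, hek⟩ := hget n hn
      refine ⟨k, hk, hsi.tail (Or.inl ⟨?_, by rw [hek, hix, hnx]⟩)⟩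
      exact Fin.lt_def.2 (by omega)
    suffices h : ∃ i : Fin e.length, (i : ℕ) < (u ++ v).length ∧ (e.get i).actor = z ∧
        ReflTransGen (Link e) s i by
      obtain ⟨k, hk, h⟩ := ih he' (run_append.2 ⟨c, hu, hv.run⟩) hL hzy h
      exact ⟨k, by simp at hk ⊢; omega, h⟩
    rcases hz with rfl | ⟨hxv, hzv⟩
    · exact ⟨i, by simp; omega, hix, hsi⟩
    · obtain ⟨a, ha, hax⟩ := hxv
      obtain ⟨b, hb, hbz⟩ := hzv
      obtain ⟨n, hn, rfl⟩ := List.getElem_of_mem ha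
      obtain ⟨n', hn', rfl⟩ := List.getElem_of_mem hb
      obtain ⟨k, hk, hsk⟩ := hmove n hn hax
      obtain ⟨k', hk', hek'⟩ := hget n' hn'
      refine ⟨k', by simp; omega, by rw [hek', hbz], ?_⟩
      by_cases hnn : n = n'
      · obtain rfl : k = k' := Fin.ext (by omega)
        exact hsk
      -- Only an exchange lets the chain change its participant. Its two positions match because the
      -- channel was empty before.
      · cases hv with
        | send _ p' q' a h => simp at hn hn'; omega
        | internal _ p' a h => simp at hn hn'; omega
        | pair _ p' q' a _ hce _ _ _ _ =>
          have hcount := countP_eq_of_run_init hu p' q'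
          rw [hce, List.length_nil, Nat.add_zero] at hcount
          obtain ⟨k₀, hk₀, he₀⟩ := hget 0 (by simp)
          obtain ⟨k₁, hk₁, he₁⟩ := hget 1 (by simp)
          have hmatch : IsMatchingPair e k₀ k₁ := by
            refine ⟨Fin.lt_def.2 (by omega), p', q', a, by rw [he₀]; rfl, by rw [he₁]; rfl, ?_⟩
            rw [hk₀, hk₁, he']
            simp [List.take_append, List.take_of_length_le, Act.recvsOn, hcount]
          simp only [List.length_cons, List.length_nil] at hn hn'
          obtain ⟨rfl, rfl⟩ | ⟨rfl, rfl⟩ : n = 0 ∧ n' = 1 ∨ n = 1 ∧ n' = 0 := by omega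
          · obtain rfl : k = k₀ := Fin.ext (by omega)
            obtain rfl : k' = k₁ := Fin.ext (by omega)
            exact hsk.tail (Or.inr (Or.inl hmatch))
          · obtain rfl : k = k₁ := Fin.ext (by omega)
            obtain rfl : k' = k₀ := Fin.ext (by omega)
            exact hsk.tail (Or.inr (Or.inr hmatch))

/-- A non-empty channel stays non-empty along a synchronous run, while an exchange on it would need
it to be empty. -/
theorem SRun.countP_recvsOn {c d : Config S} {L : List (List (Act P A))} (h : SRun S c L d)
    {p q : P} (hc : c.chan p q ≠ []) : L.flatten.countP (Act.recvsOn p q) = 0 := by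
  induction L generalizing c with
  | nil => rfl
  | cons v L ih =>
    obtain ⟨m, hv, h⟩ := h
    have hm : m.chan p q ≠ [] := fun hm => hc (List.prefix_nil.1 (hm ▸ hv.chan_prefix p q))
    rw [List.flatten_cons, List.countP_append, ih h hm]
    cases hv with
    | send => simp [Act.recvsOn]
    | internal => simp [Act.recvsOn]
    | pair _ p' q' a _ hce _ _ _ _ =>
      have : ¬ (p' = p ∧ q' = q) := by
        rintro ⟨rfl, rfl⟩
        exact hc hce
      simpa [Act.recvsOn] using this

/-- The chain leads from the send to an action of `q` that precedes the receive. Send and receive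
form one vertex, so this is a cycle of the conflict graph. It is not trivial, since that action is
neither of the two. Causal equivalence would carry it over to an RSC execution, where only trivial
cycles exist. -/
theorem not_isRSC_of_hasViolation (hS : HasViolation S) : ¬ S.IsRSC := by
  obtain ⟨d, c, c', p, q, m, L, R, hL, hd, hs, hR, hchain, s', hr⟩ := hS
  intro hrsc
  have hpq := ne_of_step_send hs
  have hcne : c.chan p q ≠ [] := by rw [hs.2.2.1]; simp
  -- Nothing leaves the non-empty channel during `R`, so `m` is still its first message and can be
  -- received.
  obtain ⟨y, hy⟩ := hR.chan_prefix p q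
  rw [hs.2.2.1, hd] at hy
  let f : Config S :=
    { state := fun r => if h : r = q then h ▸ s' else c'.state r
      chan := fun r t => if r = p ∧ t = q then y else c'.chan r t }
  have hf : Step S c' (.recv p q m) f := by
    have hq : f.state q = s' := by simp [f]
    refine ⟨by simp only [Act.actor]; rw [hq]; exact hr, fun r (h : r ≠ q) => by simp [f, h],
      by simp [f, ← hy], fun r t hrt => ?_⟩
    simp only [f]
    rw [if_neg fun h => hrt (Prod.ext_iff.2 h)]
  obtain ⟨e, he⟩ : ∃ e, e = (L.flatten ++ [.send p q m]) ++ (R.flatten ++ [.recv p q m]) :=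
    ⟨_, rfl⟩
  have hrun₁ : Run S (initConfig S) (L.flatten ++ [.send p q m]) c :=
    run_append.2 ⟨d, hL.run, run_singleton.2 hs⟩
  have hrun : Run S (initConfig S) e f :=
    he ▸ run_append.2 ⟨c, hrun₁, run_append.2 ⟨c', hR.run, run_singleton.2 hf⟩⟩
  have hV := isValidComm_of_run hrun
  obtain ⟨e', V', hV', hrsc', ⟨φ, -, hφ⟩⟩ := hrsc e ⟨f, hrun⟩ _ hV
  have hlen : e.length = L.flatten.length + 1 + (R.flatten.length + 1) := by simp [he]; omega
  let i : Fin e.length := ⟨L.flatten.length, by omega⟩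
  let k : Fin e.length := ⟨L.flatten.length + 1 + R.flatten.length, by omega⟩
  have hi : e.get i = .send p q m := by simp [i, he]
  have hk : e.get k = .recv p q m := by
    simp only [k, he, List.get_eq_getElem]
    rw [List.getElem_append_right (by simp), List.getElem_append_right (by simp)]
    simp
  have hm : IsMatchingPair e i k := by
    refine ⟨Fin.lt_def.2 (by simp only [i, k]; omega), p, q, m, hi, hk, ?_⟩
    have h₁ : e.take i = L.flatten := by simp [i, he]
    have h₂ : e.take k = L.flatten ++ [.send p q m] ++ R.flatten := by
      have h (l : List (Act P A)) (hl : l = L.flatten ++ [.send p q m] ++ R.flatten ++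
          [.recv p q m]) : l.take (L.flatten.length + 1 + R.flatten.length) =
          L.flatten ++ [.send p q m] ++ R.flatten := by
        rw [hl]
        exact List.take_left' (by simp; omega)
      exact h e (by rw [he]; simp)
    have h₃ := countP_eq_of_run_init hL.run p q
    rw [h₁, h₂, List.countP_append, List.countP_append, hR.countP_recvsOn hcne, h₃, hd]
    simp [Act.recvsOn]
  obtain ⟨j, hjlt, hjq, hij⟩ := exists_link_chain (s := i) he hrun₁ hR hchain
    ⟨i, by simp [i], by rw [hi]; rfl, .refl⟩
  choose vert hvert using fun j => (hV.2 j).exists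
  let vert' (j : Fin e.length) : {v // v ∈ {v | IsInteraction e v}} := ⟨vert j, (hvert j).1⟩
  have hpair {a b : Fin e.length} (h : IsMatchingPair e a b) : vert a = {a, b} ∧ vert b = {a, b} :=
    ⟨(hV.2 a).unique (hvert a) ⟨Or.inl ⟨a, b, h, rfl⟩, by simp⟩,
      (hV.2 b).unique (hvert b) ⟨Or.inl ⟨a, b, h, rfl⟩, by simp⟩⟩
  have hlink {a b : Fin e.length} (h : Link e a b) :
      ReflTransGen (fun v w : V' => Conflict e' v.1 w.1) (φ (vert' a)) (φ (vert' b)) := by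
    rcases h with ⟨hlt, ha⟩ | h | h
    · exact .single ((hφ _ _).2 ⟨a, (hvert a).2, b, (hvert b).2, hlt, fun hc => hc.1 ha⟩)
    · have := hpair h
      rw [show vert' a = vert' b from Subtype.ext (this.1.trans this.2.symm)]
    · have := hpair h
      rw [show vert' a = vert' b from Subtype.ext (this.2.trans this.1.symm)]
  have hpath : ReflTransGen (fun v w : V' => Conflict e' v.1 w.1) (φ (vert' i)) (φ (vert' j)) :=
    hij.lift' (fun a => φ (vert' a)) fun a b h => hlink h
  -- The edge that closes the cycle: `j` and the receive are both actions of `q`, and `j` is the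
  -- earlier one.
  have hback : Conflict e' (φ (vert' j)).1 (φ (vert' i)).1 := by
    refine (hφ _ _).2 ⟨j, (hvert j).2, k, ?_, ?_, fun hc => hc.1 ?_⟩
    · simp only [vert', (hpair hm).1]
      simp
    · refine Fin.lt_def.2 ?_
      simp only [k]
      simp only [List.length_append, List.length_singleton] at hjlt
      exact hjlt
    · rw [hjq, hk]
      rfl
  have heq := φ.injective (hrsc'.acyclic hV' hpath hback)
  have hj : j ∈ vert i := by
    rw [show vert i = vert j from congrArg Subtype.val heq]
    exact (hvert j).2
  rw [(hpair hm).1] at hj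
  rcases hj with rfl | rfl
  · rw [hi] at hjq
    exact hpq hjq
  · simp only [k, List.length_append, List.length_singleton] at hjlt
    omega

/-- This turns a condition on all executions into a reachability question about synchronous runs,
for which channels matter only through their emptiness. -/
theorem isRSC_iff : S.IsRSC ↔ ¬ HasViolation S :=
  ⟨fun h h' => not_isRSC_of_hasViolation h' h, isRSC_of_not_hasViolation⟩

end FIFOSystem

end CrashStop

namespace CrashStop

open Relation

/-! ### Memories given by functions -/

def cells (f : Key → Val) (K : List Key) : Mem :=
  K.map fun k => (k, f k)

theorem cells_has_iff {f : Key → Val} {K : List Key} {g : Mem} :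
    (cells f K).has g = true ↔ ∀ c ∈ g, c.1 ∈ K ∧ f c.1 = c.2 := by
  simp only [Mem.has, cells, List.all_eq_true, decide_eq_true_eq, List.mem_map]
  refine forall₂_congr fun c _ => ⟨?_, fun h => ⟨c.1, h.1, by rw [h.2]⟩⟩
  rintro ⟨k, hk, rfl⟩
  exact ⟨hk, rfl⟩

theorem cells_set (f : Key → Val) (K : List Key) (k : Key) (v : Val) :
    (cells f K).set k v = cells (Function.update f k v) K := by
  simp only [Mem.set, cells, List.map_map]
  refine List.map_congr_left fun k' _ => ?_
  by_cases h : k' = k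
  · subst h; simp
  · simp [h]

/-- With a fixed list of keys, rules act by `Function.update` on the function that gives the
contents. -/
theorem apply_cells (f : Key → Val) (K : List Key) (r : Rule) :
    r.apply (cells f K) = cells (r.foldl (fun f c => Function.update f c.1 c.2.2) f) K := by
  induction r generalizing f with
  | nil => rfl
  | cons c r ih =>
    have := ih (Function.update f c.1 c.2.2)
    simp only [Rule.apply, List.foldl_cons] at this ⊢
    rw [cells_set, this]

/-- The cells for the states of the participants, the channels, and two further cells. -/
def layout (s : ℕ → Val) (c : ℕ → ℕ → Val) (w t : Val) : Key → Val
  | [0, i] => s i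
  | [1, i, j] => c i j
  | [2] => w
  | [3] => t
  | _ => []

section Layout

variable (s : ℕ → Val) (c : ℕ → ℕ → Val) (w t v : Val)

theorem update_layout_state (i : ℕ) :
    Function.update (layout s c w t) [0, i] v = layout (Function.update s i v) c w t := by
  funext k
  by_cases h : k = [0, i]
  · subst h; simp [layout]
  · rw [Function.update_of_ne h]
    unfold layout
    split <;> simp_all

theorem update_layout_chan (i j : ℕ) :
    Function.update (layout s c w t) [1, i, j] v =
      layout s (Function.update c i (Function.update (c i) j v)) w t := by
  funext k
  by_cases h : k = [1, i, j]
  · subst h; simp [layout]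
  · rw [Function.update_of_ne h]
    unfold layout
    split
    case h_2 a b =>
      by_cases hi : a = i
      · subst hi
        have : b ≠ j := fun hb => h (by rw [hb])
        simp [this]
      · simp [hi]
    all_goals simp_all

theorem update_layout_watch :
    Function.update (layout s c w t) [2] v = layout s c v t := by
  funext k
  by_cases h : k = [2]
  · subst h; simp [layout]
  · rw [Function.update_of_ne h]
    unfold layout
    split <;> simp_all

theorem update_layout_token :
    Function.update (layout s c w t) [3] v = layout s c w v := by
  funext k
  by_cases h : k = [3]
  · subst h; simp [layout]
  · rw [Function.update_of_ne h]
    unfold layout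
    split <;> simp_all

end Layout

/-- The last two cells serve only the RSC reduction: `[2]` holds the message under observation with
its channel, `[3]` the participant reached by the causal chain. -/
def keys (n : ℕ) : List Key :=
  ((List.range n).map fun i => [0, i]) ++
    (((List.range n).flatMap fun i => (List.range n).map fun j => [1, i, j]) ++ [[2], [3]])

theorem mem_keys_state {n i : ℕ} : [0, i] ∈ keys n ↔ i < n := by
  simp [keys]

theorem mem_keys_chan {n i j : ℕ} : [1, i, j] ∈ keys n ↔ i < n ∧ j < n := by
  simp [keys]

theorem mem_keys_watch {n : ℕ} : [2] ∈ keys n := by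
  simp [keys]

theorem mem_keys_token {n : ℕ} : [3] ∈ keys n := by
  simp [keys]

/-! ### Tables of FIFO systems -/

/-- A transition: participant, state, kind of action (`0` for sends, `1` for receives), peer,
message, next state. -/
abbrev Entry := ℕ × List ℕ × (ℕ × ℕ × List ℕ) × List ℕ

/-- The number of participants, the transitions, and the initial states. -/
abbrev Table := ℕ × List Entry × List (List ℕ)

def initMem (T : Table) : Mem :=
  ((List.range T.1).map fun i => ([0, i], [T.2.2.getD i []])) ++
    (((List.range T.1).flatMap fun i => (List.range T.1).map fun j => ([1, i, j], [])) ++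
      [([2], []), ([3], [])])

theorem initMem_eq (T : Table) :
    initMem T = cells (layout (fun i => [T.2.2.getD i []]) (fun _ _ => []) [] []) (keys T.1) := by
  simp [initMem, cells, keys, List.map_flatMap, layout, Function.comp_def]

section Coding

variable {n : ℕ} {A : Type}

def actCode (msg : A → List ℕ) : Act (Fin n) A → ℕ × ℕ × List ℕ
  | .send _ q a => (0, q, msg a)
  | .recv p _ a => (1, p, msg a)
  | .internal _ _ => (2, 0, [])

/-- The table `T` describes the system `S`. -/
structure Coding (S : FIFOSystem (Fin n) A) (T : Table) where
  size_eq : T.1 = n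
  st : ∀ p, (S p).State → List ℕ
  msg : A → List ℕ
  msg_inj : Function.Injective msg
  init_eq : ∀ p : Fin n, T.2.2.getD p [] = st p (S p).init
  complete : ∀ p s a s', (s, a, s') ∈ (S p).trans → (p.val, st p s, actCode msg a, st p s') ∈ T.2.1
  sound : ∀ (p : Fin n) s x w, (p.val, st p s, x, w) ∈ T.2.1 →
    ∃ a s', x = actCode msg a ∧ w = st p s' ∧ (s, a, s') ∈ (S p).trans

namespace Coding

open FIFOSystem

variable {S : FIFOSystem (Fin n) A} {T : Table} (C : Coding S T)

include C

theorem sound_send {p : Fin n} {s : (S p).State} {j : ℕ} {m w : List ℕ}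
    (h : (p.val, C.st p s, (0, j, m), w) ∈ T.2.1) :
    ∃ (q : Fin n) (a : A) (s' : (S p).State), j = q ∧ m = C.msg a ∧ w = C.st p s' ∧
      (s, .send p q a, s') ∈ (S p).trans := by
  obtain ⟨a, s', hx, rfl, ht⟩ := C.sound _ _ _ _ h
  have := (S p).actor_eq _ _ _ ht
  cases a with
  | send p' q a =>
    obtain rfl : p' = p := this
    simp only [actCode, Prod.mk.injEq, true_and] at hx
    exact ⟨q, a, s', hx.1, hx.2, rfl, ht⟩
  | recv _ _ _ => simp [actCode] at hx
  | internal _ _ => simp [actCode] at hx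

theorem sound_recv {q : Fin n} {s : (S q).State} {j : ℕ} {m w : List ℕ}
    (h : (q.val, C.st q s, (1, j, m), w) ∈ T.2.1) :
    ∃ (p : Fin n) (a : A) (s' : (S q).State), j = p ∧ m = C.msg a ∧ w = C.st q s' ∧
      (s, .recv p q a, s') ∈ (S q).trans := by
  obtain ⟨a, s', hx, rfl, ht⟩ := C.sound _ _ _ _ h
  have := (S q).actor_eq _ _ _ ht
  cases a with
  | recv p q' a =>
    obtain rfl : q' = q := this
    simp only [actCode, Prod.mk.injEq, true_and] at hx
    exact ⟨p, a, s', hx.1, hx.2, rfl, ht⟩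
  | send _ _ _ => simp [actCode] at hx
  | internal _ _ => simp [actCode] at hx

theorem sound_internal {p : Fin n} {s : (S p).State} {x : ℕ × ℕ × List ℕ} {w : List ℕ}
    (h : (p.val, C.st p s, x, w) ∈ T.2.1) (h₀ : x.1 ≠ 0) (h₁ : x.1 ≠ 1) :
    ∃ (i : InternalName) (s' : (S p).State), w = C.st p s' ∧
      (s, .internal p i, s') ∈ (S p).trans := by
  obtain ⟨a, s', rfl, rfl, ht⟩ := C.sound _ _ _ _ h
  have := (S p).actor_eq _ _ _ ht
  cases a with
  | internal p' i =>
    obtain rfl : p' = p := this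
    exact ⟨i, s', rfl, ht⟩
  | send _ _ _ => simp [actCode] at h₀
  | recv _ _ _ => simp [actCode] at h₁

/-- The state cells. -/
def stateCells (c : Config S) (i : ℕ) : Val :=
  if h : i < n then [C.st ⟨i, h⟩ (c.state ⟨i, h⟩)] else []

omit C in
/-- The channel cells, where `g` tells what is recorded of the contents of a channel. -/
def chanCells (g : List A → Val) (c : Config S) (i j : ℕ) : Val :=
  if h : i < n ∧ j < n then g (c.chan ⟨i, h.1⟩ ⟨j, h.2⟩) else []

theorem stateCells_val (c : Config S) (p : Fin n) : C.stateCells c p = [C.st p (c.state p)] := by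
  simp [stateCells]

omit C in
theorem chanCells_val (g : List A → Val) (c : Config S) (p q : Fin n) :
    chanCells g c p q = g (c.chan p q) := by
  simp [chanCells]

theorem stateCells_eq_update {c c' : Config S} {p : Fin n}
    (h : ∀ r, r ≠ p → c'.state r = c.state r) :
    C.stateCells c' = Function.update (C.stateCells c) p [C.st p (c'.state p)] := by
  funext i
  by_cases hi : i = p
  · subst hi; simp [stateCells]
  · rw [Function.update_of_ne hi]
    unfold stateCells
    split
    · rw [h _ fun hp => hi (congrArg Fin.val hp)]
    · rfl

omit C in
theorem chanCells_eq_update {g : List A → Val} {c c' : Config S} {p q : Fin n}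
    (h : ∀ r s, (r, s) ≠ (p, q) → c'.chan r s = c.chan r s) :
    chanCells g c' = Function.update (chanCells g c) p
      (Function.update (chanCells g c p) q (g (c'.chan p q))) := by
  funext i j
  by_cases hi : i = p
  · subst hi
    by_cases hj : j = q
    · subst hj; simp [chanCells]
    · rw [Function.update_self, Function.update_of_ne hj]
      unfold chanCells
      split
      · rw [h _ _ fun hp => hj (congrArg Fin.val (Prod.ext_iff.1 hp).2)]
      · rfl
  · rw [Function.update_of_ne hi]
    unfold chanCells
    split
    · rw [h _ _ fun hp => hi (congrArg Fin.val (Prod.ext_iff.1 hp).1)]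
    · rfl

/-- The cells of a configuration. -/
def configLayout (g : List A → Val) (c : Config S) (w t : Val) : Key → Val :=
  layout (C.stateCells c) (chanCells g c) w t

variable (g : List A → Val) {c c' : Config S} {p q : Fin n} {a : A} (w t : Val)

theorem configLayout_send (h : Step S c (.send p q a) c') :
    C.configLayout g c' w t = Function.update (Function.update (C.configLayout g c w t)
      [0, p] [C.st p (c'.state p)]) [1, p, q] (g (c'.chan p q)) := by
  rw [configLayout, configLayout, update_layout_state, update_layout_chan,
    C.stateCells_eq_update h.2.1, chanCells_eq_update h.2.2.2]
  rfl

theorem configLayout_recv (h : Step S c (.recv p q a) c') :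
    C.configLayout g c' w t = Function.update (Function.update (C.configLayout g c w t)
      [0, q] [C.st q (c'.state q)]) [1, p, q] (g (c'.chan p q)) := by
  rw [configLayout, configLayout, update_layout_state, update_layout_chan,
    C.stateCells_eq_update h.2.1, chanCells_eq_update h.2.2.2]
  rfl

theorem configLayout_internal {i : InternalName} (h : Step S c (.internal p i) c') :
    C.configLayout g c' w t =
      Function.update (C.configLayout g c w t) [0, p] [C.st p (c'.state p)] := by
  rw [configLayout, configLayout, update_layout_state, C.stateCells_eq_update h.2.1]
  have : c'.chan = c.chan := h.2.2
  unfold chanCells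
  rw [this]
  rfl

theorem initMem_eq_cells (hg : g [] = []) :
    initMem T = cells (C.configLayout g (initConfig S) [] []) (keys n) := by
  rw [initMem_eq, C.size_eq]
  refine List.map_congr_left fun k hk => ?_
  congr 1
  simp only [keys, List.mem_append, List.mem_map, List.mem_flatMap, List.mem_range,
    List.mem_cons, List.not_mem_nil, or_false] at hk
  rcases hk with ⟨i, hi, rfl⟩ | ⟨i, hi, j, hj, rfl⟩ | rfl | rfl
  · simp only [configLayout, layout]
    rw [C.init_eq ⟨i, hi⟩, C.stateCells_val _ ⟨i, hi⟩]
    rfl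
  · simp only [configLayout, layout]
    rw [chanCells_val g _ ⟨i, hi⟩ ⟨j, hj⟩]
    exact hg.symm
  · rfl
  · rfl

variable {g w t}

/-- Table entries contain bare numbers; membership of the key in `keys n` is what turns them back
into participants. -/
theorem has_state_iff {i : ℕ} {s : List ℕ} :
    ([0, i] ∈ keys n ∧ C.configLayout g c w t [0, i] = [s]) ↔
      ∃ p : Fin n, i = p ∧ s = C.st p (c.state p) := by
  rw [mem_keys_state]
  constructor
  · rintro ⟨hi, h⟩
    refine ⟨⟨i, hi⟩, rfl, ?_⟩
    rw [configLayout, layout, C.stateCells_val c ⟨i, hi⟩] at h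
    exact (List.cons.inj h).1.symm
  · rintro ⟨p, rfl, rfl⟩
    exact ⟨p.2, C.stateCells_val c p⟩

theorem has_chan_iff {i j : ℕ} {v : Val} :
    ([1, i, j] ∈ keys n ∧ C.configLayout g c w t [1, i, j] = v) ↔
      ∃ p q : Fin n, i = p ∧ j = q ∧ g (c.chan p q) = v := by
  rw [mem_keys_chan]
  constructor
  · rintro ⟨⟨hi, hj⟩, h⟩
    refine ⟨⟨i, hi⟩, ⟨j, hj⟩, rfl, rfl, ?_⟩
    rwa [configLayout, layout, chanCells_val g c ⟨i, hi⟩ ⟨j, hj⟩] at h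
  · rintro ⟨p, q, rfl, rfl, rfl⟩
    exact ⟨⟨p.2, q.2⟩, chanCells_val g c p q⟩

end Coding

end Coding

-- Existence of steps, and transfer of reachability

namespace FIFOSystem

variable {P A : Type} [DecidableEq P] {S : FIFOSystem P A} {c : Config S}

theorem exists_step_send {p q : P} {a : A} {s : (S p).State}
    (h : (c.state p, .send p q a, s) ∈ (S p).trans) :
    ∃ c', Step S c (.send p q a) c' ∧ c'.state p = s := by
  let d : Config S :=
    { state := Function.update c.state p s
      chan := fun r t => if r = p ∧ t = q then c.chan r t ++ [a] else c.chan r t }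
  have hd : d.state p = s := Function.update_self ..
  refine ⟨d, ⟨?_, fun r hr => Function.update_of_ne hr _ _, by simp [d], fun r t hrt => ?_⟩, hd⟩
  · simp only [Act.actor]
    rw [hd]
    exact h
  · simp only [d]
    rw [if_neg fun h => hrt (Prod.ext_iff.2 h)]

theorem exists_step_recv {p q : P} {a : A} {u : List A} {s : (S q).State}
    (h : (c.state q, .recv p q a, s) ∈ (S q).trans) (hu : c.chan p q = a :: u) :
    ∃ c', Step S c (.recv p q a) c' ∧ c'.state q = s := by
  let d : Config S :=
    { state := Function.update c.state q s
      chan := fun r t => if r = p ∧ t = q then u else c.chan r t }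
  have hd : d.state q = s := Function.update_self ..
  refine ⟨d, ⟨?_, fun r hr => Function.update_of_ne hr _ _, by simp [d, hu],
    fun r t hrt => ?_⟩, hd⟩
  · simp only [Act.actor]
    rw [hd]
    exact h
  · simp only [d]
    rw [if_neg fun h => hrt (Prod.ext_iff.2 h)]

theorem exists_step_internal {p : P} {i : InternalName} {s : (S p).State}
    (h : (c.state p, .internal p i, s) ∈ (S p).trans) :
    ∃ c', Step S c (.internal p i) c' ∧ c'.state p = s := by
  let d : Config S :=
    { state := Function.update c.state p s
      chan := c.chan }
  have hd : d.state p = s := Function.update_self ..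
  refine ⟨d, ⟨?_, fun r hr => Function.update_of_ne hr _ _, rfl⟩, hd⟩
  simp only [Act.actor]
  rw [hd]
  exact h

end FIFOSystem

/-- Reachability is transferred by functional bisimulations. -/
theorem reflTransGen_iff_of_bisim {σ τ : Type*} {R : σ → σ → Prop} {R' : τ → τ → Prop}
    {f : σ → τ} {I : σ → Prop} (hI : ∀ a b, I a → R a b → I b)
    (hf : ∀ a b, I a → R a b → R' (f a) (f b))
    (hb : ∀ a t, I a → R' (f a) t → ∃ b, R a b ∧ f b = t) {a : σ} (ha : I a) {t : τ} :
    ReflTransGen R' (f a) t ↔ ∃ b, I b ∧ ReflTransGen R a b ∧ f b = t := by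
  constructor
  · intro h
    induction h with
    | refl => exact ⟨a, ha, .refl, rfl⟩
    | tail _ h ih =>
      obtain ⟨b, hIb, hab, rfl⟩ := ih
      obtain ⟨b', hbb', rfl⟩ := hb b _ hIb h
      exact ⟨b', hI _ _ hIb hbb', hab.tail hbb', rfl⟩
  · rintro ⟨b, -, hab, rfl⟩
    have : I b ∧ ReflTransGen R' (f a) (f b) := by
      induction hab with
      | refl => exact ⟨ha, .refl⟩
      | tail _ h ih => exact ⟨hI _ _ ih.1 h, ih.2.tail (hf _ _ ih.1 h)⟩
    exact this.2

end CrashStop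

namespace CrashStop

open Relation

/-! ### Weak multiparty compatibility as liveness of a rewriting system -/

def letters (T : Table) : List (List ℕ) :=
  T.2.1.map fun e => e.2.2.1.2.2

/-- The words of length at most `k`. -/
def words (B : List (List ℕ)) (k : ℕ) : List Val :=
  (fun W => [] :: W.flatMap fun w => B.map fun m => m :: w)^[k] [[]]

theorem mem_words {B : List (List ℕ)} {k : ℕ} {w : Val} :
    w ∈ words B k ↔ w.length ≤ k ∧ ∀ m ∈ w, m ∈ B := by
  induction k generalizing w with
  | zero => cases w <;> simp [words]
  | succ k ih =>
    have : words B (k + 1) = [] :: (words B k).flatMap fun w => B.map fun m => m :: w := by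
      simp only [words, Function.iterate_succ_apply']
    rw [this]
    rcases w with _ | ⟨m, w⟩
    · simp
    · simp [ih]
      tauto

/-- The words of length less than `k` over the messages of a table. -/
def shortWords (k : ℕ) (T : Table) : List Val :=
  (words (letters T) k).filter fun w => decide (w.length < k)

theorem mem_shortWords {k : ℕ} {T : Table} {w : Val} :
    w ∈ shortWords k T ↔ w.length < k ∧ ∀ m ∈ w, m ∈ letters T := by
  simp only [shortWords, List.mem_filter, mem_words, decide_eq_true_eq]
  constructor
  · rintro ⟨⟨-, h⟩, h'⟩
    exact ⟨h', h⟩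
  · rintro ⟨h', h⟩
    exact ⟨⟨h'.le, h⟩, h'⟩

/-- A channel is a single cell, so there is one rule for each word that may accompany the message.
Since `w` is shorter than `k`, the channel respects the bound before and after the step. Kinds of
action other than `0` and `1` are internal. -/
def wmcRules (k : ℕ) (T : Table) : List Rule :=
  T.2.1.flatMap fun e =>
    bif decide (e.2.2.1.1 = 0) then
      (shortWords k T).map fun w =>
        [([0, e.1], [e.2.1], [e.2.2.2]), ([1, e.1, e.2.2.1.2.1], w, w ++ [e.2.2.1.2.2])]
    else bif decide (e.2.2.1.1 = 1) then
      (shortWords k T).map fun w =>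
        [([0, e.1], [e.2.1], [e.2.2.2]), ([1, e.2.2.1.2.1, e.1], e.2.2.1.2.2 :: w, w)]
    else [[([0, e.1], [e.2.1], [e.2.2.2])]]

/-- The conditions under which `q` can receive the message `m` from `p`. -/
def recvConditions (k : ℕ) (T : Table) (p q : ℕ) (m : List ℕ) : List Mem :=
  T.2.1.flatMap fun e => bif decide (e.1 = q) && decide (e.2.2.1 = (1, p, m)) then
    (shortWords k T).map fun w => [([0, q], [e.2.1]), ([1, p, q], m :: w)] else []

/-- With `w` shorter than `k`, the words `m :: w` are the non-empty channel contents within the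
bound. -/
def receptionObligations (k : ℕ) (T : Table) : List Obligation :=
  (List.range T.1).flatMap fun p => (List.range T.1).flatMap fun q =>
    bif decide (p = q) then [] else
      (shortWords k T).flatMap fun w => (letters T).map fun m =>
        ([([1, p, q], m :: w)], recvConditions k T p q m)

/-- Does the state have no outgoing receives? -/
def hasNoRecv (T : Table) (p : ℕ) (s : List ℕ) : Bool :=
  T.2.1.all fun e => !(decide (e.1 = p) && (decide (e.2.1 = s) && decide (e.2.2.1.1 = 1)))

/-- The conditions under which the participant `p` can perform the send `x`. -/
def sendConditions (k : ℕ) (T : Table) (p : ℕ) (x : ℕ × ℕ × List ℕ) : List Mem :=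
  T.2.1.flatMap fun e => bif decide (e.1 = p) && decide (e.2.2.1 = x) then
    (shortWords k T).map fun w => [([0, p], [e.2.1]), ([1, p, x.2.1], w)]
    else []

/-- The entry itself shows that the state has an outgoing send, so only the absence of receives is
tested. The goal is the same send from any state of the participant, as in `Exhaustive`. -/
def exhaustivityObligations (k : ℕ) (T : Table) : List Obligation :=
  T.2.1.flatMap fun e => bif decide (e.2.2.1.1 = 0) && hasNoRecv T e.1 e.2.1 then
    [([([0, e.1], [e.2.1])], sendConditions k T e.1 e.2.2.1)] else []

namespace Coding

open FIFOSystem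

variable {n : ℕ} {A : Type} {S : FIFOSystem (Fin n) A} {T : Table} (C : Coding S T) {k : ℕ}

include C

/-- The invariant of the configurations that are considered for weak compatibility. -/
structure Good (k : ℕ) (c : Config S) : Prop where
  bounded : c.Bounded k
  diag : ∀ p, c.chan p p = []
  letters : ∀ p q, ∀ m ∈ c.chan p q, C.msg m ∈ letters T

def wordCode (u : List A) : Val :=
  u.map C.msg

/-- The memory that represents a configuration. -/
def configMem (c : Config S) : Mem :=
  cells (C.configLayout C.wordCode c [] []) (keys n)

theorem msg_mem_letters {p : Fin n} {s s' : (S p).State} {a : Act (Fin n) A}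
    (h : (s, a, s') ∈ (S p).trans) : (actCode C.msg a).2.2 ∈ CrashStop.letters T :=
  List.mem_map.2 ⟨_, C.complete _ _ _ _ h, rfl⟩

theorem good_init : C.Good k (initConfig S) where
  bounded _ _ _ := Nat.zero_le _
  diag _ := rfl
  letters _ _ m hm := by simp [initConfig] at hm

variable {C} in
theorem Good.step {c c' : Config S} {a : Act (Fin n) A} (hc : C.Good k c)
    (h : StepK S k c a c') : C.Good k c' := by
  refine ⟨h.2.1, fun p => ?_, fun p q m hm => ?_⟩
  · have hs := h.2.2
    cases a with
    | send p' q' a =>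
      have := ne_of_step_send hs
      rw [hs.2.2.2 p p (by rintro ⟨⟩; exact this rfl), hc.diag]
    | recv p' q' a =>
      have := ne_of_step_recv hs
      rw [hs.2.2.2 p p (by rintro ⟨⟩; exact this rfl), hc.diag]
    | internal p' i => rw [show c'.chan = c.chan from hs.2.2, hc.diag]
  · have hs := h.2.2
    cases a with
    | send p' q' a =>
      by_cases hpq : (p, q) = (p', q')
      · obtain ⟨rfl, rfl⟩ := Prod.ext_iff.1 hpq
        rw [hs.2.2.1] at hm
        rcases List.mem_append.1 hm with hm | hm
        · exact hc.letters _ _ _ hm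
        · obtain rfl := List.mem_singleton.1 hm
          exact C.msg_mem_letters hs.1
      · rw [hs.2.2.2 p q hpq] at hm
        exact hc.letters _ _ _ hm
    | recv p' q' a =>
      by_cases hpq : (p, q) = (p', q')
      · obtain ⟨rfl, rfl⟩ := Prod.ext_iff.1 hpq
        refine hc.letters p q _ ?_
        rw [hs.2.2.1]
        exact .tail _ hm
      · rw [hs.2.2.2 p q hpq] at hm
        exact hc.letters _ _ _ hm
    | internal p' i =>
      rw [show c'.chan = c.chan from hs.2.2] at hm
      exact hc.letters _ _ _ hm

variable {C} in
theorem Good.wordCode_mem {c : Config S} (hc : C.Good k c) (p q : Fin n) :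
    ∀ m ∈ C.wordCode (c.chan p q), m ∈ CrashStop.letters T := by
  intro m hm
  obtain ⟨a, ha, rfl⟩ := List.mem_map.1 hm
  exact hc.letters _ _ _ ha

variable {C} in
-- `Bounded` says nothing about channels from a participant to itself; these are empty by `diag`.
theorem Good.length_le {c : Config S} (hc : C.Good k c) (p q : Fin n) :
    (c.chan p q).length ≤ k := by
  by_cases h : p = q
  · subst h
    rw [hc.diag]
    exact Nat.zero_le _
  · exact hc.bounded _ _ h

theorem wordCode_eq_cons {u : List A} {a : A} {v : Val} (h : C.wordCode u = C.msg a :: v) :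
    ∃ u', u = a :: u' ∧ v = C.wordCode u' := by
  rcases u with _ | ⟨b, u⟩
  · simp [wordCode] at h
  · simp only [wordCode, List.map_cons, List.cons.injEq] at h
    obtain rfl := C.msg_inj h.1
    exact ⟨u, rfl, h.2.symm⟩

omit C in
theorem bounded_of_send {c c' : Config S} {p q : Fin n} {a : A} (hc : c.Bounded k)
    (h : Step S c (.send p q a) c') (hlt : (c.chan p q).length < k) : c'.Bounded k := by
  intro r t hrt
  by_cases hpq : r = p ∧ t = q
  · obtain ⟨rfl, rfl⟩ := hpq
    rw [h.2.2.1, List.length_append]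
    exact hlt
  · rw [h.2.2.2 r t fun h => hpq (Prod.ext_iff.1 h)]
    exact hc r t hrt

omit C in
theorem bounded_of_recv {c c' : Config S} {p q : Fin n} {a : A} (hc : c.Bounded k)
    (h : Step S c (.recv p q a) c') : c'.Bounded k := by
  intro r t hrt
  by_cases hpq : r = p ∧ t = q
  · obtain ⟨rfl, rfl⟩ := hpq
    have := hc r t hrt
    rw [h.2.2.1, List.length_cons] at this
    omega
  · rw [h.2.2.2 r t fun h => hpq (Prod.ext_iff.1 h)]
    exact hc r t hrt

variable {C} in
-- The rule comes from the table entry of the transition; the word is the content of the channel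
-- before a send or after a receive, which the bound makes shorter than `k`.
theorem Good.configMem_mem_rewrites {c c' : Config S} (hc : C.Good k c)
    (h : ∃ a, StepK S k c a c') : C.configMem c' ∈ rewrites (wmcRules k T) (C.configMem c) := by
  obtain ⟨a, h⟩ := h
  have hc' := hc.step h
  have hs := h.2.2
  have hent := C.complete _ _ _ _ hs.1
  rw [mem_rewrites]
  simp only [wmcRules, List.mem_flatMap]
  cases a with
  | send p q a =>
    have hlt : (c.chan p q).length < k := by
      have := hc'.length_le p q
      rw [hs.2.2.1, List.length_append] at this
      exact this
    refine ⟨_, ⟨_, hent, List.mem_map.2 ⟨C.wordCode (c.chan p q),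
      mem_shortWords.2 ⟨by simpa [wordCode] using hlt, hc.wordCode_mem p q⟩, rfl⟩⟩, ?_, ?_⟩
    · simp only [Rule.guard, configMem, cells_has_iff, List.map_cons, List.map_nil,
        List.forall_mem_cons]
      exact ⟨C.has_state_iff.2 ⟨p, rfl, rfl⟩, C.has_chan_iff.2 ⟨p, q, rfl, rfl, rfl⟩, by simp⟩
    · rw [configMem, configMem, apply_cells, C.configLayout_send _ _ _ hs, hs.2.2.1]
      simp [wordCode, actCode, Act.actor]
  | recv p q a =>
    have hlt : (c'.chan p q).length < k := by
      have := hc.length_le p q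
      rw [hs.2.2.1, List.length_cons] at this
      exact this
    refine ⟨_, ⟨_, hent, List.mem_map.2 ⟨C.wordCode (c'.chan p q),
      mem_shortWords.2 ⟨by simpa [wordCode] using hlt, hc'.wordCode_mem p q⟩, rfl⟩⟩, ?_, ?_⟩
    · simp only [Rule.guard, configMem, cells_has_iff, List.map_cons, List.map_nil,
        List.forall_mem_cons]
      exact ⟨C.has_state_iff.2 ⟨q, rfl, rfl⟩,
        C.has_chan_iff.2 ⟨p, q, rfl, rfl, by rw [hs.2.2.1]; rfl⟩, by simp⟩
    · rw [configMem, configMem, apply_cells, C.configLayout_recv _ _ _ hs]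
      simp [actCode, Act.actor]
  | internal p i =>
    refine ⟨_, ⟨_, hent, List.mem_singleton_self _⟩, ?_, ?_⟩
    · simp only [Rule.guard, configMem, cells_has_iff, List.map_cons, List.map_nil,
        List.forall_mem_cons]
      exact ⟨C.has_state_iff.2 ⟨p, rfl, rfl⟩, by simp⟩
    · rw [configMem, configMem, apply_cells, C.configLayout_internal _ _ _ hs]
      simp [Act.actor]

variable {C} in
-- The guards identify the participant, its state and the content of the channel; soundness of the
-- table then supplies the transition.
theorem Good.exists_of_mem_rewrites {c : Config S} (hc : C.Good k c) {t : Mem}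
    (h : t ∈ rewrites (wmcRules k T) (C.configMem c)) :
    ∃ c', (∃ a, StepK S k c a c') ∧ C.configMem c' = t := by
  obtain ⟨r, hr, hg, rfl⟩ := mem_rewrites.1 h
  obtain ⟨⟨i, s, ⟨x, j, m⟩, s'⟩, he, hr⟩ := List.mem_flatMap.1 hr
  by_cases h₀ : x = 0
  · subst h₀
    obtain ⟨w, hw, rfl⟩ := List.mem_map.1 hr
    simp only [Rule.guard, configMem, cells_has_iff, List.map_cons, List.map_nil,
      List.forall_mem_cons] at hg
    obtain ⟨hg₁, hg₂, -⟩ := hg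
    obtain ⟨p, rfl, rfl⟩ := C.has_state_iff.1 hg₁
    obtain ⟨q, a, s', rfl, rfl, rfl, ht⟩ := C.sound_send he
    obtain ⟨p', q', hp', hq', hw'⟩ := C.has_chan_iff.1 hg₂
    obtain rfl : p = p' := Fin.ext hp'
    obtain rfl : q = q' := Fin.ext hq'
    subst hw'
    obtain ⟨c', hs, rfl⟩ := exists_step_send ht
    have hlt := (mem_shortWords.1 hw).1
    rw [wordCode, List.length_map] at hlt
    refine ⟨c', ⟨_, hc.bounded, bounded_of_send hc.bounded hs hlt, hs⟩, ?_⟩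
    rw [configMem, configMem, apply_cells, C.configLayout_send _ _ _ hs, hs.2.2.1]
    simp [wordCode]
  by_cases h₁ : x = 1
  · subst h₁
    obtain ⟨w, hw, rfl⟩ := List.mem_map.1 hr
    simp only [Rule.guard, configMem, cells_has_iff, List.map_cons, List.map_nil,
      List.forall_mem_cons] at hg
    obtain ⟨hg₁, hg₂, -⟩ := hg
    obtain ⟨q, rfl, rfl⟩ := C.has_state_iff.1 hg₁
    obtain ⟨p, a, s', rfl, rfl, rfl, ht⟩ := C.sound_recv he
    obtain ⟨p', q', hp', hq', hw'⟩ := C.has_chan_iff.1 hg₂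
    obtain rfl : p = p' := Fin.ext hp'
    obtain rfl : q = q' := Fin.ext hq'
    obtain ⟨u, hu, rfl⟩ := C.wordCode_eq_cons hw'
    obtain ⟨c', hs, rfl⟩ := exists_step_recv ht hu
    refine ⟨c', ⟨_, hc.bounded, bounded_of_recv hc.bounded hs, hs⟩, ?_⟩
    have hu' : c'.chan p q = u := (List.cons.inj (hs.2.2.1.symm.trans hu)).2
    rw [configMem, configMem, apply_cells, C.configLayout_recv _ _ _ hs, hu']
    simp
  · simp only [h₀, h₁, decide_false, cond_false, List.mem_singleton] at hr
    subst hr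
    simp only [Rule.guard, configMem, cells_has_iff, List.map_cons, List.map_nil,
      List.forall_mem_cons] at hg
    obtain ⟨p, rfl, rfl⟩ := C.has_state_iff.1 hg.1
    obtain ⟨i, s', rfl, ht⟩ := C.sound_internal he h₀ h₁
    obtain ⟨c', hs, rfl⟩ := exists_step_internal ht
    refine ⟨c', ⟨_, hc.bounded, ?_, hs⟩, ?_⟩
    · intro r t hrt
      rw [show c'.chan = c.chan from hs.2.2]
      exact hc.bounded r t hrt
    · rw [configMem, configMem, apply_cells, C.configLayout_internal _ _ _ hs]
      simp

variable {C} in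
theorem Good.reach_iff {c : Config S} (hc : C.Good k c) {t : Mem} :
    ReflTransGen (fun s s' => s' ∈ rewrites (wmcRules k T) s) (C.configMem c) t ↔
      ∃ d, C.Good k d ∧ ReachK S k c d ∧ C.configMem d = t :=
  reflTransGen_iff_of_bisim (fun _ _ hc ⟨_, h⟩ => hc.step h)
    (fun _ _ hc h => hc.configMem_mem_rewrites h) (fun _ _ hc h => hc.exists_of_mem_rewrites h) hc

theorem isSending_of_hasNoRecv {p : Fin n} {s : (S p).State}
    (h : hasNoRecv T p (C.st p s) = true) (a : Act (Fin n) A) (s' : (S p).State)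
    (ht : (s, a, s') ∈ (S p).trans) : ¬ a.IsRecv := by
  intro ha
  have := C.complete _ _ _ _ ht
  simp only [hasNoRecv, List.all_eq_true] at h
  have := h _ this
  cases a with
  | recv _ _ _ => simp [actCode] at this
  | send _ _ _ => exact ha
  | internal _ _ => exact ha

theorem hasNoRecv_of_isSending {p : Fin n} {s : (S p).State} (h : (S p).IsSending s) :
    hasNoRecv T p (C.st p s) = true := by
  simp only [hasNoRecv, List.all_eq_true]
  rintro ⟨i, w, ⟨x, j, m⟩, w'⟩ he
  by_contra hcon
  rw [Bool.not_eq_true, Bool.not_eq_false', Bool.and_eq_true, Bool.and_eq_true] at hcon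
  simp only [decide_eq_true_eq] at hcon
  obtain ⟨rfl, rfl, rfl⟩ := hcon
  obtain ⟨q, a, s', rfl, rfl, rfl, ht⟩ := C.sound_recv he
  exact h.2 _ _ ht trivial

/-- By `Good.reach_iff`, rewriting is reachability within the bound. Whether a send or receive can
be performed within the bound depends only on one local state and one channel, so it becomes a test
of two cells. -/
theorem isWMC_iff : S.IsWMC k ↔
    ∀ c, ReflTransGen (fun s s' => s' ∈ rewrites (wmcRules k T) s) (initMem T) c →
      ∀ o ∈ receptionObligations k T ++ exhaustivityObligations k T, c.has o.1 = true →
        ∃ d, ReflTransGen (fun s s' => s' ∈ rewrites (wmcRules k T) s) c d ∧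
          ∃ g ∈ o.2, d.has g = true := by
  rw [C.initMem_eq_cells C.wordCode rfl]
  constructor
  · rintro ⟨hrec, hexh⟩ t ht o ho hto
    obtain ⟨c, hgc, hc, rfl⟩ := C.good_init.reach_iff.1 ht
    rcases List.mem_append.1 ho with ho | ho
    · simp only [receptionObligations, List.mem_flatMap, List.mem_range] at ho
      obtain ⟨i, hi, j, hj, ho⟩ := ho
      by_cases hij : i = j
      · simp [hij] at ho
      simp only [hij, decide_false, cond_false, List.mem_flatMap, List.mem_map] at ho
      obtain ⟨w, hw, m, hm, rfl⟩ := ho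
      simp only [configMem, cells_has_iff, List.forall_mem_cons] at hto
      obtain ⟨p, q, rfl, rfl, hpq⟩ := C.has_chan_iff.1 hto.1
      obtain ⟨a, u, hau⟩ : ∃ a u, c.chan p q = a :: u :=
        List.exists_cons_of_ne_nil (by rintro h; simp [h, wordCode] at hpq)
      obtain ⟨d, d', hd, hdd'⟩ := hrec c hc p q a u (fun h => hij (congrArg Fin.val h)) hau
      obtain ⟨hgd, -⟩ : C.Good k d ∧ True := by
        refine ⟨?_, trivial⟩
        clear hdd'
        induction hd with
        | refl => exact hgc
        | tail _ h ih => exact ih.step h.choose_spec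
      have hs := hdd'.2.2
      have hm : m = C.msg a := by
        rw [hau] at hpq
        exact (List.cons.inj hpq).1.symm
      have hlt : (d'.chan p q).length < k := by
        have := hgd.length_le p q
        rw [hs.2.2.1, List.length_cons] at this
        exact this
      refine ⟨C.configMem d, hgc.reach_iff.2 ⟨d, hgd, hd, rfl⟩,
        [([0, q.val], [C.st q (d.state q)]), ([1, p.val, q.val], m :: C.wordCode (d'.chan p q))],
        ?_, ?_⟩
      · refine List.mem_flatMap.2 ⟨_, C.complete _ _ _ _ hs.1, ?_⟩
        simp only [Act.actor, actCode, hm, decide_true, Bool.and_self, cond_true]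
        exact List.mem_map.2 ⟨_, mem_shortWords.2
          ⟨by simpa [wordCode] using hlt, (hgd.step hdd').wordCode_mem p q⟩, rfl⟩
      · simp only [configMem, cells_has_iff, List.forall_mem_cons]
        refine ⟨C.has_state_iff.2 ⟨q, rfl, rfl⟩, C.has_chan_iff.2 ⟨p, q, rfl, rfl, ?_⟩, by simp⟩
        rw [hs.2.2.1, hm]
        rfl
    · simp only [exhaustivityObligations, List.mem_flatMap] at ho
      obtain ⟨⟨i, s, ⟨x, j, m⟩, s'⟩, he, ho⟩ := ho
      by_cases hsend : (decide (x = 0) && hasNoRecv T i s) = true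
      swap
      · rw [Bool.not_eq_true] at hsend
        simp [hsend] at ho
      simp only [hsend, cond_true, List.mem_singleton] at ho
      subst ho
      obtain ⟨hx, hno⟩ := by simpa using hsend
      subst hx
      simp only [configMem, cells_has_iff, List.forall_mem_cons] at hto
      obtain ⟨p, rfl, rfl⟩ := C.has_state_iff.1 hto.1
      obtain ⟨q, a, s', rfl, rfl, rfl, ht⟩ := C.sound_send he
      obtain ⟨d, d', hd, hdd'⟩ := hexh c hc p q ((S p).onChannel _ _ _ ht)
        ⟨⟨_, _, ht, trivial⟩, C.isSending_of_hasNoRecv hno⟩ a s' ht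
      obtain ⟨hgd, -⟩ : C.Good k d ∧ True := by
        refine ⟨?_, trivial⟩
        clear hdd'
        induction hd with
        | refl => exact hgc
        | tail _ h ih => exact ih.step h.choose_spec
      have hs := hdd'.2.2
      have hlt : (d.chan p q).length < k := by
        have := (hgd.step hdd').length_le p q
        rw [hs.2.2.1, List.length_append] at this
        exact this
      refine ⟨C.configMem d, hgc.reach_iff.2 ⟨d, hgd, hd, rfl⟩,
        [([0, p.val], [C.st p (d.state p)]), ([1, p.val, q.val], C.wordCode (d.chan p q))], ?_, ?_⟩
      · refine List.mem_flatMap.2 ⟨_, C.complete _ _ _ _ hs.1, ?_⟩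
        simp only [Act.actor, actCode, decide_true, Bool.and_self, cond_true]
        exact List.mem_map.2 ⟨_, mem_shortWords.2
          ⟨by simpa [wordCode] using hlt, hgd.wordCode_mem p q⟩, rfl⟩
      · simp only [configMem, cells_has_iff, List.forall_mem_cons]
        exact ⟨C.has_state_iff.2 ⟨p, rfl, rfl⟩, C.has_chan_iff.2 ⟨p, q, rfl, rfl, rfl⟩, by simp⟩
  · intro H
    have hgood {c : Config S} (hc : ReachK S k (initConfig S) c) : C.Good k c := by
      induction hc with
      | refl => exact C.good_init
      | tail _ h ih => exact ih.step h.choose_spec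
    refine ⟨fun c hc p q a u hpq hau => ?_, fun c hc p q hpq hsend a s' ht => ?_⟩
    · have hgc := hgood hc
      have hlt : u.length < k := by
        have := hgc.length_le p q
        rw [hau, List.length_cons] at this
        exact this
      have hw := hgc.wordCode_mem p q
      rw [hau, wordCode, List.map_cons, List.forall_mem_cons] at hw
      obtain ⟨t, ht, h, hh, hth⟩ := H _ (C.good_init.reach_iff.2 ⟨c, hgc, hc, rfl⟩)
        ([([1, p.val, q.val], C.msg a :: C.wordCode u)], recvConditions k T p q (C.msg a))
        (by
          refine List.mem_append_left _ ?_
          simp only [receptionObligations, List.mem_flatMap, List.mem_range, C.size_eq]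
          refine ⟨p, p.2, q, q.2, ?_⟩
          have : ¬ (p : ℕ) = q := fun h => hpq (Fin.ext h)
          simp only [this, decide_false, cond_false, List.mem_flatMap, List.mem_map]
          exact ⟨C.wordCode u, mem_shortWords.2 ⟨by simpa [wordCode] using hlt, hw.2⟩, C.msg a,
            hw.1, rfl⟩)
        (by
          simp only [configMem, cells_has_iff, List.forall_mem_cons]
          exact ⟨C.has_chan_iff.2 ⟨p, q, rfl, rfl, by rw [hau]; rfl⟩, by simp⟩)
      obtain ⟨d, hgd, hd, rfl⟩ := hgc.reach_iff.1 ht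
      obtain ⟨⟨i, s, x, s'⟩, he, hh⟩ := List.mem_flatMap.1 hh
      by_cases hcond : (decide (i = q.val) && decide (x = (1, p.val, C.msg a))) = true
      swap
      · rw [Bool.not_eq_true] at hcond
        simp [hcond] at hh
      simp only [hcond, cond_true] at hh
      obtain ⟨w', hw', rfl⟩ := List.mem_map.1 hh
      obtain ⟨rfl, rfl⟩ : i = q.val ∧ x = (1, p.val, C.msg a) := by simpa using hcond
      simp only [configMem, cells_has_iff, List.forall_mem_cons] at hth
      obtain ⟨hth₁, hth₂, -⟩ := hth
      obtain ⟨q', hq', rfl⟩ := C.has_state_iff.1 hth₁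
      obtain rfl : q = q' := Fin.ext hq'
      obtain ⟨p', q', hp', hq', hdw⟩ := C.has_chan_iff.1 hth₂
      obtain rfl : p = p' := Fin.ext hp'
      obtain rfl : q = q' := Fin.ext hq'
      obtain ⟨u', hu', -⟩ := C.wordCode_eq_cons hdw
      obtain ⟨p', a', s', hp', ha', -, htr⟩ := C.sound_recv he
      obtain rfl : p = p' := Fin.ext hp'
      obtain rfl := C.msg_inj ha'
      obtain ⟨d', hs, -⟩ := exists_step_recv htr hu'
      exact ⟨d, d', hd, hgd.bounded, bounded_of_recv hgd.bounded hs, hs⟩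
    · have hgc := hgood hc
      have he := C.complete _ _ _ _ ht
      obtain ⟨t, htr, h, hh, hth⟩ := H _ (C.good_init.reach_iff.2 ⟨c, hgc, hc, rfl⟩)
        ([([0, p.val], [C.st p (c.state p)])], sendConditions k T p (0, q, C.msg a))
        (by
          refine List.mem_append_right _ ?_
          simp only [exhaustivityObligations, List.mem_flatMap]
          refine ⟨_, he, ?_⟩
          simp only [actCode, decide_true, C.hasNoRecv_of_isSending hsend, Bool.and_self, cond_true]
          exact List.mem_singleton_self _)
        (by
          simp only [configMem, cells_has_iff, List.forall_mem_cons]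
          exact ⟨C.has_state_iff.2 ⟨p, rfl, rfl⟩, by simp⟩)
      obtain ⟨d, hgd, hd, rfl⟩ := hgc.reach_iff.1 htr
      obtain ⟨⟨i, s, x, s''⟩, he', hh⟩ := List.mem_flatMap.1 hh
      by_cases hcond : (decide (i = p.val) && decide (x = (0, q.val, C.msg a))) = true
      swap
      · rw [Bool.not_eq_true] at hcond
        simp [hcond] at hh
      simp only [hcond, cond_true] at hh
      obtain ⟨w', hw', rfl⟩ := List.mem_map.1 hh
      obtain ⟨rfl, rfl⟩ : i = p.val ∧ x = (0, q.val, C.msg a) := by simpa using hcond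
      simp only [configMem, cells_has_iff, List.forall_mem_cons] at hth
      obtain ⟨hth₁, hth₂, -⟩ := hth
      obtain ⟨p', hp', rfl⟩ := C.has_state_iff.1 hth₁
      obtain rfl : p = p' := Fin.ext hp'
      obtain ⟨p', q', hp', hq', rfl⟩ := C.has_chan_iff.1 hth₂
      obtain rfl : p = p' := Fin.ext hp'
      obtain rfl : q = q' := Fin.ext hq'
      obtain ⟨q', a', s', hq', ha', -, htr⟩ := C.sound_send he'
      obtain rfl : q = q' := Fin.ext hq'
      obtain rfl := C.msg_inj ha'
      obtain ⟨d', hs, -⟩ := exists_step_send htr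
      have hlt := (mem_shortWords.1 hw').1
      rw [wordCode, List.length_map] at hlt
      exact ⟨d, d', hd, hgd.bounded, bounded_of_send hgd.bounded hs hlt, hs⟩

end Coding

section Primrec

variable {α : Type} [Primcodable α]

@[fun_prop]
theorem primrec_initMem {T : α → Table} (hT : Primrec T) : Primrec fun x => initMem (T x) := by
  unfold initMem
  fun_prop

@[fun_prop]
theorem primrec_letters {T : α → Table} (hT : Primrec T) : Primrec fun x => letters (T x) := by
  unfold letters
  fun_prop

@[fun_prop]
theorem primrec_words {B : α → List (List ℕ)} {k : α → ℕ} (hB : Primrec B) (hk : Primrec k) :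
    Primrec fun x => words (B x) (k x) := by
  unfold words
  fun_prop

@[fun_prop]
theorem primrec_shortWords {k : α → ℕ} {T : α → Table} (hk : Primrec k) (hT : Primrec T) :
    Primrec fun x => shortWords (k x) (T x) := by
  unfold shortWords
  fun_prop

@[fun_prop]
theorem primrec_hasNoRecv {T : α → Table} {p : α → ℕ} {s : α → List ℕ} (hT : Primrec T)
    (hp : Primrec p) (hs : Primrec s) : Primrec fun x => hasNoRecv (T x) (p x) (s x) := by
  unfold hasNoRecv
  fun_prop

@[fun_prop]
theorem primrec_wmcRules {k : α → ℕ} {T : α → Table} (hk : Primrec k) (hT : Primrec T) :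
    Primrec fun x => wmcRules (k x) (T x) := by
  unfold wmcRules
  fun_prop

@[fun_prop]
theorem primrec_recvConditions {k : α → ℕ} {T : α → Table} {p q : α → ℕ} {m : α → List ℕ}
    (hk : Primrec k) (hT : Primrec T) (hp : Primrec p) (hq : Primrec q) (hm : Primrec m) :
    Primrec fun x => recvConditions (k x) (T x) (p x) (q x) (m x) := by
  unfold recvConditions
  fun_prop

@[fun_prop]
theorem primrec_receptionObligations {k : α → ℕ} {T : α → Table} (hk : Primrec k)
    (hT : Primrec T) : Primrec fun x => receptionObligations (k x) (T x) := by
  unfold receptionObligations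
  fun_prop

@[fun_prop]
theorem primrec_sendConditions {k : α → ℕ} {T : α → Table} {p : α → ℕ} {x : α → ℕ × ℕ × List ℕ}
    (hk : Primrec k) (hT : Primrec T) (hp : Primrec p) (hx : Primrec x) :
    Primrec fun a => sendConditions (k a) (T a) (p a) (x a) := by
  unfold sendConditions
  fun_prop

@[fun_prop]
theorem primrec_exhaustivityObligations {k : α → ℕ} {T : α → Table} (hk : Primrec k)
    (hT : Primrec T) : Primrec fun x => exhaustivityObligations (k x) (T x) := by
  unfold exhaustivityObligations
  fun_prop

end Primrec

/-- For tables weak multiparty compatibility is decidable. -/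
theorem exists_computable_isWMC : ∃ f : ℕ × Table → Bool, Computable f ∧
    ∀ (n : ℕ) (A : Type) (S : FIFOSystem (Fin n) A) (T : Table), Coding S T → ∀ k,
      (f (k, T) = true ↔ S.IsWMC k) := by
  obtain ⟨f, hf, h⟩ := exists_computable_rewriting (α := ℕ × Table)
    (init := fun x => initMem x.2) (rules := fun x => wmcRules x.1 x.2)
    (obl := fun x => receptionObligations x.1 x.2 ++ exhaustivityObligations x.1 x.2)
    (by fun_prop) (by fun_prop) (by fun_prop)
  exact ⟨f, hf, fun n A S T C k => (h (k, T)).trans C.isWMC_iff.symm⟩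

end CrashStop

namespace CrashStop

open Relation

-- Following a causal chain step by step

namespace FIFOSystem

variable {P A : Type} {S : FIFOSystem P A}

/-- Synchronous runs in which at some point a message is chosen, together with its channel, and
from then on a causal chain is followed. -/
inductive TStep (S : FIFOSystem P A) :
    Config S × Option ((P × P × A) × P) → Config S × Option ((P × P × A) × P) → Prop
  | stay (c d v o) : SStep S c v d → TStep S (c, o) (d, o)
  | forward (c d p q a w) : SStep S c [.send p q a, .recv p q a] d →
      TStep S (c, some (w, p)) (d, some (w, q))
  | backward (c d p q a w) : SStep S c [.send p q a, .recv p q a] d →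
      TStep S (c, some (w, q)) (d, some (w, p))
  | start (c d p q a) : c.chan p q = [] → Step S c (.send p q a) d →
      TStep S (c, none) (d, some ((p, q, a), p))

/-- In an exchange the chain stays, passes from the sender to the receiver, or passes back; an
interaction with one participant cannot move it. -/
theorem reflTransGen_tstep_of_chain {c d : Config S} {L : List (List (Act P A))} {x y : P}
    {w : P × P × A} (h : SRun S c L d) (hL : Chain L x y) :
    ReflTransGen (TStep S) (c, some (w, x)) (d, some (w, y)) := by
  induction L generalizing c x with
  | nil =>
    obtain rfl := h
    obtain rfl : x = y := hL
    exact .refl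
  | cons v L ih =>
    obtain ⟨m, hv, h⟩ := h
    obtain ⟨z, hz, hL⟩ := hL
    refine .head ?_ (ih h hL)
    rcases hz with rfl | ⟨hx, hz⟩
    · exact .stay _ _ _ _ hv
    · cases hv with
      | send _ p q a hs =>
        simp only [actors_send, Set.mem_singleton_iff] at hx hz
        rw [hx, hz]
        exact .stay _ _ _ _ (.send _ _ _ _ _ hs)
      | internal _ p i hs =>
        simp only [actors_internal, Set.mem_singleton_iff] at hx hz
        rw [hx, hz]
        exact .stay _ _ _ _ (.internal _ _ _ _ hs)
      | pair _ p q a h₁ h₂ h₃ h₄ h₅ h₆ =>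
        have hv := SStep.pair _ _ p q a h₁ h₂ h₃ h₄ h₅ h₆
        simp only [actors_pair, Set.mem_insert_iff, Set.mem_singleton_iff] at hx hz
        rcases hx with rfl | rfl <;> rcases hz with rfl | rfl
        · exact .stay _ _ _ _ hv
        · exact .forward _ _ _ _ _ _ hv
        · exact .backward _ _ _ _ _ _ hv
        · exact .stay _ _ _ _ hv

theorem reflTransGen_tstep_of_srun {c d : Config S} {L : List (List (Act P A))}
    {o : Option ((P × P × A) × P)} (h : SRun S c L d) :
    ReflTransGen (TStep S) (c, o) (d, o) := by
  induction L generalizing c with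
  | nil => obtain rfl := h; exact .refl
  | cons v L ih =>
    obtain ⟨m, hv, h⟩ := h
    exact .head (.stay _ _ _ _ hv) (ih h)

theorem chain_concat {L : List (List (Act P A))} {v : List (Act P A)} {x y z : P}
    (h : Chain L x y) (hv : z = y ∨ y ∈ actors v ∧ z ∈ actors v) : Chain (L ++ [v]) x z := by
  induction L generalizing x with
  | nil =>
    obtain rfl : x = y := h
    exact ⟨z, hv, rfl⟩
  | cons w L ih =>
    obtain ⟨u, hu, h⟩ := h
    exact ⟨u, hu, ih h⟩

/-- What is known about the states reached by `TStep`. -/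
def TInv (S : FIFOSystem P A) : Config S × Option ((P × P × A) × P) → Prop
  | (c, none) => ∃ L, SRun S (initConfig S) L c
  | (c, some ((p, q, m), x)) => ∃ d b L R, SRun S (initConfig S) L d ∧ d.chan p q = [] ∧
      Step S d (.send p q m) b ∧ SRun S b R c ∧ Chain R p x

theorem TInv.step {σ σ' : Config S × Option ((P × P × A) × P)} (hσ : TInv S σ)
    (h : TStep S σ σ') : TInv S σ' := by
  have extend {c d : Config S} {v : List (Act P A)} {p q x z : P} {m : A} (hv : SStep S c v d)
      (hz : z = x ∨ x ∈ actors v ∧ z ∈ actors v) (h : TInv S (c, some ((p, q, m), x))) :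
      TInv S (d, some ((p, q, m), z)) := by
    obtain ⟨e, b, L, R, hL, he, hs, hR, hc⟩ := h
    exact ⟨e, b, L, R ++ [v], hL, he, hs, srun_append.2 ⟨_, hR, srun_singleton.2 hv⟩,
      chain_concat hc hz⟩
  cases h with
  | stay c d v o hv =>
    rcases o with _ | ⟨⟨p, q, m⟩, x⟩
    · obtain ⟨L, hL⟩ := hσ
      exact ⟨L ++ [v], srun_append.2 ⟨_, hL, srun_singleton.2 hv⟩⟩
    · exact extend hv (Or.inl rfl) hσ
  | forward c d p q a w hv => exact extend hv (Or.inr (by simp)) hσ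
  | backward c d p q a w hv => exact extend hv (Or.inr (by simp)) hσ
  | start c d p q a hc hs =>
    obtain ⟨L, hL⟩ := hσ
    exact ⟨c, d, L, [], hL, hc, hs, rfl, rfl⟩

/-- Of the history only the observed message and the end of the chain need to be remembered; the
invariant `TInv` recovers both synchronous runs. -/
theorem hasViolation_iff : HasViolation S ↔ ∃ c p q m s,
    ReflTransGen (TStep S) (initConfig S, none) (c, some ((p, q, m), q)) ∧
      (c.state q, .recv p q m, s) ∈ (S q).trans := by
  constructor
  · rintro ⟨d, c, c', p, q, m, L, R, hL, hd, hs, hR, hc, s, hr⟩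
    exact ⟨c', p, q, m, s, ((reflTransGen_tstep_of_srun hL).tail (.start _ _ _ _ _ hd hs)).trans
      (reflTransGen_tstep_of_chain hR hc), hr⟩
  · rintro ⟨c, p, q, m, s, h, hr⟩
    have : TInv S (c, some ((p, q, m), q)) := by
      generalize hσ : (c, some ((p, q, m), q)) = σ at h
      clear hσ
      induction h with
      | refl => exact ⟨[], rfl⟩
      | tail _ h ih => exact ih.step h
    obtain ⟨d, b, L, R, hL, hd, hs, hR, hc⟩ := this
    exact ⟨d, b, c, p, q, m, L, R, hL, hd, hs, hR, hc, s, hr⟩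

theorem exists_sstep_pair [DecidableEq P] {c : Config S} {p q : P} {a : A} {s : (S p).State}
    {t : (S q).State} (hc : c.chan p q = []) (hs : (c.state p, .send p q a, s) ∈ (S p).trans)
    (ht : (c.state q, .recv p q a, t) ∈ (S q).trans) :
    ∃ d, SStep S c [.send p q a, .recv p q a] d ∧ d.state p = s ∧ d.state q = t := by
  have hpq : p ≠ q := (S p).onChannel _ _ _ hs
  let d : Config S :=
    { state := Function.update (Function.update c.state p s) q t
      chan := c.chan }
  have hp : d.state p = s := by simp [d, hpq]
  have hq : d.state q = t := by simp [d]
  refine ⟨d, .pair _ _ _ _ _ hpq hc ?_ ?_ (fun r h₁ h₂ => by simp [d, h₁, h₂]) rfl, hp, hq⟩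
  · rw [hp]; exact hs
  · rw [hq]; exact ht

end FIFOSystem

/-! ### RSC as a safety property of a rewriting system -/

/-- The first component changes nothing; it tests that the channel is empty. -/
def pairRule (e e' : Entry) : Rule :=
  [([1, e.1, e'.1], [], []), ([0, e.1], [e.2.1], [e.2.2.2]), ([0, e'.1], [e'.2.1], [e'.2.2.2])]

/-- The variants leave the token where it is, pass it from the sender to the receiver, or pass it
from the receiver to the sender. -/
def pairRules (T : Table) : List Rule :=
  T.2.1.flatMap fun e => T.2.1.flatMap fun e' =>
    bif decide (e.2.2.1.1 = 0) && (decide (e.2.2.1.2.1 = e'.1) &&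
      decide (e'.2.2.1 = (1, e.1, e.2.2.1.2.2))) then
      [pairRule e e', pairRule e e' ++ [([3], [[e.1]], [[e'.1]])],
        pairRule e e' ++ [([3], [[e'.1]], [[e.1]])]]
    else []

def sendRule (e : Entry) (v : Val) : Rule :=
  [([0, e.1], [e.2.1], [e.2.2.2]), ([1, e.1, e.2.2.1.2.1], v, [[]])]

/-- The value `[[]]` stands for any non-empty channel, so a send is possible from both values. The
third variant starts the observation and needs an empty channel and an unset token. A receive has no
rule of its own, since in synchronous runs it occurs only within an exchange. -/
def singleRules (T : Table) : List Rule :=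
  T.2.1.flatMap fun e =>
    bif decide (e.2.2.1.1 = 0) then
      [sendRule e [], sendRule e [[]], sendRule e [] ++
        [([2], [], [[e.1], [e.2.2.1.2.1], e.2.2.1.2.2]), ([3], [], [[e.1]])]]
    else bif decide (e.2.2.1.1 = 1) then []
    else [[([0, e.1], [e.2.1], [e.2.2.2])]]

def rscRules (T : Table) : List Rule :=
  pairRules T ++ singleRules T

/-- An obligation without alternatives cannot be met, so it forbids its condition, here the end of a
violation. -/
def rscObligations (T : Table) : List Obligation :=
  T.2.1.flatMap fun e => bif decide (e.2.2.1.1 = 1) then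
    [([([0, e.1], [e.2.1]), ([2], [[e.2.2.1.2.1], [e.1], e.2.2.1.2.2]), ([3], [[e.1]])], [])]
    else []

/-- Only the emptiness of a channel is recorded. -/
def emptiness {A : Type} : List A → Val
  | [] => []
  | _ :: _ => [[]]

theorem emptiness_concat {A : Type} (u : List A) (a : A) : emptiness (u ++ [a]) = [[]] := by
  cases u <;> rfl

theorem emptiness_eq_nil {A : Type} {u : List A} : emptiness u = [] ↔ u = [] := by
  cases u <;> simp [emptiness]

namespace Coding

open FIFOSystem

variable {n : ℕ} {A : Type} {S : FIFOSystem (Fin n) A} {T : Table} (C : Coding S T)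

include C

def watchVal : Option ((Fin n × Fin n × A) × Fin n) → Val
  | none => []
  | some ((p, q, m), _) => [[p], [q], C.msg m]

omit C in
def tokenVal : Option ((Fin n × Fin n × A) × Fin n) → Val
  | none => []
  | some (_, x) => [[x]]

def traceMem (σ : Config S × Option ((Fin n × Fin n × A) × Fin n)) : Mem :=
  cells (C.configLayout emptiness σ.1 (C.watchVal σ.2) (tokenVal σ.2)) (keys n)

omit C in
theorem tokenVal_eq_iff {o : Option ((Fin n × Fin n × A) × Fin n)} {p : Fin n} :
    tokenVal o = [[(p : ℕ)]] ↔ ∃ w, o = some (w, p) := by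
  rcases o with _ | ⟨w, x⟩
  · simp [tokenVal]
  · simp [tokenVal, Fin.ext_iff]

variable {c d : Config S} {p q : Fin n} {a : A}

theorem configLayout_pair (g : List A → Val) (w t : Val) (hg : g [] = [])
    (h : SStep S c [.send p q a, .recv p q a] d) :
    C.configLayout g d w t = Function.update (Function.update (Function.update
      (C.configLayout g c w t) [1, p, q] []) [0, p] [C.st p (d.state p)])
      [0, q] [C.st q (d.state q)] := by
  cases h with
  | pair _ _ _ _ hpq hce _ _ ho hch =>
    -- The channel is empty already, so the first assignment of `pairRule` has no effect.
    have h₁ : Function.update (C.configLayout g c w t) [1, p, q] [] = C.configLayout g c w t := by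
      rw [Function.update_eq_self_iff, configLayout, layout, chanCells_val, hce, hg]
    rw [h₁, configLayout, configLayout, update_layout_state, update_layout_state]
    have h₂ : chanCells g d = chanCells g c := by
      unfold chanCells
      rw [hch]
    rw [h₂]
    congr 1
    funext i
    by_cases hq : i = q
    · subst hq; simp [stateCells]
    rw [Function.update_of_ne hq]
    by_cases hp : i = p
    · subst hp; simp [stateCells]
    rw [Function.update_of_ne hp]
    unfold stateCells
    split
    · rw [ho _ (fun h => hp (congrArg Fin.val h)) fun h => hq (congrArg Fin.val h)]
    · rfl

/-- The part of the argument that the three variants of the rule for an exchange have in common. -/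
theorem pair_has {w t : Val} (h : SStep S c [.send p q a, .recv p q a] d) :
    ∃ e ∈ T.2.1, ∃ e' ∈ T.2.1, e.1 = p ∧ e'.1 = q ∧ (decide (e.2.2.1.1 = 0) &&
      (decide (e.2.2.1.2.1 = e'.1) && decide (e'.2.2.1 = (1, e.1, e.2.2.1.2.2)))) = true ∧
      (∀ x ∈ (pairRule e e').guard, x.1 ∈ keys n ∧ C.configLayout emptiness c w t x.1 = x.2) ∧
      (pairRule e e').foldl (fun f c => Function.update f c.1 c.2.2)
        (C.configLayout emptiness c w t) = C.configLayout emptiness d w t := by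
  have h' := C.configLayout_pair emptiness w t rfl h
  cases h with
  | pair _ _ _ _ hpq hce hs hr ho hch =>
    refine ⟨_, C.complete _ _ _ _ hs, _, C.complete _ _ _ _ hr, rfl, rfl, ?_, ?_, ?_⟩
    · simp [actCode]
    · simp only [pairRule, Rule.guard, List.map_cons, List.map_nil, List.forall_mem_cons]
      exact ⟨C.has_chan_iff.2 ⟨p, q, rfl, rfl, by rw [hce]; rfl⟩, C.has_state_iff.2 ⟨p, rfl, rfl⟩,
        C.has_state_iff.2 ⟨q, rfl, rfl⟩, by simp⟩
    · rw [h']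
      simp [pairRule]

theorem traceMem_mem_of_pair {o o' : Option ((Fin n × Fin n × A) × Fin n)}
    (h : SStep S c [.send p q a, .recv p q a] d) (hw : C.watchVal o = C.watchVal o')
    (ho : o = o' ∨ tokenVal o = [[(p : ℕ)]] ∧ tokenVal o' = [[(q : ℕ)]] ∨
      tokenVal o = [[(q : ℕ)]] ∧ tokenVal o' = [[(p : ℕ)]]) :
    C.traceMem (d, o') ∈ rewrites (rscRules T) (C.traceMem (c, o)) := by
  obtain ⟨e, he, e', he', rfl', rfl'', hc, hg, hf⟩ :=
    C.pair_has (w := C.watchVal o) (t := tokenVal o) h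
  rw [mem_rewrites]
  simp only [rscRules, List.mem_append, pairRules, List.mem_flatMap]
  have htok (v : Val) : Function.update (C.configLayout emptiness d (C.watchVal o) (tokenVal o))
      [3] v = C.configLayout emptiness d (C.watchVal o) v := by
    rw [configLayout, update_layout_token, configLayout]
  rcases ho with rfl | ⟨h₁, h₂⟩ | ⟨h₁, h₂⟩
  · refine ⟨pairRule e e', Or.inl ⟨e, he, e', he', by simp [hc]⟩, ?_, ?_⟩
    · rw [traceMem, cells_has_iff]
      exact hg
    · rw [traceMem, traceMem, apply_cells, hf]
  · refine ⟨pairRule e e' ++ [([3], [[e.1]], [[e'.1]])], Or.inl ⟨e, he, e', he', by simp [hc]⟩,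
      ?_, ?_⟩
    · rw [traceMem, cells_has_iff, Rule.guard, List.map_append]
      simp only [List.forall_mem_append]
      refine ⟨hg, ?_⟩
      simp only [List.map_cons, List.map_nil, List.forall_mem_cons]
      exact ⟨⟨mem_keys_token, by rw [configLayout, layout, h₁, rfl']⟩, by simp⟩
    · rw [traceMem, traceMem, apply_cells, List.foldl_append, hf]
      simp only [List.foldl_cons, List.foldl_nil]
      rw [htok, ← hw, h₂, rfl'']
  · refine ⟨pairRule e e' ++ [([3], [[e'.1]], [[e.1]])], Or.inl ⟨e, he, e', he', by simp [hc]⟩,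
      ?_, ?_⟩
    · rw [traceMem, cells_has_iff, Rule.guard, List.map_append]
      simp only [List.forall_mem_append]
      refine ⟨hg, ?_⟩
      simp only [List.map_cons, List.map_nil, List.forall_mem_cons]
      exact ⟨⟨mem_keys_token, by rw [configLayout, layout, h₁, rfl'']⟩, by simp⟩
    · rw [traceMem, traceMem, apply_cells, List.foldl_append, hf]
      simp only [List.foldl_cons, List.foldl_nil]
      rw [htok, ← hw, h₂, rfl']

theorem traceMem_mem_rewrites {σ σ' : Config S × Option ((Fin n × Fin n × A) × Fin n)}
    (h : TStep S σ σ') : C.traceMem σ' ∈ rewrites (rscRules T) (C.traceMem σ) := by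
  cases h with
  | forward c d p q a w hv => exact C.traceMem_mem_of_pair hv rfl (Or.inr (Or.inl ⟨rfl, rfl⟩))
  | backward c d p q a w hv => exact C.traceMem_mem_of_pair hv rfl (Or.inr (Or.inr ⟨rfl, rfl⟩))
  | start c d p q a hc hs =>
    rw [mem_rewrites]
    have hent := C.complete _ _ _ _ hs.1
    refine ⟨_, List.mem_append_right _ (List.mem_flatMap.2 ⟨_, hent,
      .tail _ (.tail _ (.head _))⟩), ?_, ?_⟩
    · simp only [traceMem, cells_has_iff, Rule.guard, sendRule, List.map_cons,
        List.map_nil, List.cons_append, List.nil_append, List.forall_mem_cons]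
      exact ⟨C.has_state_iff.2 ⟨p, rfl, rfl⟩,
        C.has_chan_iff.2 ⟨p, q, rfl, rfl, by rw [hc]; rfl⟩, ⟨mem_keys_watch, rfl⟩,
        ⟨mem_keys_token, rfl⟩, by simp⟩
    · rw [traceMem, traceMem, apply_cells]
      simp only [sendRule, List.cons_append, List.nil_append, List.foldl_cons, List.foldl_nil,
        Act.actor, actCode]
      have := C.configLayout_send emptiness (C.watchVal none) (tokenVal (n := n) (A := A) none) hs
      rw [hs.2.2.1, emptiness_concat] at this
      rw [← this, configLayout, update_layout_watch, update_layout_token]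
      rfl
  | stay c d v o hv =>
    cases hv with
    | pair _ p q a h₁ h₂ h₃ h₄ h₅ h₆ =>
      exact C.traceMem_mem_of_pair (.pair _ _ p q a h₁ h₂ h₃ h₄ h₅ h₆) rfl (Or.inl rfl)
    | send _ p q a hs =>
      rw [mem_rewrites]
      have hent := C.complete _ _ _ _ hs.1
      refine ⟨sendRule (p.val, C.st p (c.state p), (0, q.val, C.msg a), C.st p (d.state p))
          (emptiness (c.chan p q)), List.mem_append_right _
        (List.mem_flatMap.2 ⟨_, hent, ?_⟩), ?_, ?_⟩
      · rcases c.chan p q with _ | ⟨b, u⟩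
        · exact .head _
        · exact .tail _ (.head _)
      · simp only [traceMem, cells_has_iff, Rule.guard, sendRule, List.map_cons,
          List.map_nil, List.forall_mem_cons]
        exact ⟨C.has_state_iff.2 ⟨p, rfl, rfl⟩, C.has_chan_iff.2 ⟨p, q, rfl, rfl, rfl⟩, by simp⟩
      · rw [traceMem, traceMem, apply_cells, C.configLayout_send _ _ _ hs, hs.2.2.1,
          emptiness_concat]
        rfl
    | internal _ p i hs =>
      rw [mem_rewrites]
      have hent := C.complete _ _ _ _ hs.1
      refine ⟨_, List.mem_append_right _ (List.mem_flatMap.2 ⟨_, hent, .head _⟩), ?_, ?_⟩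
      · simp only [traceMem, cells_has_iff, Rule.guard, List.map_cons,
          List.map_nil, List.forall_mem_cons]
        exact ⟨C.has_state_iff.2 ⟨p, rfl, rfl⟩, by simp⟩
      · rw [traceMem, traceMem, apply_cells, C.configLayout_internal _ _ _ hs]
        rfl

/-- The memory forgets what the channels contain, but a synchronous step asks at most whether a
channel is empty, so each rewriting step lifts to the configuration itself. -/
theorem exists_of_traceMem_rewrites {σ : Config S × Option ((Fin n × Fin n × A) × Fin n)}
    {t : Mem} (h : t ∈ rewrites (rscRules T) (C.traceMem σ)) :
    ∃ σ', TStep S σ σ' ∧ C.traceMem σ' = t := by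
  obtain ⟨c, o⟩ := σ
  obtain ⟨r, hr, hg, rfl⟩ := mem_rewrites.1 h
  rw [traceMem, cells_has_iff] at hg
  rw [traceMem, apply_cells]
  rcases List.mem_append.1 hr with hr | hr
  · simp only [pairRules, List.mem_flatMap] at hr
    obtain ⟨⟨i, s, ⟨x, j, m⟩, s'⟩, he, ⟨j', t, y, t'⟩, he', hr⟩ := hr
    by_cases hcond : (decide (x = 0) && (decide (j = j') && decide (y = (1, i, m)))) = true
    swap
    · rw [Bool.not_eq_true] at hcond
      simp [hcond] at hr
    simp only [hcond, cond_true] at hr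
    obtain ⟨rfl, rfl, rfl⟩ : x = 0 ∧ j = j' ∧ y = (1, i, m) := by simpa using hcond
    -- The guards shared by all three variants suffice to identify the exchange.
    have hsub : ∃ ρ, r = pairRule (i, s, (0, j, m), s') (j, t, (1, i, m), t') ++ ρ := by
      simp only [List.mem_cons, List.not_mem_nil, or_false] at hr
      rcases hr with rfl | rfl | rfl
      · exact ⟨[], (List.append_nil _).symm⟩
      · exact ⟨_, rfl⟩
      · exact ⟨_, rfl⟩
    have hg' : ∀ x ∈ (pairRule (i, s, (0, j, m), s') (j, t, (1, i, m), t')).guard, x.1 ∈ keys n ∧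
        C.configLayout emptiness c (C.watchVal o) (tokenVal o) x.1 = x.2 := by
      obtain ⟨ρ, rfl⟩ := hsub
      intro x hx
      refine hg x ?_
      rw [Rule.guard, List.map_append]
      exact List.mem_append_left _ hx
    simp only [pairRule, Rule.guard, List.map_cons, List.map_nil, List.forall_mem_cons] at hg'
    obtain ⟨hg₁, hg₂, hg₃, -⟩ := hg'
    obtain ⟨p, rfl, rfl⟩ := C.has_state_iff.1 hg₂
    obtain ⟨q, rfl, rfl⟩ := C.has_state_iff.1 hg₃
    obtain ⟨p', q', hp', hq', hce⟩ := C.has_chan_iff.1 hg₁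
    obtain rfl : p = p' := Fin.ext hp'
    obtain rfl : q = q' := Fin.ext hq'
    rw [emptiness_eq_nil] at hce
    obtain ⟨q', a, s', hq', rfl, rfl, hs⟩ := C.sound_send he
    obtain rfl : q = q' := Fin.ext hq'
    obtain ⟨p', a', t', hp', ha', rfl, ht⟩ := C.sound_recv he'
    obtain rfl : p = p' := Fin.ext hp'
    obtain rfl := C.msg_inj ha'
    obtain ⟨d, hd, rfl, rfl⟩ := exists_sstep_pair hce hs ht
    have hf : (pairRule (p.val, C.st p (c.state p), (0, q.val, C.msg a), C.st p (d.state p))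
        (q.val, C.st q (c.state q), (1, p.val, C.msg a), C.st q (d.state q))).foldl
        (fun f c => Function.update f c.1 c.2.2)
        (C.configLayout emptiness c (C.watchVal o) (tokenVal o)) =
        C.configLayout emptiness d (C.watchVal o) (tokenVal o) := by
      rw [C.configLayout_pair emptiness _ _ rfl hd]
      simp [pairRule]
    have htok (v : Val) : Function.update (C.configLayout emptiness d (C.watchVal o) (tokenVal o))
        [3] v = C.configLayout emptiness d (C.watchVal o) v := by
      rw [configLayout, update_layout_token, configLayout]
    simp only [List.mem_cons, List.not_mem_nil, or_false] at hr
    rcases hr with rfl | rfl | rfl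
    · exact ⟨(d, o), .stay _ _ _ _ hd, by rw [traceMem, hf]⟩
    · have := (hg ([3], [[p.val]]) (by simp [Rule.guard])).2
      obtain ⟨w, rfl⟩ := tokenVal_eq_iff.1 this
      refine ⟨(d, some (w, q)), .forward _ _ _ _ _ _ hd, ?_⟩
      rw [List.foldl_append, hf, List.foldl_cons, List.foldl_nil, htok]
      rfl
    · have := (hg ([3], [[q.val]]) (by simp [Rule.guard])).2
      obtain ⟨w, rfl⟩ := tokenVal_eq_iff.1 this
      refine ⟨(d, some (w, p)), .backward _ _ _ _ _ _ hd, ?_⟩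
      rw [List.foldl_append, hf, List.foldl_cons, List.foldl_nil, htok]
      rfl
  · obtain ⟨⟨i, s, ⟨x, j, m⟩, s'⟩, he, hr⟩ := List.mem_flatMap.1 hr
    by_cases h₀ : x = 0
    · subst h₀
      simp only [decide_true, cond_true] at hr
      have hsub : ∃ v ρ, r = sendRule (i, s, (0, j, m), s') v ++ ρ := by
        simp only [List.mem_cons, List.not_mem_nil, or_false] at hr
        rcases hr with rfl | rfl | rfl
        · exact ⟨_, [], (List.append_nil _).symm⟩
        · exact ⟨_, [], (List.append_nil _).symm⟩
        · exact ⟨_, _, rfl⟩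
      obtain ⟨v, hg'⟩ : ∃ v, ∀ x ∈ (sendRule (i, s, (0, j, m), s') v).guard, x.1 ∈ keys n ∧
          C.configLayout emptiness c (C.watchVal o) (tokenVal o) x.1 = x.2 := by
        obtain ⟨v, ρ, rfl⟩ := hsub
        refine ⟨v, fun x hx => hg x ?_⟩
        rw [Rule.guard, List.map_append]
        exact List.mem_append_left _ hx
      simp only [sendRule, Rule.guard, List.map_cons, List.map_nil, List.forall_mem_cons] at hg'
      obtain ⟨p, rfl, rfl⟩ := C.has_state_iff.1 hg'.1
      obtain ⟨q, a, s', rfl, rfl, rfl, hs⟩ := C.sound_send he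
      obtain ⟨d, hd, rfl⟩ := exists_step_send hs
      have hf (v : Val) : (sendRule (p.val, C.st p (c.state p), (0, q.val, C.msg a),
          C.st p (d.state p)) v).foldl (fun f c => Function.update f c.1 c.2.2)
          (C.configLayout emptiness c (C.watchVal o) (tokenVal o)) =
          C.configLayout emptiness d (C.watchVal o) (tokenVal o) := by
        rw [C.configLayout_send emptiness _ _ hd, hd.2.2.1, emptiness_concat]
        rfl
      simp only [List.mem_cons, List.not_mem_nil, or_false] at hr
      rcases hr with rfl | rfl | rfl
      · exact ⟨(d, o), .stay _ _ _ _ (.send _ _ _ _ _ hd), by rw [traceMem, hf]⟩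
      · exact ⟨(d, o), .stay _ _ _ _ (.send _ _ _ _ _ hd), by rw [traceMem, hf]⟩
      · obtain rfl : o = none := by
          have := (hg ([3], []) (by simp [Rule.guard])).2
          rcases o with _ | ⟨w, x⟩
          · rfl
          · simp [configLayout, layout, tokenVal] at this
        have hce : c.chan p q = [] := by
          have := hg ([1, p, q], []) (by simp [Rule.guard, sendRule])
          obtain ⟨p', q', hp', hq', hce⟩ := C.has_chan_iff.1 this
          obtain rfl : p = p' := Fin.ext hp'
          obtain rfl : q = q' := Fin.ext hq'
          exact emptiness_eq_nil.1 hce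
        refine ⟨(d, some ((p, q, a), p)), .start _ _ _ _ _ hce hd, ?_⟩
        rw [List.foldl_append, hf]
        simp only [List.foldl_cons, List.foldl_nil]
        rw [configLayout, update_layout_watch, update_layout_token]
        rfl
    · by_cases h₁ : x = 1
      · subst h₁
        simp at hr
      · simp only [h₀, h₁, decide_false, cond_false, List.mem_singleton] at hr
        subst hr
        simp only [Rule.guard, List.map_cons, List.map_nil, List.forall_mem_cons] at hg
        obtain ⟨p, rfl, rfl⟩ := C.has_state_iff.1 hg.1
        obtain ⟨i, s', rfl, hs⟩ := C.sound_internal he h₀ h₁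
        obtain ⟨d, hd, rfl⟩ := exists_step_internal hs
        refine ⟨(d, o), .stay _ _ _ _ (.internal _ _ _ _ hd), ?_⟩
        rw [traceMem, C.configLayout_internal _ _ _ hd]
        rfl

/-- `traceMem` is a functional bisimulation from `TStep` to rewriting, and the impossible
obligations say that no violation is ever completed. -/
theorem isRSC_iff : S.IsRSC ↔
    ∀ c, ReflTransGen (fun s s' => s' ∈ rewrites (rscRules T) s) (initMem T) c →
      ∀ o ∈ rscObligations T, c.has o.1 = true →
        ∃ d, ReflTransGen (fun s s' => s' ∈ rewrites (rscRules T) s) c d ∧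
          ∃ g ∈ o.2, d.has g = true := by
  rw [FIFOSystem.isRSC_iff, hasViolation_iff, C.initMem_eq_cells emptiness rfl]
  have hreach (t : Mem) : ReflTransGen (fun s s' => s' ∈ rewrites (rscRules T) s)
      (C.traceMem (initConfig S, none)) t ↔
      ∃ σ, True ∧ ReflTransGen (TStep S) (initConfig S, none) σ ∧ C.traceMem σ = t :=
    reflTransGen_iff_of_bisim (f := C.traceMem) (R := TStep S)
      (R' := fun s s' => s' ∈ rewrites (rscRules T) s) (I := fun _ => True) (fun _ _ _ _ => trivial)
      (fun _ _ _ h => C.traceMem_mem_rewrites h)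
      (fun _ _ _ h => C.exists_of_traceMem_rewrites h) trivial
  constructor
  · intro h t ht o ho hto
    obtain ⟨⟨c, o'⟩, -, hc, rfl⟩ := (hreach t).1 ht
    simp only [rscObligations, List.mem_flatMap] at ho
    obtain ⟨⟨i, s, ⟨x, j, m⟩, s'⟩, he, ho⟩ := ho
    by_cases h₁ : x = 1
    swap
    · simp [h₁] at ho
    simp only [h₁, decide_true, cond_true, List.mem_singleton] at ho
    subst ho
    subst h₁
    simp only [traceMem, cells_has_iff, List.forall_mem_cons] at hto
    obtain ⟨h₁, h₂, h₃, -⟩ := hto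
    obtain ⟨q, rfl, rfl⟩ := C.has_state_iff.1 h₁
    obtain ⟨p, a, s', rfl, rfl, rfl, hs⟩ := C.sound_recv he
    obtain ⟨w, rfl⟩ := tokenVal_eq_iff.1 h₃.2
    obtain ⟨p', q', a'⟩ := w
    obtain ⟨hp, hq, ha⟩ : (p' : ℕ) = p ∧ (q' : ℕ) = q ∧ C.msg a' = C.msg a := by
      simpa [configLayout, layout, watchVal] using h₂.2
    obtain rfl := Fin.ext hp
    obtain rfl := Fin.ext hq
    obtain rfl := C.msg_inj ha
    exact absurd ⟨c, p', q', a', s', hc, hs⟩ h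
  · rintro H ⟨c, p, q, m, s, hc, hs⟩
    obtain ⟨d, -, g, hg, -⟩ := H _ ((hreach _).2 ⟨_, trivial, hc, rfl⟩)
      ([([0, q.val], [C.st q (c.state q)]), ([2], [[p.val], [q.val], C.msg m]), ([3], [[q.val]])],
        [])
      (List.mem_flatMap.2 ⟨_, C.complete _ _ _ _ hs, .head _⟩)
      (by
        simp only [traceMem, cells_has_iff, List.forall_mem_cons]
        exact ⟨C.has_state_iff.2 ⟨q, rfl, rfl⟩, ⟨mem_keys_watch, rfl⟩, ⟨mem_keys_token, rfl⟩,
          by simp⟩)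
    simp at hg

end Coding

section Primrec

variable {α : Type} [Primcodable α]

@[fun_prop]
theorem primrec_pairRule {e e' : α → Entry} (he : Primrec e) (he' : Primrec e') :
    Primrec fun x => pairRule (e x) (e' x) := by
  unfold pairRule
  fun_prop

@[fun_prop]
theorem primrec_pairRules {T : α → Table} (hT : Primrec T) :
    Primrec fun x => pairRules (T x) := by
  unfold pairRules
  fun_prop

@[fun_prop]
theorem primrec_sendRule {e : α → Entry} {v : α → Val} (he : Primrec e) (hv : Primrec v) :
    Primrec fun x => sendRule (e x) (v x) := by
  unfold sendRule
  fun_prop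

@[fun_prop]
theorem primrec_singleRules {T : α → Table} (hT : Primrec T) :
    Primrec fun x => singleRules (T x) := by
  unfold singleRules
  fun_prop

@[fun_prop]
theorem primrec_rscObligations {T : α → Table} (hT : Primrec T) :
    Primrec fun x => rscObligations (T x) := by
  unfold rscObligations
  fun_prop

end Primrec

/-- For tables it is decidable whether the system is RSC. -/
theorem exists_computable_isRSC : ∃ f : Table → Bool, Computable f ∧
    ∀ (n : ℕ) (A : Type) (S : FIFOSystem (Fin n) A) (T : Table), Coding S T →
      (f T = true ↔ S.IsRSC) := by
  obtain ⟨f, hf, h⟩ := exists_computable_rewriting (α := Table)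
    (init := fun x => initMem x) (rules := fun x => pairRules x ++ singleRules x)
    (obl := fun x => rscObligations x) (by fun_prop) (by fun_prop) (by fun_prop)
  exact ⟨f, hf, fun n A S T C => (h T).trans C.isRSC_iff.symm⟩

end CrashStop

namespace CrashStop

namespace LocalType

variable {P : Type}

/-! ### Subterms and targets -/

mutual
theorem subterms_subset : ∀ {T U : LocalType P}, T ∈ U.subterms → T.subterms ⊆ U.subterms
  | T, branch q bs, h => by
    rcases List.mem_cons.1 h with rfl | h
    · exact fun _ h => h
    · exact List.subset_cons_of_subset _ (subterms_subset_subtermsL h)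
  | T, select q bs, h => by
    rcases List.mem_cons.1 h with rfl | h
    · exact fun _ h => h
    · exact List.subset_cons_of_subset _ (subterms_subset_subtermsL h)
  | T, mu t U, h => by
    rcases List.mem_cons.1 h with rfl | h
    · exact fun _ h => h
    · exact List.subset_cons_of_subset _ (subterms_subset h)
  | T, var t, h => by rw [List.mem_singleton.1 h]; exact fun _ h => h
  | T, finished, h => by rw [List.mem_singleton.1 h]; exact fun _ h => h
  | T, crashed, h => by rw [List.mem_singleton.1 h]; exact fun _ h => h
theorem subterms_subset_subtermsL : ∀ {T : LocalType P} {bs : List (Label × LocalType P)},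
    T ∈ subtermsL bs → T.subterms ⊆ subtermsL bs
  | T, (l, U) :: bs, h => by
    rcases List.mem_append.1 h with h | h
    · exact List.subset_append_of_subset_left _ (subterms_subset h)
    · exact List.subset_append_of_subset_right _ (subterms_subset_subtermsL h)
end

theorem mem_subtermsL {l : Label} {T : LocalType P} {bs : List (Label × LocalType P)}
    (h : (l, T) ∈ bs) : T ∈ subtermsL bs := by
  induction bs with
  | nil => simp at h
  | cons b bs ih =>
    rcases List.mem_cons.1 h with rfl | h
    · exact List.mem_append_left _ (self_mem_subterms T)
    · exact List.mem_append_right _ (ih h)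

theorem mem_subterms_of_branch {T₀ T : LocalType P} {q : P} {l : Label}
    {bs : List (Label × LocalType P)} (h : branch q bs ∈ T₀.subterms) (hT : (l, T) ∈ bs) :
    T ∈ T₀.subterms :=
  subterms_subset h (List.mem_cons_of_mem _ (mem_subtermsL hT))

theorem mem_subterms_of_select {T₀ T : LocalType P} {q : P} {l : Label}
    {bs : List (Label × LocalType P)} (h : select q bs ∈ T₀.subterms) (hT : (l, T) ∈ bs) :
    T ∈ T₀.subterms :=
  subterms_subset h (List.mem_cons_of_mem _ (mem_subtermsL hT))

mutual
-- The list of admissible variables grows only on passing under a recursion, so a variable outside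
-- the original list has its recursion inside the type.
theorem exists_mu_of_closedIn {t : ℕ} : ∀ {ts : List ℕ} {T : LocalType P}, ClosedIn ts T →
    var t ∈ T.subterms → t ∈ ts ∨ ∃ U, mu t U ∈ T.subterms
  | ts, branch q bs, hc, h => by
    rcases List.mem_cons.1 h with h | h
    · cases h
    · exact (exists_mu_of_closedInL hc h).imp_right fun ⟨U, hU⟩ => ⟨U, List.mem_cons_of_mem _ hU⟩
  | ts, select q bs, hc, h => by
    rcases List.mem_cons.1 h with h | h
    · cases h
    · exact (exists_mu_of_closedInL hc h).imp_right fun ⟨U, hU⟩ => ⟨U, List.mem_cons_of_mem _ hU⟩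
  | ts, mu s T, hc, h => by
    rcases List.mem_cons.1 h with h | h
    · cases h
    · rcases exists_mu_of_closedIn (ts := s :: ts) hc h with ht | ⟨U, hU⟩
      · rcases List.mem_cons.1 ht with rfl | ht
        · exact Or.inr ⟨T, List.mem_cons_self ..⟩
        · exact Or.inl ht
      · exact Or.inr ⟨U, List.mem_cons_of_mem _ hU⟩
  | ts, var s, hc, h => by
    cases List.mem_singleton.1 h
    exact Or.inl hc
  | ts, finished, hc, h => by cases List.mem_singleton.1 h
  | ts, crashed, hc, h => by cases List.mem_singleton.1 h
theorem exists_mu_of_closedInL {t : ℕ} : ∀ {ts : List ℕ} {bs : List (Label × LocalType P)},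
    ClosedInL ts bs → var t ∈ subtermsL bs → t ∈ ts ∨ ∃ U, mu t U ∈ subtermsL bs
  | ts, (l, T) :: bs, hc, h => by
    rcases List.mem_append.1 h with h | h
    · exact (exists_mu_of_closedIn hc.1 h).imp_right
        fun ⟨U, hU⟩ => ⟨U, List.mem_append_left _ hU⟩
    · exact (exists_mu_of_closedInL hc.2 h).imp_right
        fun ⟨U, hU⟩ => ⟨U, List.mem_append_right _ hU⟩
end

mutual
theorem mem_binders {t : ℕ} {U : LocalType P} : ∀ {T : LocalType P},
    mu t U ∈ T.subterms → t ∈ T.binders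
  | branch q bs, h => by
    rcases List.mem_cons.1 h with h | h
    · cases h
    · exact mem_bindersL h
  | select q bs, h => by
    rcases List.mem_cons.1 h with h | h
    · cases h
    · exact mem_bindersL h
  | mu s T, h => by
    rcases List.mem_cons.1 h with h | h
    · cases h
      exact List.mem_cons_self ..
    · exact List.mem_cons_of_mem _ (mem_binders h)
  | var s, h => by cases List.mem_singleton.1 h
  | finished, h => by cases List.mem_singleton.1 h
  | crashed, h => by cases List.mem_singleton.1 h
theorem mem_bindersL {t : ℕ} {U : LocalType P} : ∀ {bs : List (Label × LocalType P)},
    mu t U ∈ subtermsL bs → t ∈ bindersL bs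
  | (l, T) :: bs, h => by
    rcases List.mem_append.1 h with h | h
    · exact List.mem_append_left _ (mem_binders h)
    · exact List.mem_append_right _ (mem_bindersL h)
end

mutual
-- `binders` counts with multiplicity, so two recursions on one variable at different places would
-- give a repetition. Hence the continuation of a variable is well defined.
theorem mu_unique {t : ℕ} {U V : LocalType P} : ∀ {T : LocalType P}, T.binders.Nodup →
    mu t U ∈ T.subterms → mu t V ∈ T.subterms → U = V
  | branch q bs, hn, hU, hV => by
    rcases List.mem_cons.1 hU with hU | hU
    · cases hU
    rcases List.mem_cons.1 hV with hV | hV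
    · cases hV
    exact mu_uniqueL hn hU hV
  | select q bs, hn, hU, hV => by
    rcases List.mem_cons.1 hU with hU | hU
    · cases hU
    rcases List.mem_cons.1 hV with hV | hV
    · cases hV
    exact mu_uniqueL hn hU hV
  | mu s T, hn, hU, hV => by
    obtain ⟨hs, hn⟩ := List.nodup_cons.1 hn
    rcases List.mem_cons.1 hU with hU' | hU' <;> rcases List.mem_cons.1 hV with hV' | hV'
    · cases hU'; cases hV'; rfl
    · cases hU'; exact absurd (mem_binders hV') hs
    · cases hV'; exact absurd (mem_binders hU') hs
    · exact mu_unique hn hU' hV'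
  | var s, hn, hU, hV => by cases List.mem_singleton.1 hU
  | finished, hn, hU, hV => by cases List.mem_singleton.1 hU
  | crashed, hn, hU, hV => by cases List.mem_singleton.1 hU
theorem mu_uniqueL {t : ℕ} {U V : LocalType P} : ∀ {bs : List (Label × LocalType P)},
    (bindersL bs).Nodup → mu t U ∈ subtermsL bs → mu t V ∈ subtermsL bs → U = V
  | (l, T) :: bs, hn, hU, hV => by
    obtain ⟨h₁, h₂, hd⟩ := List.nodup_append.1 hn
    rcases List.mem_append.1 hU with hU | hU <;> rcases List.mem_append.1 hV with hV | hV
    · exact mu_unique h₁ hU hV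
    · exact absurd rfl (hd _ (mem_binders hU) _ (mem_bindersL hV))
    · exact absurd rfl (hd _ (mem_binders hV) _ (mem_bindersL hU))
    · exact mu_uniqueL h₂ hU hV
end

namespace WellFormed

variable {p : P} {T₀ T T' T'' : LocalType P}

theorem target_unique (h : WellFormed p T₀) (h₁ : Target T₀ T T') (h₂ : Target T₀ T T'') :
    T' = T'' := by
  cases h₁ with
  | direct _ hT =>
    cases h₂ with
    | direct => rfl
    | loop => exact absurd trivial hT
  | loop t U hU =>
    cases h₂ with
    | direct _ hT => exact absurd trivial hT
    | loop _ V hV => rw [mu_unique h.unique hU hV]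

theorem exists_target (h : WellFormed p T₀) (hT : T ∈ T₀.subterms) : ∃ T', Target T₀ T T' := by
  by_cases hv : T.IsVar
  · cases T with
    | var t =>
      obtain ht | ⟨U, hU⟩ := exists_mu_of_closedIn h.closed hT
      · simp at ht
      · exact ⟨_, .loop t U hU⟩
    | _ => exact hv.elim
  · exact ⟨_, .direct T hv⟩

/-- Guardedness prevents the removal of recursions from ending in a variable. -/
theorem isState_of_target (h : WellFormed p T₀) (hT : T ∈ T₀.subterms) (ht : Target T₀ T T') :
    IsState p T₀ (.ty T') := by
  cases ht with
  | direct _ hv =>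
    refine Or.inl ⟨subterms_subset hT (strip_mem_subterms T), ?_, strip_not_mu T⟩
    cases T with
    | mu t U => exact h.guarded t U hT
    | _ => exact hv
  | loop t U hU =>
    exact Or.inl ⟨subterms_subset hU (List.mem_cons_of_mem _ (strip_mem_subterms U)),
      h.guarded t U hU, strip_not_mu U⟩

end WellFormed

/-! ### The crash broadcast -/

theorem castSource_succ {order : List P} {i : ℕ} {r : P} (h : order[i]? = some r) :
    castSource order (i + 1) = .sent r := by
  simp [castSource, h]

/-- As the order has no repetitions, a broadcast state determines the index of the message to be
sent from it, so the broadcast is deterministic. -/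
theorem castSource_inj {order : List P} (hn : order.Nodup) {i j : ℕ} (hi : i < order.length)
    (hj : j < order.length) (h : castSource order i = castSource order j) : i = j := by
  rcases i with _ | i <;> rcases j with _ | j
  · rfl
  · rw [castSource_succ (List.getElem?_eq_getElem (Nat.lt_of_succ_lt hj))] at h
    cases h
  · rw [castSource_succ (List.getElem?_eq_getElem (Nat.lt_of_succ_lt hi))] at h
    cases h
  · rw [castSource_succ (List.getElem?_eq_getElem (Nat.lt_of_succ_lt hi)),
      castSource_succ (List.getElem?_eq_getElem (Nat.lt_of_succ_lt hj))] at h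
    rw [(List.Nodup.getElem_inj_iff hn).1 (TState.sent.inj h)]

theorem isState_castSource {p : P} {order : List P} (hord : ∀ r, r ∈ order ↔ r ≠ p)
    (T₀ : LocalType P) {i : ℕ} : IsState p T₀ (castSource order i) := by
  rcases i with _ | i
  · trivial
  · rcases h : order[i]? with _ | r
    · simp [castSource, h, IsState]
    · rw [castSource_succ h]
      exact (hord r).1 (List.mem_of_getElem? h)

theorem isState_castTarget {p : P} {order : List P} (hord : ∀ r, r ∈ order ↔ r ≠ p)
    (T₀ : LocalType P) {i : ℕ} : IsState p T₀ (castTarget order i) := by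
  unfold castTarget
  split
  · exact Or.inr rfl
  · exact isState_castSource hord T₀

theorem Trans.isState {p : P} {rel : Finset P} {order : List P} {T₀ : LocalType P}
    {s s' : TState P} {a : Act P (CMsg Payload)} (h : WellFormed p T₀)
    (hord : ∀ r, r ∈ order ↔ r ≠ p) (hs : IsState p T₀ s) (ht : Trans p rel order T₀ s a s') :
    IsState p T₀ s' := by
  cases ht with
  | recv q bs l B T T' h₁ h₂ h₃ => exact h.isState_of_target (mem_subterms_of_branch h₁ h₂) h₃
  | send q bs l B T T' h₁ h₂ h₃ => exact h.isState_of_target (mem_subterms_of_select h₁ h₂) h₃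
  | handle q bs T T' h₁ h₂ h₃ => exact h.isState_of_target (mem_subterms_of_branch h₁ h₂) h₃
  | crash T _ _ _ => trivial
  | cast T i r _ _ _ _ => exact isState_castTarget hord T₀
  | drain T q _ _ => exact hs

theorem Trans.eq_sink {p : P} {rel : Finset P} {order : List P} {T₀ : LocalType P}
    {s s' : TState P} (h : Trans p rel order T₀ s (.internal p .crash) s') : s' = .sink := by
  cases h
  rfl

theorem Trans.of_recv_crash {p q : P} {rel : Finset P} {order : List P} {T₀ : LocalType P}
    {s s' : TState P} (h : Trans p rel order T₀ s (.recv q p .crash) s') :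
    (∃ bs T T', s = .ty (branch q bs) ∧ s' = .ty T' ∧ (.crash, T) ∈ bs ∧ Target T₀ T T') ∨
      ∃ T, s = .ty T ∧ T.IsSink := by
  cases h with
  | handle q bs T T' h₁ h₂ h₃ => exact Or.inl ⟨bs, T, T', rfl, rfl, h₂, h₃⟩
  | drain T q h₁ _ => exact Or.inr ⟨T, rfl, h₁⟩

/-! ### Crash handling of the generated automata -/

/-- The states of `Q₁`. -/
def choiceStates (p : P) (T₀ : LocalType P) : Set {s // IsState p T₀ s} :=
  {s | ∃ T, s.1 = .ty T ∧ T.IsChoice}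

/-- The states of `Q₂`. -/
def sinkStates (p : P) (T₀ : LocalType P) : Set {s // IsState p T₀ s} :=
  {s | ∃ T, s.1 = .ty T ∧ T.IsSink}

/-- The states of `Q₃`. -/
def castStates (p : P) (T₀ : LocalType P) : Set {s // IsState p T₀ s} :=
  {s | ∀ T, s.1 ≠ .ty T}

theorem isChoice_or_isSink {p : P} {T₀ T : LocalType P} (h : IsState p T₀ (.ty T)) :
    T.IsChoice ∨ T.IsSink := by
  rcases h with ⟨-, hv, hm⟩ | rfl
  · cases T <;> simp_all [IsVar, IsMu, IsChoice, IsSink]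
  · exact Or.inr trivial

theorem not_isSink_of_isChoice {T : LocalType P} (h : T.IsChoice) : ¬ T.IsSink := by
  cases T <;> simp_all [IsChoice, IsSink]

theorem not_isVar_of_isChoice {T : LocalType P} (h : T.IsChoice) : ¬ T.IsVar ∧ ¬ T.IsMu := by
  cases T <;> simp_all [IsChoice, IsVar, IsMu]

theorem castSource_mem_castStates {p : P} {order : List P} {T₀ : LocalType P} {i : ℕ}
    (h : IsState p T₀ (castSource order i)) : ⟨_, h⟩ ∈ castStates p T₀ := by
  intro T hT
  rcases i with _ | i
  · cases hT
  · rcases h : order[i]? with _ | r <;> simp [castSource, h] at hT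

section Automaton

variable {p : P} {rel : Finset P} {order : List P} {T₀ : LocalType P}

/-- The transitions that are no data actions. -/
def crashTrans (p : P) (rel : Finset P) (order : List P) (T₀ : LocalType P) :
    Set ({s // IsState p T₀ s} × Act P (CMsg Payload) × {s // IsState p T₀ s}) :=
  {x | Trans p rel order T₀ x.1.1 x.2.1 x.2.2.1 ∧ ¬ x.2.1.IsData}

/-- The path follows the `cast` transitions through the rest of the order. The list is non-empty
because an empty path would have to start in `Q₂`, where no broadcast source lies. -/
theorem exists_broadcastPath (hord : ∀ r, r ∈ order ↔ r ≠ p) {T : LocalType P} (hp : p ∉ rel)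
    (hT : T ∈ T₀.subterms)
    (hc : T.IsChoice) (l : List P) (r : P) (i : ℕ) (hl : order.drop i = r :: l)
    (hs : IsState p T₀ (castSource order i)) :
    BroadcastPath p (sinkStates p T₀) (castStates p T₀) (crashTrans p rel order T₀) (r :: l)
      ⟨castSource order i, hs⟩ := by
  induction l generalizing r i with
  | nil =>
    have hr : order[i]? = some r := by
      rw [← List.head?_drop, hl]; rfl
    have hlen : i + 1 = order.length := by
      have := congrArg List.length hl
      simp at this
      omega
    refine ⟨castSource_mem_castStates hs, ⟨_, isState_castTarget hord T₀ (i := i)⟩,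
      ⟨.cast T i r hp hT hc hr, id⟩, crashed, ?_, trivial⟩
    simp [castTarget, hlen]
  | cons r' l ih =>
    have hr : order[i]? = some r := by
      rw [← List.head?_drop, hl]; rfl
    have hlen : i + 1 ≠ order.length := by
      have := congrArg List.length hl
      simp at this
      omega
    have ht : castTarget order i = castSource order (i + 1) := if_neg hlen
    refine ⟨castSource_mem_castStates hs, ⟨_, isState_castSource hord T₀ (i := i + 1)⟩,
      ⟨?_, id⟩, ih r' (i + 1) ?_ _⟩
    · have := Trans.cast T i r hp hT hc hr
      rwa [ht] at this
    · rw [← List.drop_drop, hl]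
      rfl

/-- From each broadcast state only one crash message can be sent, and none of these states is in
`Q₂`. So a broadcast path inside the crash transitions cannot stop early, and it uses every `cast`
transition from its starting index on. -/
theorem cast_mem_of_broadcastPath (hn : order.Nodup)
    {δ : Set ({s // IsState p T₀ s} × Act P (CMsg Payload) × {s // IsState p T₀ s})}
    (hδ : δ ⊆ crashTrans p rel order T₀) {j : ℕ} {r : P} (hj : order[j]? = some r)
    {s s' : {s // IsState p T₀ s}} (hs : s.1 = castSource order j)
    (hs' : s'.1 = castTarget order j)
    (rs : List P) (i : ℕ) (hi : i ≤ j) (u : {s // IsState p T₀ s}) (hu : u.1 = castSource order i)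
    (hb : BroadcastPath p (sinkStates p T₀) (castStates p T₀) δ rs u) :
    (s, .send p r .crash, s') ∈ δ := by
  have hjl : j < order.length := (List.getElem?_eq_some_iff.1 hj).1
  induction rs generalizing i u with
  | nil =>
    obtain ⟨T, hT, -⟩ := hb
    obtain ⟨u, hu'⟩ := u
    subst hu
    exact absurd hT (castSource_mem_castStates hu' T)
  | cons r' rs ih =>
    obtain ⟨-, u', hm, hb⟩ := hb
    obtain ⟨ht, -⟩ := hδ hm
    generalize hu₁ : u.1 = x at ht
    generalize hu₂ : u'.1 = y at ht
    generalize ha : Act.send p r' CMsg.crash = a at ht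
    cases ht with
    | cast T i' r'' _ _ _ hr =>
      obtain ⟨-, rfl⟩ : p = p ∧ r' = r'' := by cases ha; exact ⟨rfl, rfl⟩
      obtain rfl : i = i' := castSource_inj hn (by omega) (List.getElem?_eq_some_iff.1 hr).1
        (hu ▸ hu₁)
      rcases hi.eq_or_lt with rfl | hi
      · obtain rfl : r' = r := Option.some.inj (hr ▸ hj)
        obtain rfl : u = s := Subtype.ext (hu.trans hs.symm)
        obtain rfl : u' = s' := Subtype.ext (hu₂.trans hs'.symm)
        exact hm
      · refine ih (i + 1) hi u' ?_ hb
        rw [hu₂, castTarget, if_neg (by omega)]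
    | _ => cases ha

/-- For minimality, each transition that is not a data action is forced: handling branches by crash
handling, the crash itself because it can lead only to the sink, the broadcast because it is
deterministic, and the loops because redundancy names them. -/
theorem isCrashHandling [Finite P] (hn : order.Nodup) (hord : ∀ r, r ∈ order ↔ r ≠ p)
    (h : WellFormed p T₀)
    (haware : ∀ q bs, branch q bs ∈ T₀.subterms → ((∃ b ∈ bs, b.1 = .crash) ↔ q ∉ rel)) :
    (toAutomaton p rel order hord T₀ h).IsCrashHandling rel := by
  have hcases (s : {s // IsState p T₀ s}) :
      s ∈ choiceStates p T₀ ∨ s ∈ sinkStates p T₀ ∨ s ∈ castStates p T₀ := by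
    by_cases hs : ∃ T, s.1 = .ty T
    · obtain ⟨T, hT⟩ := hs
      exact (isChoice_or_isSink (hT ▸ s.2)).imp (fun h => ⟨T, hT, h⟩)
        fun h => Or.inl ⟨T, hT, h⟩
    · exact Or.inr (Or.inr fun T hT => hs ⟨T, hT⟩)
  have hstate {T : LocalType P} (hT : IsState p T₀ (.ty T)) :
      (⟨.ty T, hT⟩ : {s // IsState p T₀ s}) ∈ choiceStates p T₀ ∪ sinkStates p T₀ :=
    (isChoice_or_isSink hT).imp (fun h => ⟨T, rfl, h⟩) fun h => ⟨T, rfl, h⟩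
  have hmem {T : LocalType P} (hT : IsState p T₀ (.ty T)) (hc : T.IsChoice) :
      T ∈ T₀.subterms := by
    rcases hT with hT | rfl
    · exact hT.1
    · exact hc.elim
  refine ⟨choiceStates p T₀, sinkStates p T₀, castStates p T₀,
    {x | Trans p rel order T₀ x.1.1 x.2.1 x.2.2.1 ∧ x.2.1.IsData}, crashTrans p rel order T₀,
    ?_, ?_, ?_, ?_, ?_, ?_, ?_, fun _ _ _ h => h.2, ⟨⟨?_, ?_, ?_⟩, ?_⟩⟩
  · exact Set.eq_univ_of_forall fun s => or_assoc.2 (hcases s)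
  · refine Set.disjoint_left.2 ?_
    rintro s ⟨T, hT, hc⟩ ⟨U, hU, hk⟩
    cases hT.symm.trans hU
    exact not_isSink_of_isChoice hc hk
  · exact Set.disjoint_left.2 fun s ⟨T, hT, _⟩ hk => hk T hT
  · exact Set.disjoint_left.2 fun s ⟨T, hT, _⟩ hk => hk T hT
  · ext x
    exact ⟨fun hx => hx.elim And.left And.left, fun hx => (em x.2.1.IsData).imp (⟨hx, ·⟩) (⟨hx, ·⟩)⟩
  · exact Set.disjoint_left.2 fun x hx hx' => hx'.2 hx.2
  · rintro ⟨s, hs⟩ a ⟨s', hs'⟩ ⟨ht, hd⟩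
    dsimp only at ht hd
    cases ht with
    | recv q bs l B T T' h₁ h₂ h₃ => exact ⟨⟨_, rfl, trivial⟩, hd, hstate hs'⟩
    | send q bs l B T T' h₁ h₂ h₃ => exact ⟨⟨_, rfl, trivial⟩, hd, hstate hs'⟩
    | _ => exact hd.elim
  · rintro ⟨s, hs⟩ r m ⟨s', hs'⟩ ⟨ht, hd⟩ hr
    dsimp only at ht
    generalize ha : Act.recv r p (CMsg.data m) = a at ht
    cases ht with
    | recv q bs l B T T' h₁ h₂ h₃ =>
      cases ha
      obtain ⟨⟨_, U⟩, hU, rfl⟩ := (haware r bs h₁).2 hr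
      obtain ⟨U', hU'⟩ := h.exists_target (mem_subterms_of_branch h₁ hU)
      have hs'' := h.isState_of_target (mem_subterms_of_branch h₁ hU) hU'
      exact ⟨⟨_, hs''⟩, hstate hs'', .handle r bs U U' h₁ hU hU', id⟩
    | _ => cases ha
  · rintro hp ⟨s, hs⟩ ⟨T, rfl, hc⟩
    have hT := hmem hs hc
    -- The peer of the choice is another participant, so there is someone to notify.
    obtain ⟨r, l, hl⟩ : ∃ r l, order = r :: l := by
      have : ∃ q, q ≠ p := by
        cases T with
        | branch q bs => exact ⟨q, (h.branch_ok q bs hT).1⟩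
        | select q bs => exact ⟨q, (h.select_ok q bs hT).1⟩
        | _ => exact hc.elim
      obtain ⟨q, hq⟩ := this
      exact List.exists_cons_of_ne_nil (List.ne_nil_of_mem ((hord q).2 hq))
    refine ⟨order, hn, hord, ⟨.sink, trivial⟩, ⟨.crash T hp hT hc, id⟩, ?_⟩
    have := exists_broadcastPath hord hp hT hc l r 0 hl trivial
    rwa [← hl] at this
  · rintro ⟨s, hs⟩ ⟨T, rfl, hk⟩ r hr
    exact ⟨.drain T r hk hr, id⟩
  · rintro δ ⟨hδ₁, hδ₂, hδ₃⟩ hδ ⟨⟨s, hs⟩, a, ⟨s', hs'⟩⟩ ⟨ht, hd⟩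
    dsimp only at ht hd
    cases ht with
    | recv => exact absurd trivial hd
    | send => exact absurd trivial hd
    | handle q bs T T' h₁ h₂ h₃ =>
      -- The crash label is never alone, so a data branch from `q` makes a receive of the crash
      -- message compulsory. Distinct labels and unique targets leave only the given transition for
      -- it.
      obtain ⟨-, hname, ⟨l, U⟩, hU, hl⟩ := h.branch_ok q bs h₁
      obtain ⟨U', hU'⟩ := h.exists_target (mem_subterms_of_branch h₁ hU)
      have hs'' := h.isState_of_target (mem_subterms_of_branch h₁ hU) hU'
      rcases l with ⟨l, B⟩ | _
      swap
      · exact absurd rfl hl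
      obtain ⟨⟨u, hu⟩, -, hm⟩ := hδ₁ ⟨_, hs⟩ q (l, B) ⟨_, hs''⟩ ⟨.recv q bs l B U U' h₁ hU hU',
        trivial⟩ ((haware q bs h₁).1 ⟨_, h₂, rfl⟩)
      obtain ⟨ht, -⟩ := hδ hm
      dsimp only at ht
      rcases ht.of_recv_crash with ⟨bs', V, V', hb, rfl, hV, hV'⟩ | ⟨V, hx, hk⟩
      · cases hb
        cases List.inj_on_of_nodup_map hname h₂ hV rfl
        cases h.target_unique h₃ hV'
        exact hm
      · cases hx
        exact hk.elim
    | crash T hp hT hc =>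
      obtain ⟨-, -, -, ⟨u, hu⟩, hm, -⟩ := hδ₂ hp ⟨_, hs⟩ ⟨T, rfl, hc⟩
      obtain ⟨ht, -⟩ := hδ hm
      cases ht.eq_sink
      exact hm
    | cast T i r hp hT hc hr =>
      -- The choice that comes with the `cast` transition is a state of `Q₁`; the broadcast required
      -- after a crash there must use this transition.
      have hTs : IsState p T₀ (.ty T) := Or.inl ⟨hT, not_isVar_of_isChoice hc⟩
      obtain ⟨rs, -, -, ⟨u, hu⟩, hm, hb⟩ := hδ₂ hp ⟨_, hTs⟩ ⟨T, rfl, hc⟩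
      obtain ⟨ht, -⟩ := hδ hm
      cases ht.eq_sink
      exact cast_mem_of_broadcastPath hn hδ hr rfl rfl rs 0 (Nat.zero_le i) _ rfl hb
    | drain T q hk hq => exact hδ₃ ⟨_, hs⟩ ⟨T, rfl, hk⟩ q hq

end Automaton

end LocalType

theorem Protocol.isCrashHandling {S : Protocol} (h : S.CrashAware) :
    S.system.IsCrashHandling S.reliable := fun p =>
  LocalType.isCrashHandling (S.order_nodup p) (S.mem_order p) (S.wf p) (h p)

end CrashStop

namespace CrashStop

/-! ### Reading words in prefix notation -/

def isChoiceWord (x : List ℕ) : Bool :=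
  decide (x.getD 0 0 = 0) || decide (x.getD 0 0 = 1)

def labelLength (x : List ℕ) : ℕ :=
  bif decide (x.getD 0 0 = 0) then 3 else 1

/-- Whether a type is to be read, the number of branches that remain to be read afterwards, the
rest of the word, and the suffixes at which a type has been read. -/
abbrev Scan := Bool × ℕ × List ℕ × List (List ℕ)

def scanType (s : Scan) : Scan :=
  bif isChoiceWord s.2.2.1 then
    (false, s.2.1 + s.2.2.1.getD 2 0, s.2.2.1.drop 3, s.2.2.2 ++ [s.2.2.1])
  else bif decide (s.2.2.1.getD 0 0 = 2) then
    (true, s.2.1, s.2.2.1.drop 2, s.2.2.2 ++ [s.2.2.1])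
  else bif decide (s.2.2.1.getD 0 0 = 3) then
    (false, s.2.1, s.2.2.1.drop 2, s.2.2.2 ++ [s.2.2.1])
  else (false, s.2.1, s.2.2.1.drop 1, s.2.2.2 ++ [s.2.2.1])

def scanStep (s : Scan) : Scan :=
  bif s.1 then scanType s
  else bif decide (s.2.1 = 0) then s
  else (true, s.2.1 - 1, s.2.2.1.drop (labelLength s.2.2.1), s.2.2.2)

/-- On the code of a type each step reads at least one number until the type is complete, so the
length of the word is enough. After that, `scanStep` stays at a fixed point. -/
def scan (x : List ℕ) : Scan :=
  scanStep^[x.length] (true, 0, x, [])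

/-- The word after its first type. -/
def skip (x : List ℕ) : List ℕ :=
  (scan x).2.2.1

/-- The suffixes that start with the subterms of the first type. -/
def visited (x : List ℕ) : List (List ℕ) :=
  (scan x).2.2.2

/-- The first type. -/
def code (x : List ℕ) : List ℕ :=
  x.take (x.length - (skip x).length)

def stripStep (x : List ℕ) : List ℕ :=
  bif decide (x.getD 0 0 = 2) then x.drop 2 else x

def stripWord (x : List ℕ) : List ℕ :=
  stripStep^[x.length] x

def branchStep (s : List ℕ × List (List ℕ × List ℕ)) : List ℕ × List (List ℕ × List ℕ) :=
  (skip (s.1.drop (labelLength s.1)),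
    s.2 ++ [(s.1.take (labelLength s.1), s.1.drop (labelLength s.1))])

/-- The labels of a choice, and the suffixes that start with the continuations. -/
def branches (x : List ℕ) : List (List ℕ × List ℕ) :=
  (branchStep^[x.getD 2 0] (x.drop 3, [])).2

section Primrec

variable {α : Type} [Primcodable α]

@[fun_prop]
theorem primrec_isChoiceWord {x : α → List ℕ} (hx : Primrec x) :
    Primrec fun a => isChoiceWord (x a) := by
  unfold isChoiceWord
  fun_prop

@[fun_prop]
theorem primrec_labelLength {x : α → List ℕ} (hx : Primrec x) :
    Primrec fun a => labelLength (x a) := by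
  unfold labelLength
  fun_prop

@[fun_prop]
theorem primrec_scanType {s : α → Scan} (hs : Primrec s) : Primrec fun a => scanType (s a) := by
  unfold scanType
  fun_prop

@[fun_prop]
theorem primrec_scanStep {s : α → Scan} (hs : Primrec s) : Primrec fun a => scanStep (s a) := by
  unfold scanStep
  fun_prop

@[fun_prop]
theorem primrec_scan {x : α → List ℕ} (hx : Primrec x) : Primrec fun a => scan (x a) := by
  unfold scan
  fun_prop

@[fun_prop]
theorem primrec_skip {x : α → List ℕ} (hx : Primrec x) : Primrec fun a => skip (x a) := by
  unfold skip
  fun_prop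

@[fun_prop]
theorem primrec_visited {x : α → List ℕ} (hx : Primrec x) : Primrec fun a => visited (x a) := by
  unfold visited
  fun_prop

@[fun_prop]
theorem primrec_code {x : α → List ℕ} (hx : Primrec x) : Primrec fun a => code (x a) := by
  unfold code
  fun_prop

@[fun_prop]
theorem primrec_stripWord {x : α → List ℕ} (hx : Primrec x) :
    Primrec fun a => stripWord (x a) := by
  unfold stripWord stripStep
  fun_prop

@[fun_prop]
theorem primrec_branches {x : α → List ℕ} (hx : Primrec x) : Primrec fun a => branches (x a) := by
  unfold branches branchStep
  fun_prop

end Primrec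

namespace LocalType

variable {n : ℕ}

/-- The word starts with the given type. -/
def Starts (T : LocalType (Fin n)) (x : List ℕ) : Prop :=
  ∃ y, x = T.encode ++ y

theorem labelLength_encode (l : Label) (x : List ℕ) :
    labelLength (l.encode ++ x) = l.encode.length := by
  cases l <;> simp [labelLength, Label.encode]

theorem length_label_encode_pos (l : Label) : 0 < l.encode.length := by
  cases l <;> simp [Label.encode]

mutual
-- The counter replaces a stack: a choice adds the number of its branches, each branch takes one
-- off, so after a complete type it is back at `k`. Suffixes are recorded in the order of
-- `subterms`.
theorem exists_scan : ∀ (T : LocalType (Fin n)) (k : ℕ) (y : List ℕ) (acc : List (List ℕ)),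
    ∃ m ≤ T.encode.length, ∃ L, scanStep^[m] (true, k, T.encode ++ y, acc) =
      (false, k, y, acc ++ L) ∧ List.Forall₂ Starts T.subterms L
  | branch q bs, k, y, acc => by
    obtain ⟨m, hm, L, h, hL⟩ := exists_scanL bs k y (acc ++ [(branch q bs).encode ++ y])
    refine ⟨m + 1, by simp [encode]; omega, ((branch q bs).encode ++ y) :: L, ?_,
      .cons ⟨y, rfl⟩ hL⟩
    rw [Function.iterate_succ_apply]
    have : scanStep (true, k, (branch q bs).encode ++ y, acc) =
        (false, k + bs.length, encodeL bs ++ y, acc ++ [(branch q bs).encode ++ y]) := by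
      simp [scanStep, scanType, isChoiceWord, encode]
    rw [this, h]
    simp
  | select q bs, k, y, acc => by
    obtain ⟨m, hm, L, h, hL⟩ := exists_scanL bs k y (acc ++ [(select q bs).encode ++ y])
    refine ⟨m + 1, by simp [encode]; omega, ((select q bs).encode ++ y) :: L, ?_,
      .cons ⟨y, rfl⟩ hL⟩
    rw [Function.iterate_succ_apply]
    have : scanStep (true, k, (select q bs).encode ++ y, acc) =
        (false, k + bs.length, encodeL bs ++ y, acc ++ [(select q bs).encode ++ y]) := by
      simp [scanStep, scanType, isChoiceWord, encode]
    rw [this, h]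
    simp
  | mu t T, k, y, acc => by
    obtain ⟨m, hm, L, h, hL⟩ := exists_scan T k y (acc ++ [(mu t T).encode ++ y])
    refine ⟨m + 1, by simp [encode]; omega, ((mu t T).encode ++ y) :: L, ?_,
      .cons ⟨y, rfl⟩ hL⟩
    rw [Function.iterate_succ_apply]
    have : scanStep (true, k, (mu t T).encode ++ y, acc) =
        (true, k, T.encode ++ y, acc ++ [(mu t T).encode ++ y]) := by
      simp [scanStep, scanType, isChoiceWord, encode]
    rw [this, h]
    simp
  | var t, k, y, acc =>
    ⟨1, by simp [encode], [(var t).encode ++ y],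
      by simp [scanStep, scanType, isChoiceWord, encode], .cons ⟨y, rfl⟩ .nil⟩
  | finished, k, y, acc =>
    ⟨1, by simp [encode], [finished.encode (n := n) ++ y],
      by simp [scanStep, scanType, isChoiceWord, encode], .cons ⟨y, rfl⟩ .nil⟩
  | crashed, k, y, acc =>
    ⟨1, by simp [encode], [crashed.encode (n := n) ++ y],
      by simp [scanStep, scanType, isChoiceWord, encode], .cons ⟨y, rfl⟩ .nil⟩
theorem exists_scanL : ∀ (bs : List (Label × LocalType (Fin n))) (k : ℕ) (y : List ℕ)
    (acc : List (List ℕ)), ∃ m ≤ (encodeL bs).length, ∃ L,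
      scanStep^[m] (false, k + bs.length, encodeL bs ++ y, acc) = (false, k, y, acc ++ L) ∧
        List.Forall₂ Starts (subtermsL bs) L
  | [], k, y, acc => ⟨0, Nat.zero_le _, [], by simp [encodeL], .nil⟩
  | (l, T) :: bs, k, y, acc => by
    obtain ⟨m, hm, L, h, hL⟩ := exists_scan T (k + bs.length) (encodeL bs ++ y) acc
    obtain ⟨m', hm', L', h', hL'⟩ := exists_scanL bs k y (acc ++ L)
    have hl := length_label_encode_pos l
    refine ⟨m' + (m + 1), by simp [encodeL]; omega, L ++ L', ?_, List.rel_append hL hL'⟩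
    rw [Function.iterate_add_apply, Function.iterate_succ_apply]
    have : scanStep (false, k + ((l, T) :: bs).length, encodeL ((l, T) :: bs) ++ y, acc) =
        (true, k + bs.length, T.encode ++ (encodeL bs ++ y), acc) := by
      simp [scanStep, encodeL, labelLength_encode]
    rw [this, h, h', List.append_assoc]
end

theorem scan_encode (T : LocalType (Fin n)) (y : List ℕ) :
    ∃ L, scan (T.encode ++ y) = (false, 0, y, L) ∧ List.Forall₂ Starts T.subterms L := by
  obtain ⟨m, hm, L, h, hL⟩ := exists_scan T 0 y []
  refine ⟨L, ?_, hL⟩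
  obtain ⟨i, hi⟩ := Nat.exists_eq_add_of_le' (hm.trans (by simp : _ ≤ (T.encode ++ y).length))
  rw [scan, hi, Function.iterate_add_apply, h]
  exact Function.iterate_fixed (by simp [scanStep]) i

theorem skip_encode (T : LocalType (Fin n)) (y : List ℕ) : skip (T.encode ++ y) = y := by
  obtain ⟨L, h, -⟩ := scan_encode T y
  rw [skip, h]

theorem forall₂_visited (T : LocalType (Fin n)) :
    List.Forall₂ Starts T.subterms (visited T.encode) := by
  obtain ⟨L, h, hL⟩ := scan_encode T []
  rw [List.append_nil] at h
  rwa [visited, h]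

theorem code_encode (T : LocalType (Fin n)) (y : List ℕ) : code (T.encode ++ y) = T.encode := by
  rw [code, skip_encode]
  simp

theorem exists_stripStep (T : LocalType (Fin n)) (y : List ℕ) :
    ∃ m ≤ T.encode.length, stripStep^[m] (T.encode ++ y) = T.strip.encode ++ y := by
  fun_induction strip T with
  | case1 t T ih =>
    obtain ⟨m, hm, h⟩ := ih
    refine ⟨m + 1, by simp [encode]; omega, ?_⟩
    rw [Function.iterate_succ_apply, ← h]
    simp [stripStep, encode]
  | case2 T h => exact ⟨0, Nat.zero_le _, rfl⟩

theorem head_encode_of_not_isMu {T : LocalType (Fin n)} (h : ¬ T.IsMu) (y : List ℕ) :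
    (T.encode ++ y).getD 0 0 ≠ 2 := by
  cases T <;> simp_all [encode, IsMu]

theorem stripWord_encode (T : LocalType (Fin n)) (y : List ℕ) :
    stripWord (T.encode ++ y) = T.strip.encode ++ y := by
  obtain ⟨m, hm, h⟩ := exists_stripStep T y
  obtain ⟨i, hi⟩ := Nat.exists_eq_add_of_le' (hm.trans (by simp : _ ≤ (T.encode ++ y).length))
  rw [stripWord, hi, Function.iterate_add_apply, h]
  refine Function.iterate_fixed ?_ i
  rw [stripStep, decide_eq_false (head_encode_of_not_isMu (strip_not_mu T) y), cond_false]

theorem exists_branchStep (bs : List (Label × LocalType (Fin n))) (y : List ℕ)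
    (acc : List (List ℕ × List ℕ)) : ∃ L,
      branchStep^[bs.length] (encodeL bs ++ y, acc) = (y, acc ++ L) ∧
        List.Forall₂ (fun b e => e.1 = b.1.encode ∧ Starts b.2 e.2) bs L := by
  induction bs generalizing acc with
  | nil => exact ⟨[], by simp [encodeL], .nil⟩
  | cons b bs ih =>
    obtain ⟨l, T⟩ := b
    obtain ⟨L, h, hL⟩ := ih (acc ++ [(l.encode, T.encode ++ (encodeL bs ++ y))])
    refine ⟨(l.encode, T.encode ++ (encodeL bs ++ y)) :: L, ?_, .cons ⟨rfl, _, rfl⟩ hL⟩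
    rw [List.length_cons, Function.iterate_succ_apply]
    have : branchStep (encodeL ((l, T) :: bs) ++ y, acc) =
        (encodeL bs ++ y, acc ++ [(l.encode, T.encode ++ (encodeL bs ++ y))]) := by
      simp [branchStep, encodeL, labelLength_encode, skip_encode]
    rw [this, h]
    simp

theorem forall₂_branches_branch (q : Fin n) (bs : List (Label × LocalType (Fin n)))
    (y : List ℕ) : List.Forall₂ (fun b e => e.1 = b.1.encode ∧ Starts b.2 e.2) bs
      (branches ((branch q bs).encode ++ y)) := by
  obtain ⟨L, h, hL⟩ := exists_branchStep bs y []
  simpa [branches, encode, h] using hL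

theorem forall₂_branches_select (q : Fin n) (bs : List (Label × LocalType (Fin n)))
    (y : List ℕ) : List.Forall₂ (fun b e => e.1 = b.1.encode ∧ Starts b.2 e.2) bs
      (branches ((select q bs).encode ++ y)) := by
  obtain ⟨L, h, hL⟩ := exists_branchStep bs y []
  simpa [branches, encode, h] using hL

/-! ### Unique readability -/

theorem label_encode_append_inj {l l' : Label} {x y : List ℕ}
    (h : l.encode ++ x = l'.encode ++ y) : l = l' ∧ x = y := by
  cases l <;> cases l' <;> simp_all [Label.encode]

mutual
-- The first number determines the constructor, and the stored number of branches tells where a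
-- choice ends. The rests `x` and `y` are needed for the induction.
theorem encode_append_inj : ∀ {T U : LocalType (Fin n)} {x y : List ℕ},
    T.encode ++ x = U.encode ++ y → T = U ∧ x = y
  | branch q bs, U, x, y, h => by
    cases U with
    | branch q' bs' =>
      simp only [encode, List.cons_append, List.cons.injEq, true_and] at h
      obtain ⟨rfl, rfl⟩ := encodeL_append_inj h.2.1 h.2.2
      exact ⟨by rw [Fin.ext h.1], rfl⟩
    | _ => simp [encode] at h
  | select q bs, U, x, y, h => by
    cases U with
    | select q' bs' =>
      simp only [encode, List.cons_append, List.cons.injEq, true_and] at h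
      obtain ⟨rfl, rfl⟩ := encodeL_append_inj h.2.1 h.2.2
      exact ⟨by rw [Fin.ext h.1], rfl⟩
    | _ => simp [encode] at h
  | mu t T, U, x, y, h => by
    cases U with
    | mu t' U =>
      simp only [encode, List.cons_append, List.cons.injEq, true_and] at h
      obtain ⟨rfl, rfl⟩ := encode_append_inj h.2
      exact ⟨by rw [h.1], rfl⟩
    | _ => simp [encode] at h
  | var t, U, x, y, h => by cases U <;> simp_all [encode]
  | finished, U, x, y, h => by cases U <;> simp_all [encode]
  | crashed, U, x, y, h => by cases U <;> simp_all [encode]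
theorem encodeL_append_inj : ∀ {bs bs' : List (Label × LocalType (Fin n))} {x y : List ℕ},
    bs.length = bs'.length → encodeL bs ++ x = encodeL bs' ++ y → bs = bs' ∧ x = y
  | [], bs', x, y, hl, h => by
    obtain rfl := List.length_eq_zero_iff.1 hl.symm
    exact ⟨rfl, h⟩
  | (l, T) :: bs, [], x, y, hl, h => by simp at hl
  | (l, T) :: bs, (l', T') :: bs', x, y, hl, h => by
    simp only [encodeL, List.append_assoc] at h
    obtain ⟨rfl, h₁⟩ := label_encode_append_inj h
    obtain ⟨rfl, h₂⟩ := encode_append_inj h₁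
    obtain ⟨rfl, rfl⟩ := encodeL_append_inj (Nat.succ.inj hl) h₂
    exact ⟨rfl, rfl⟩
end

theorem encode_injective : Function.Injective (encode (n := n)) := fun T U h =>
  (encode_append_inj (x := []) (y := []) (by rw [h])).1

end LocalType

end CrashStop

namespace CrashStop

/-! ### The table of a collection of local types -/

/-- The code of the type that is reached by continuing with the first type of `x`, given the
suffixes `V` at which the subterms start. -/
def targetWord (V : List (List ℕ)) (x : List ℕ) : List ℕ :=
  bif decide (x.getD 0 0 = 3) then
    code (stripWord (((V.filter fun w => decide (w.take 2 = [2, x.getD 1 0])).getD 0 []).drop 2))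
  else code (stripWord x)

def choiceEntries (p : ℕ) (V : List (List ℕ)) (w : List ℕ) : List Entry :=
  bif isChoiceWord w then
    (branches w).map fun e =>
      -- Codes of external choices begin with `0` and those of internal choices with `1`, whereas
      -- receives have kind `1` and sends kind `0`. The code of a label is also the code of its
      -- message.
      (p, 0 :: code w, (1 - w.getD 0 0, w.getD 1 0, e.1), 0 :: targetWord V e.2)
  else []

def crashEntries (p : ℕ) (w : List ℕ) : List Entry :=
  bif isChoiceWord w then [(p, 0 :: code w, (2, 0, []), [1])] else []

/-- The numbers agree with `stateWord`: `0` begins the codes of types, `1` is the sink, `2` begins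
the codes of the other broadcast states. -/
def castSourceWord (order : List ℕ) (i : ℕ) : List ℕ :=
  bif decide (i = 0) then [1] else [2, order.getD (i - 1) 0]

def castTargetWord (order : List ℕ) (i : ℕ) : List ℕ :=
  bif decide (i + 1 = order.length) then [0, 5] else castSourceWord order (i + 1)

def castEntries (p : ℕ) (order : List ℕ) : List Entry :=
  (List.range order.length).map fun i =>
    (p, castSourceWord order i, (0, order.getD i 0, [1]), castTargetWord order i)

/-- The codes `4` and `5` are those of `finished` and `crashed`. Both are listed whether or not they
occur in the type, in accordance with `Trans.drain`. -/
def drainEntries (n p : ℕ) : List Entry :=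
  (List.range n).flatMap fun q =>
    bif decide (q = p) then []
    else [(p, [0, 4], (1, q, [1]), [0, 4]), (p, [0, 5], (1, q, [1]), [0, 5])]

/-- The transitions of participant `p` out of `n`, which is unreliable if `u` holds, for the
broadcast order and the local type with the given codes. -/
def entries (n p : ℕ) (u : Bool) (order x : List ℕ) : List Entry :=
  (visited x).flatMap (choiceEntries p (visited x)) ++
    ((bif u then (visited x).flatMap (crashEntries p) else []) ++
      ((bif u && (visited x).any isChoiceWord then castEntries p order else []) ++
        drainEntries n p))

/-- The unread word begins with the reliability of `p`, the length of its broadcast order, this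
order, and its type; the entries and initial states found so far are carried along. -/
def tableStep (n : ℕ) (s : List ℕ × List Entry × List (List ℕ)) (p : ℕ) :
    List ℕ × List Entry × List (List ℕ) :=
  (skip (s.1.drop (2 + s.1.getD 1 0)),
    s.2.1 ++ entries n p (decide (s.1.getD 0 0 = 0)) ((s.1.drop 2).take (s.1.getD 1 0))
      (code (s.1.drop (2 + s.1.getD 1 0))),
    s.2.2 ++ [0 :: code (stripWord (s.1.drop (2 + s.1.getD 1 0)))])

/-- The table of the collection of local types with the given code. -/
def table (x : List ℕ) : Table :=
  (x.getD 0 0, ((List.range (x.getD 0 0)).foldl (tableStep (x.getD 0 0)) (x.drop 1, [], [])).2)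

section Primrec

variable {α : Type} [Primcodable α]

@[fun_prop]
theorem primrec_targetWord {V : α → List (List ℕ)} {x : α → List ℕ} (hV : Primrec V)
    (hx : Primrec x) : Primrec fun a => targetWord (V a) (x a) := by
  unfold targetWord
  fun_prop

@[fun_prop]
theorem primrec_choiceEntries {p : α → ℕ} {V : α → List (List ℕ)} {w : α → List ℕ}
    (hp : Primrec p) (hV : Primrec V) (hw : Primrec w) :
    Primrec fun a => choiceEntries (p a) (V a) (w a) := by
  unfold choiceEntries
  fun_prop

@[fun_prop]
theorem primrec_crashEntries {p : α → ℕ} {w : α → List ℕ} (hp : Primrec p) (hw : Primrec w) :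
    Primrec fun a => crashEntries (p a) (w a) := by
  unfold crashEntries
  fun_prop

@[fun_prop]
theorem primrec_castSourceWord {o : α → List ℕ} {i : α → ℕ} (ho : Primrec o) (hi : Primrec i) :
    Primrec fun a => castSourceWord (o a) (i a) := by
  unfold castSourceWord
  fun_prop

@[fun_prop]
theorem primrec_castTargetWord {o : α → List ℕ} {i : α → ℕ} (ho : Primrec o) (hi : Primrec i) :
    Primrec fun a => castTargetWord (o a) (i a) := by
  unfold castTargetWord
  fun_prop

@[fun_prop]
theorem primrec_castEntries {p : α → ℕ} {o : α → List ℕ} (hp : Primrec p) (ho : Primrec o) :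
    Primrec fun a => castEntries (p a) (o a) := by
  unfold castEntries
  fun_prop

@[fun_prop]
theorem primrec_drainEntries {n p : α → ℕ} (hn : Primrec n) (hp : Primrec p) :
    Primrec fun a => drainEntries (n a) (p a) := by
  unfold drainEntries
  fun_prop

@[fun_prop]
theorem primrec_entries {n p : α → ℕ} {u : α → Bool} {o x : α → List ℕ} (hn : Primrec n)
    (hp : Primrec p) (hu : Primrec u) (ho : Primrec o) (hx : Primrec x) :
    Primrec fun a => entries (n a) (p a) (u a) (o a) (x a) := by
  unfold entries
  fun_prop

@[fun_prop]
theorem primrec_tableStep {n p : α → ℕ} {s : α → List ℕ × List Entry × List (List ℕ)}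
    (hn : Primrec n) (hs : Primrec s) (hp : Primrec p) :
    Primrec fun a => tableStep (n a) (s a) (p a) := by
  unfold tableStep
  fun_prop

theorem primrec_table : Primrec table := by
  unfold table
  fun_prop

end Primrec

end CrashStop

-- Correctness of the table

namespace CrashStop

theorem exists_of_forall₂_left {α β : Type} {R : α → β → Prop} {l : List α} {l' : List β}
    (h : List.Forall₂ R l l') {a : α} (ha : a ∈ l) : ∃ b ∈ l', R a b := by
  induction h with
  | nil => simp at ha
  | cons hab _ ih =>
    rcases List.mem_cons.1 ha with rfl | ha
    · exact ⟨_, List.mem_cons_self .., hab⟩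
    · obtain ⟨b, hb, h⟩ := ih ha
      exact ⟨b, List.mem_cons_of_mem _ hb, h⟩

theorem exists_of_forall₂_right {α β : Type} {R : α → β → Prop} {l : List α} {l' : List β}
    (h : List.Forall₂ R l l') {b : β} (hb : b ∈ l') : ∃ a ∈ l, R a b :=
  exists_of_forall₂_left h.flip hb

namespace LocalType

variable {n : ℕ}

def stateWord : TState (Fin n) → List ℕ
  | .ty T => 0 :: T.encode
  | .sink => [1]
  | .sent r => [2, r]

def msgWord : CMsg Payload → List ℕ
  | .data (l, B) => [0, l, B]
  | .crash => [1]

theorem stateWord_injective : Function.Injective (stateWord (n := n)) := by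
  intro s s' h
  cases s <;> cases s' <;> simp_all [stateWord, encode_injective.eq_iff, Fin.val_inj]

theorem msgWord_injective : Function.Injective msgWord := by
  intro m m' h
  rcases m with ⟨l, B⟩ | _ <;> rcases m' with ⟨l', B'⟩ | _ <;> simp_all [msgWord]

theorem isChoiceWord_encode {T : LocalType (Fin n)} {y : List ℕ} :
    isChoiceWord (T.encode ++ y) = true ↔ T.IsChoice := by
  cases T <;> simp [isChoiceWord, encode, IsChoice]

section Entries

variable {p : Fin n} {rel : Finset (Fin n)} {order : List (Fin n)} {T₀ : LocalType (Fin n)}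

/-- The suffix found for a variable starts with a recursion on the same variable; as bound variables
are distinct, it is the right recursion. -/
theorem WellFormed.targetWord_eq (h : WellFormed p T₀) {T T' : LocalType (Fin n)} {x : List ℕ}
    (ht : Target T₀ T T') (hx : Starts T x) : targetWord (visited T₀.encode) x = T'.encode := by
  obtain ⟨y, rfl⟩ := hx
  cases ht with
  | direct _ hv =>
    have : (T.encode ++ y).getD 0 0 ≠ 3 := by
      cases T <;> simp_all [encode, IsVar]
    rw [targetWord, decide_eq_false this, cond_false, stripWord_encode, code_encode]
  | loop t U hU =>
    have hV := forall₂_visited T₀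
    set V := visited T₀.encode
    have hx : ((var (P := Fin n) t).encode ++ y).getD 0 0 = 3 := by simp [encode]
    have hx' : ((var (P := Fin n) t).encode ++ y).getD 1 0 = t := by simp [encode]
    rw [targetWord, decide_eq_true hx, cond_true, hx']
    obtain ⟨w, hw, z, rfl⟩ := exists_of_forall₂_left hV hU
    have hmem : (mu t U).encode ++ z ∈ V.filter fun w => decide (w.take 2 = [2, t]) :=
      List.mem_filter.2 ⟨hw, by simp [encode]⟩
    obtain ⟨v, l, hl⟩ := List.exists_cons_of_ne_nil (List.ne_nil_of_mem hmem)
    have hv : v ∈ V.filter fun w => decide (w.take 2 = [2, t]) := hl ▸ List.mem_cons_self ..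
    obtain ⟨hvV, hv⟩ := List.mem_filter.1 hv
    obtain ⟨W, hW, z', rfl⟩ := exists_of_forall₂_right hV hvV
    rw [hl]
    cases W with
    | mu t' W =>
      obtain rfl : t' = t := by simpa [encode] using hv
      cases mu_unique h.unique hW hU
      simp [encode, stripWord_encode, code_encode]
    | _ => simp [encode] at hv

theorem castSourceWord_eq {i : ℕ} (hi : i < order.length) :
    castSourceWord (order.map Fin.val) i = stateWord (castSource order i) := by
  rcases i with _ | i
  · rfl
  · rw [castSource_succ (List.getElem?_eq_getElem (Nat.lt_of_succ_lt hi))]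
    simp [castSourceWord, stateWord, Nat.lt_of_succ_lt hi]

theorem castTargetWord_eq {i : ℕ} (hi : i < order.length) :
    castTargetWord (order.map Fin.val) i = stateWord (castTarget order i) := by
  unfold castTargetWord castTarget
  by_cases h : i + 1 = order.length
  · simp [h, stateWord, encode]
  · simp [h, castSourceWord_eq (show i + 1 < order.length by omega)]

/-- Each item of `branches` stems from a branch of the choice. A crash label gives a handling
transition in an external choice and cannot occur in an internal one. -/
theorem WellFormed.exists_of_mem_choiceEntries (h : WellFormed p T₀) {T : LocalType (Fin n)}
    (hT : T ∈ T₀.subterms) {w : List ℕ} (hw : Starts T w) {e : Entry}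
    (he : e ∈ choiceEntries p (visited T₀.encode) w) : ∃ s a s', Trans p rel order T₀ s a s' ∧
      e = (p.val, stateWord s, actCode msgWord a, stateWord s') := by
  obtain ⟨y, rfl⟩ := hw
  unfold choiceEntries at he
  by_cases hc : T.IsChoice
  swap
  · rw [Bool.eq_false_iff.2 (mt isChoiceWord_encode.1 hc)] at he
    simp at he
  rw [isChoiceWord_encode.2 hc, cond_true, code_encode] at he
  obtain ⟨⟨l', x⟩, hb, rfl⟩ := List.mem_map.1 he
  cases T with
  | branch q bs =>
    obtain ⟨⟨l, U⟩, hU, rfl, hx⟩ := exists_of_forall₂_right (forall₂_branches_branch q bs y) hb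
    have hU₀ := mem_subterms_of_branch hT hU
    obtain ⟨U', hU'⟩ := h.exists_target hU₀
    rw [h.targetWord_eq hU' hx]
    rcases l with ⟨l, B⟩ | _
    · exact ⟨_, _, _, .recv q bs l B U U' hT hU hU', by
        simp [encode, stateWord, actCode, msgWord, Label.encode]⟩
    · exact ⟨_, _, _, .handle q bs U U' hT hU hU', by
        simp [encode, stateWord, actCode, msgWord, Label.encode]⟩
  | select q bs =>
    obtain ⟨⟨l, U⟩, hU, rfl, hx⟩ := exists_of_forall₂_right (forall₂_branches_select q bs y) hb
    have hU₀ := mem_subterms_of_select hT hU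
    obtain ⟨U', hU'⟩ := h.exists_target hU₀
    rw [h.targetWord_eq hU' hx]
    rcases l with ⟨l, B⟩ | _
    · exact ⟨_, _, _, .send q bs l B U U' hT hU hU', by
        simp [encode, stateWord, actCode, msgWord, Label.encode]⟩
    · exact absurd rfl ((h.select_ok q bs hT).2.2.2 _ hU)
  | _ => exact hc.elim

theorem WellFormed.mem_choiceEntries_of_branch (h : WellFormed p T₀) {q : Fin n} {l : Label}
    {bs : List (Label × LocalType (Fin n))} {T T' : LocalType (Fin n)}
    (hT : (l, T) ∈ bs) (hT' : Target T₀ T T') {w : List ℕ} (hw : Starts (branch q bs) w) :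
    (p.val, 0 :: (branch q bs).encode, (1, q.val, l.encode), 0 :: T'.encode) ∈
      choiceEntries p (visited T₀.encode) w := by
  obtain ⟨y, rfl⟩ := hw
  obtain ⟨⟨l', x⟩, hb, rfl, hx⟩ := exists_of_forall₂_left (forall₂_branches_branch q bs y) hT
  rw [choiceEntries, (isChoiceWord_encode (T := branch q bs)).2 trivial, cond_true, code_encode]
  refine List.mem_map.2 ⟨_, hb, ?_⟩
  rw [h.targetWord_eq hT' hx]
  simp [encode]

theorem WellFormed.mem_choiceEntries_of_select (h : WellFormed p T₀) {q : Fin n} {l : Label}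
    {bs : List (Label × LocalType (Fin n))} {T T' : LocalType (Fin n)}
    (hT : (l, T) ∈ bs) (hT' : Target T₀ T T') {w : List ℕ} (hw : Starts (select q bs) w) :
    (p.val, 0 :: (select q bs).encode, (0, q.val, l.encode), 0 :: T'.encode) ∈
      choiceEntries p (visited T₀.encode) w := by
  obtain ⟨y, rfl⟩ := hw
  obtain ⟨⟨l', x⟩, hb, rfl, hx⟩ := exists_of_forall₂_left (forall₂_branches_select q bs y) hT
  rw [choiceEntries, (isChoiceWord_encode (T := select q bs)).2 trivial, cond_true, code_encode]
  refine List.mem_map.2 ⟨_, hb, ?_⟩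
  rw [h.targetWord_eq hT' hx]
  simp [encode]

theorem any_isChoiceWord_iff :
    (visited T₀.encode).any isChoiceWord = true ↔ ∃ T ∈ T₀.subterms, T.IsChoice := by
  rw [List.any_eq_true]
  constructor
  · rintro ⟨w, hw, hc⟩
    obtain ⟨T, hT, y, rfl⟩ := exists_of_forall₂_right (forall₂_visited T₀) hw
    exact ⟨T, hT, isChoiceWord_encode.1 hc⟩
  · rintro ⟨T, hT, hc⟩
    obtain ⟨w, hw, y, rfl⟩ := exists_of_forall₂_left (forall₂_visited T₀) hT
    exact ⟨_, hw, isChoiceWord_encode.2 hc⟩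

theorem WellFormed.exists_of_mem_entries (h : WellFormed p T₀) {e : Entry}
    (he : e ∈ entries n p (decide (p ∉ rel)) (order.map Fin.val) T₀.encode) :
    ∃ s a s', Trans p rel order T₀ s a s' ∧
      e = (p.val, stateWord s, actCode msgWord a, stateWord s') := by
  simp only [entries, List.mem_append] at he
  rcases he with he | he | he | he
  · obtain ⟨w, hw, he⟩ := List.mem_flatMap.1 he
    obtain ⟨T, hT, hTw⟩ := exists_of_forall₂_right (forall₂_visited T₀) hw
    exact h.exists_of_mem_choiceEntries hT hTw he
  · by_cases hp : p ∉ rel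
    swap
    · simp [hp] at he
    rw [decide_eq_true hp, cond_true] at he
    obtain ⟨w, hw, he⟩ := List.mem_flatMap.1 he
    obtain ⟨T, hT, y, rfl⟩ := exists_of_forall₂_right (forall₂_visited T₀) hw
    unfold crashEntries at he
    by_cases hc : T.IsChoice
    · rw [isChoiceWord_encode.2 hc, cond_true, List.mem_singleton, code_encode] at he
      exact ⟨_, _, _, .crash T hp hT hc, he⟩
    · rw [Bool.eq_false_iff.2 (mt isChoiceWord_encode.1 hc)] at he
      simp at he
  · by_cases hp : (decide (p ∉ rel) && (visited T₀.encode).any isChoiceWord) = true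
    swap
    · rw [Bool.eq_false_iff.2 hp] at he
      simp at he
    rw [hp, cond_true] at he
    rw [Bool.and_eq_true, decide_eq_true_iff, any_isChoiceWord_iff] at hp
    obtain ⟨hp, T, hT, hc⟩ := hp
    obtain ⟨i, hi, rfl⟩ := List.mem_map.1 he
    have hi : i < order.length := by simpa using hi
    refine ⟨_, _, _, .cast T i order[i] hp hT hc (List.getElem?_eq_getElem hi), ?_⟩
    rw [castSourceWord_eq hi, castTargetWord_eq hi]
    simp [actCode, msgWord, hi]
  · obtain ⟨q, hq, he⟩ := List.mem_flatMap.1 he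
    have hq : q < n := List.mem_range.1 hq
    by_cases hqp : q = p
    · simp [hqp] at he
    have hne : (⟨q, hq⟩ : Fin n) ≠ p := fun h => hqp (congrArg Fin.val h)
    simp only [hqp, decide_false, cond_false, List.mem_cons, List.not_mem_nil, or_false] at he
    rcases he with rfl | rfl
    · exact ⟨_, _, _, .drain finished ⟨q, hq⟩ trivial hne, by
        simp [stateWord, encode, actCode, msgWord]⟩
    · exact ⟨_, _, _, .drain crashed ⟨q, hq⟩ trivial hne, by
        simp [stateWord, encode, actCode, msgWord]⟩

theorem WellFormed.mem_entries (h : WellFormed p T₀) {s s' : TState (Fin n)}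
    {a : Act (Fin n) (CMsg Payload)} (ht : Trans p rel order T₀ s a s') :
    (p.val, stateWord s, actCode msgWord a, stateWord s') ∈
      entries n p (decide (p ∉ rel)) (order.map Fin.val) T₀.encode := by
  have hV := forall₂_visited T₀
  simp only [entries, List.mem_append]
  cases ht with
  | recv q bs l B T T' h₁ h₂ h₃ =>
    obtain ⟨w, hw, hTw⟩ := exists_of_forall₂_left hV h₁
    exact Or.inl (List.mem_flatMap.2 ⟨w, hw, h.mem_choiceEntries_of_branch h₂ h₃ hTw⟩)
  | send q bs l B T T' h₁ h₂ h₃ =>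
    obtain ⟨w, hw, hTw⟩ := exists_of_forall₂_left hV h₁
    exact Or.inl (List.mem_flatMap.2 ⟨w, hw, h.mem_choiceEntries_of_select h₂ h₃ hTw⟩)
  | handle q bs T T' h₁ h₂ h₃ =>
    obtain ⟨w, hw, hTw⟩ := exists_of_forall₂_left hV h₁
    exact Or.inl (List.mem_flatMap.2 ⟨w, hw, h.mem_choiceEntries_of_branch h₂ h₃ hTw⟩)
  | crash T hp hT hc =>
    obtain ⟨w, hw, y, rfl⟩ := exists_of_forall₂_left hV hT
    refine Or.inr (Or.inl ?_)
    rw [decide_eq_true hp, cond_true]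
    refine List.mem_flatMap.2 ⟨_, hw, ?_⟩
    rw [crashEntries, isChoiceWord_encode.2 hc, cond_true, code_encode]
    exact List.mem_singleton.2 rfl
  | cast T i r hp hT hc hr =>
    refine Or.inr (Or.inr (Or.inl ?_))
    rw [decide_eq_true hp, any_isChoiceWord_iff.2 ⟨T, hT, hc⟩, Bool.and_self, cond_true]
    obtain ⟨hi, rfl⟩ := List.getElem?_eq_some_iff.1 hr
    refine List.mem_map.2 ⟨i, by simpa using hi, ?_⟩
    rw [castSourceWord_eq hi, castTargetWord_eq hi]
    simp [actCode, msgWord, hi]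
  | drain T q hk hq =>
    refine Or.inr (Or.inr (Or.inr (List.mem_flatMap.2 ⟨q, List.mem_range.2 q.isLt, ?_⟩)))
    rw [decide_eq_false (fun h => hq (Fin.ext h)), cond_false]
    cases T with
    | finished => exact .head _
    | crashed => exact .tail _ (.head _)
    | _ => exact hk.elim

end Entries

end LocalType

-- The table as a coding of the generated system

namespace Protocol

open LocalType

variable (S : Protocol)

/-- The code of the data of one participant. -/
def block (p : Fin S.n) : List ℕ :=
  (if p ∈ S.reliable then 1 else 0) ::
    ((S.order p).length :: (S.order p).map Fin.val ++ (S.type p).encode)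

/-- Blocks are self-delimiting, so each step leaves exactly the blocks of the remaining
participants. -/
theorem foldl_tableStep (L : List (Fin S.n)) (E : List Entry) (I : List (List ℕ)) :
    (L.map Fin.val).foldl (tableStep S.n) (L.flatMap S.block, E, I) =
      ([], E ++ L.flatMap (fun p : Fin S.n => entries S.n p (decide (p ∉ S.reliable))
          ((S.order p).map Fin.val) (S.type p).encode),
        I ++ L.map fun p => 0 :: (S.type p).strip.encode) := by
  induction L generalizing E I with
  | nil => simp
  | cons p L ih =>
    have hd : ((p :: L).flatMap S.block).drop (2 + (S.order p).length) =
        (S.type p).encode ++ L.flatMap S.block := by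
      have : (p :: L).flatMap S.block = ((if p ∈ S.reliable then 1 else 0) ::
        (S.order p).length :: (S.order p).map Fin.val) ++
          ((S.type p).encode ++ L.flatMap S.block) := by simp [block]
      rw [this, List.drop_left']
      simp; omega
    have ho : (((p :: L).flatMap S.block).drop 2).take (S.order p).length =
        (S.order p).map Fin.val := by
      simp [block]
    have h₀ : ((p :: L).flatMap S.block).getD 1 0 = (S.order p).length := by simp [block]
    have h₁ : decide (((p :: L).flatMap S.block).getD 0 0 = 0) = decide (p ∉ S.reliable) := by
      by_cases hp : p ∈ S.reliable <;> simp [block, hp]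
    rw [List.map_cons, List.foldl_cons, tableStep]
    dsimp only
    rw [h₀, h₁, hd, ho, skip_encode, code_encode, stripWord_encode, code_encode, ih]
    simp

theorem table_encode : table S.encode = (S.n, (List.finRange S.n).flatMap (fun p : Fin S.n =>
      entries S.n p (decide (p ∉ S.reliable)) ((S.order p).map Fin.val) (S.type p).encode),
    (List.finRange S.n).map fun p => 0 :: (S.type p).strip.encode) := by
  have := S.foldl_tableStep (List.finRange S.n) [] []
  have hr : (List.finRange S.n).map Fin.val = List.range S.n := by
    simp
  rw [hr] at this
  have hn : S.encode.getD 0 0 = S.n := rfl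
  have hd : S.encode.drop 1 = (List.finRange S.n).flatMap S.block := rfl
  rw [table, hn, hd, this]
  simp

/-- Some entries start in control states that the automaton lacks, such as `finished` if it does not
occur. Soundness is only asked for actual states, and from these `Trans.isState` yields an actual
target. -/
def coding : Coding S.system (table S.encode) where
  size_eq := by rw [table_encode]
  st p s := stateWord s.1
  msg := msgWord
  msg_inj := msgWord_injective
  init_eq p := by
    rw [table_encode]
    simp [system, toAutomaton, stateWord]
  complete p s a s' ht := by
    rw [table_encode]
    have ht' : Trans p S.reliable (S.order p) (S.type p) s.1 a s'.1 := ht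
    exact List.mem_flatMap.2 ⟨p, List.mem_finRange p, (S.wf p).mem_entries ht'⟩
  sound p s x w he := by
    rw [table_encode] at he
    obtain ⟨q, -, he⟩ := List.mem_flatMap.1 he
    obtain ⟨u, a, u', ht, he⟩ := (S.wf q).exists_of_mem_entries he
    simp only [Prod.mk.injEq] at he
    obtain ⟨hq, hu, rfl, rfl⟩ := he
    obtain rfl := Fin.ext hq
    obtain rfl := stateWord_injective hu
    exact ⟨a, ⟨u', ht.isState (S.wf p) (S.mem_order p) s.2⟩, rfl, rfl, ht⟩

end Protocol

end CrashStop

theorem theorem6 :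
    (∀ S : CrashStop.Protocol, S.CrashAware → S.system.IsCrashHandling S.reliable) ∧
    (∃ f : List ℕ → Bool, Computable f ∧
      ∀ S : CrashStop.Protocol, f S.encode = true ↔ S.system.IsRSC) ∧
    (∃ g : ℕ × List ℕ → Bool, Computable g ∧
      ∀ (k : ℕ) (S : CrashStop.Protocol), g (k, S.encode) = true ↔ S.system.IsWMC k) := by
  refine ⟨fun S => S.isCrashHandling, ?_, ?_⟩
  · obtain ⟨f, hf, h⟩ := CrashStop.exists_computable_isRSC
    exact ⟨fun x => f (CrashStop.table x), hf.comp CrashStop.primrec_table.to_comp,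
      fun S => h _ _ _ _ S.coding⟩
  · obtain ⟨f, hf, h⟩ := CrashStop.exists_computable_isWMC
    exact ⟨fun x => f (x.1, CrashStop.table x.2), hf.comp (Computable.fst.pair
      (CrashStop.primrec_table.to_comp.comp Computable.snd)), fun k S => h _ _ _ _ S.coding k⟩
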